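/- **Theorem.** Let $U$ be a finite linearly ordered set with $n$ elements. For $A,B\subseteq U$ put $I_{A,B}=(-1)^{|\{(a,b)\in A\times B\,:\,a>b\}|}$, and for $f,g:2^U\to\mathbb Z$ let the *Non-commutative Subset Convolution* be $$(f\diamond g)(X)=\sum_{A\cup B=X,\ A\cap B=\emptyset} f(A)\,g(B)\,I_{A,B}\qquad(X\subseteq U).$$ Algorithms are programs of a random access machine with integer arrays, indirect addressing and the operations $+,-,\times$ and integer division, whose running time is measured in bit operations: each operation is charged according to the bit lengths of its operands and of the cell addresses it uses. Call a real number $w$ an *admissible exponent* if there are a program and constants $C,c$ such that for all $N\ge 1$ and $b\ge 0$ the program multiplies any two $N\times N$ integer matrices with entries of absolute value less than $2^b$ in time at most $C\,N^{w}(b+\lfloor\log_2N\rfloor+1)^c$. Let $\omega$, the matrix multiplication exponent, be the infimum of the admissible exponents. Then the Non-commutative Subset Convolution can be computed in time $O^*(2^{\omega n/2})$. Precisely: 1. for every real $w>\omega$ there are a program and constants $C,c$ such that, for every finite linearly ordered set $U$, with $n\ge 0$ elements, every $b\ge 0$ and all $f,g:2^U\to\mathbb Z$ with values of absolute value less than $2^b$,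 the program, given $n$ and the tables of $f$ and $g$, outputs the table of all $2^n$ values of $f\diamond g$ in time at most $$C\cdot 2^{wn/2}\,(n+b+1)^{c};$$ 2. the same holds for every admissible exponent $w$, in particular for $w=\omega$ if the infimum is attained. -/

import Mathlib

namespace NSC

/-! ## The convolution -/

/-- The sign `I_{A,B} = (-1)^{|{(a,b) ∈ A × B : a > b}|}`. -/
def invSign {U : Type*} [LinearOrder U] (A B : Finset U) : ℤ :=
  (-1) ^ ((A ×ˢ B).filter (fun p => p.1 > p.2)).card

/-- The Non-commutative Subset Convolution
`(f ◇ g)(X) = ∑_{A ⊎ B = X} f(A) g(B) I_{A,B}`. -/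
def nsc {U : Type*} [Fintype U] [LinearOrder U] (f g : Finset U → ℤ) (X : Finset U) : ℤ :=
  ∑ p : Finset U × Finset U with p.1 ∪ p.2 = X ∧ p.1 ∩ p.2 = ∅,
    f p.1 * g p.2 * invSign p.1 p.2

/-! ## The machine model

A random access machine with finitely many integer arrays (an array named by a number that occurs
in the program; a scalar variable is a cell of an array), arbitrary integers in the cells, indirect
addressing, structured control flow, and bit cost: every elementary operation is charged for the
length of the integers, cell addresses included, on which it works. -/

/-- Memory contents: `s a i` is the integer in cell `i` of array `a`. -/
abbrev Memory : Type := ℕ → ℤ → ℤ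

/-- The number of bits charged for an integer (its binary length, plus one for the sign). -/
def bits (z : ℤ) : ℕ := Nat.size z.natAbs + 1

/-- Arithmetic expressions: integer literals, array cells with a computed address,
sum, difference, product and integer quotient. -/
inductive Exp : Type
  | const (z : ℤ)
  | cell (a : ℕ) (i : Exp)
  | add (d e : Exp)
  | sub (d e : Exp)
  | mul (d e : Exp)
  | div (d e : Exp)

/-- The value of an expression. -/
def Exp.val (s : Memory) : Exp → ℤ
  | .const z => z
  | .cell a i => s a (i.val s)
  | .add d e => d.val s + e.val s
  | .sub d e => d.val s - e.val s
  | .mul d e => d.val s * e.val s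
  | .div d e => d.val s / e.val s

/-- The bit cost of evaluating an expression. Addition and subtraction are charged linearly,
multiplication and division quadratically. -/
def Exp.cost (s : Memory) : Exp → ℕ
  | .const z => bits z
  | .cell a i => i.cost s + bits (i.val s) + bits (s a (i.val s))
  | .add d e => d.cost s + e.cost s + (bits (d.val s) + bits (e.val s))
  | .sub d e => d.cost s + e.cost s + (bits (d.val s) + bits (e.val s))
  | .mul d e => d.cost s + e.cost s + bits (d.val s) * bits (e.val s)
  | .div d e => d.cost s + e.cost s + bits (d.val s) * bits (e.val s)

/-- Programs. The tests of `ite` and `loop` ask whether the expression is positive. -/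
inductive Prog : Type
  | skip
  | store (a : ℕ) (i e : Exp)
  | seq (p q : Prog)
  | ite (e : Exp) (p q : Prog)
  | loop (e : Exp) (p : Prog)

/-- `Exec p s t s'`: the program `p`, started on the memory `s`, halts after time `t` (in bit
operations) with the memory `s'`. -/
inductive Exec : Prog → Memory → ℕ → Memory → Prop
  | skip (s : Memory) : Exec .skip s 1 s
  | store (a : ℕ) (i e : Exp) (s : Memory) :
      Exec (.store a i e) s (i.cost s + e.cost s + bits (i.val s) + bits (e.val s))
        (Function.update s a (Function.update (s a) (i.val s) (e.val s)))
  | seq {p q : Prog} {s s₁ s₂ : Memory} {t₁ t₂ : ℕ}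
      (h₁ : Exec p s t₁ s₁) (h₂ : Exec q s₁ t₂ s₂) : Exec (.seq p q) s (t₁ + t₂) s₂
  | ite_pos {e : Exp} {p q : Prog} {s s₁ : Memory} {t : ℕ}
      (he : 0 < e.val s) (h : Exec p s t s₁) :
      Exec (.ite e p q) s (e.cost s + bits (e.val s) + t) s₁
  | ite_neg {e : Exp} {p q : Prog} {s s₁ : Memory} {t : ℕ}
      (he : ¬ 0 < e.val s) (h : Exec q s t s₁) :
      Exec (.ite e p q) s (e.cost s + bits (e.val s) + t) s₁
  | loop_done {e : Exp} {p : Prog} {s : Memory} (he : ¬ 0 < e.val s) :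
      Exec (.loop e p) s (e.cost s + bits (e.val s)) s
  | loop_step {e : Exp} {p : Prog} {s s₁ s₂ : Memory} {t₁ t₂ : ℕ}
      (he : 0 < e.val s) (h₁ : Exec p s t₁ s₁) (h₂ : Exec (.loop e p) s₁ t₂ s₂) :
      Exec (.loop e p) s (e.cost s + bits (e.val s) + t₁ + t₂) s₂

/-- `p`, started on `s`, halts within time `T` in a memory with the property `Q`. -/
def HaltsWithin (p : Prog) (s : Memory) (T : ℝ) (Q : Memory → Prop) : Prop :=
  ∃ (t : ℕ) (s' : Memory), Exec p s t s' ∧ (t : ℝ) ≤ T ∧ Q s'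

/-- Execution is deterministic, both in the result and in the running time. -/
theorem Exec.deterministic {p : Prog} {s s₁ s₂ : Memory} {t₁ t₂ : ℕ}
    (h₁ : Exec p s t₁ s₁) (h₂ : Exec p s t₂ s₂) : t₁ = t₂ ∧ s₁ = s₂ := by
  induction h₁ generalizing t₂ s₂ with
  | skip s => cases h₂; exact ⟨rfl, rfl⟩
  | store a i e s => cases h₂; exact ⟨rfl, rfl⟩
  | seq _ _ ih ih' =>
    cases h₂ with
    | seq k k' =>
      obtain ⟨rfl, rfl⟩ := ih k
      obtain ⟨rfl, rfl⟩ := ih' k'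
      exact ⟨rfl, rfl⟩
  | ite_pos he _ ih =>
    cases h₂ with
    | ite_pos _ k => obtain ⟨rfl, rfl⟩ := ih k; exact ⟨rfl, rfl⟩
    | ite_neg he' _ => exact absurd he he'
  | ite_neg he _ ih =>
    cases h₂ with
    | ite_pos he' _ => exact absurd he' he
    | ite_neg _ k => obtain ⟨rfl, rfl⟩ := ih k; exact ⟨rfl, rfl⟩
  | loop_done he =>
    cases h₂ with
    | loop_done _ => exact ⟨rfl, rfl⟩
    | loop_step he' _ _ => exact absurd he' he
  | loop_step he _ _ ih ih' =>
    cases h₂ with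
    | loop_done he' => exact absurd he he'
    | loop_step _ k k' =>
      obtain ⟨rfl, rfl⟩ := ih k
      obtain ⟨rfl, rfl⟩ := ih' k'
      exact ⟨rfl, rfl⟩

/-! ## Inputs and outputs -/

/-- The array that holds `v x` in cell `pos x`, and `0` in all other cells
(used only with injective `pos`). -/
def arrayOf {ι : Type*} [Fintype ι] (pos : ι → ℕ) (v : ι → ℤ) : ℤ → ℤ :=
  fun i => ∑ x, if (pos x : ℤ) = i then v x else 0

theorem arrayOf_apply {ι : Type*} [Fintype ι] {pos : ι → ℕ} (hpos : Function.Injective pos)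
    (v : ι → ℤ) (x : ι) : arrayOf pos v (pos x) = v x := by
  classical
  simp [arrayOf, hpos.eq_iff]

/-- The initial memory for an input that consists of a number `n` and two arrays `u`, `v`:
`n` stands in cell `0` of array `0`, `u` and `v` are the arrays `1` and `2`, and all other cells
hold `0`. -/
def inputMemory (n : ℕ) (u v : ℤ → ℤ) : Memory
  | 0 => fun i => if i = 0 then (n : ℤ) else 0
  | 1 => u
  | 2 => v
  | _ => fun _ => 0

/-- The number of the array in which a program leaves its result. -/
def outputArray : ℕ := 3

/-- Row-major position of a matrix entry. -/
def matrixPos {N : ℕ} (x : Fin N × Fin N) : ℕ := (x.1 : ℕ) * N + (x.2 : ℕ)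

/-- Position of a subset `X` in a table indexed by subsets: the bit mask of `X`, in which the
`k`-th smallest element of the universe (`k = 0, 1, …`) has the weight `2 ^ k`. -/
def subsetPos {U : Type*} [Fintype U] [LinearOrder U] (X : Finset U) : ℕ :=
  ∑ u ∈ X, 2 ^ (Finset.univ.filter (fun v : U => v < u)).card

theorem matrixPos_injective {N : ℕ} : Function.Injective (matrixPos (N := N)) := by
  rintro ⟨i, j⟩ ⟨i', j'⟩ h
  have hj := j.isLt
  have hj' := j'.isLt
  have hN : 0 < N := by omega
  simp only [matrixPos] at h
  have h1 := congrArg (· / N) h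
  have h2 := congrArg (· % N) h
  simp only [Nat.add_comm _ (j : ℕ), Nat.add_comm _ (j' : ℕ), Nat.add_mul_div_right _ _ hN,
    Nat.add_mul_mod_self_right, Nat.div_eq_of_lt hj, Nat.div_eq_of_lt hj', Nat.mod_eq_of_lt hj,
    Nat.mod_eq_of_lt hj', Nat.zero_add] at h1 h2
  exact Prod.ext (Fin.ext h1) (Fin.ext h2)

theorem subsetPos_injective {U : Type*} [Fintype U] [LinearOrder U] :
    Function.Injective (subsetPos (U := U)) := by
  have hmono : StrictMono (fun u : U => (Finset.univ.filter (fun v : U => v < u)).card) := by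
    intro a b hab
    apply Finset.card_lt_card
    refine Finset.ssubset_iff_subset_ne.2 ⟨fun v hv => ?_, fun he => ?_⟩
    · simp only [Finset.mem_filter, Finset.mem_univ, true_and] at hv ⊢
      exact hv.trans hab
    · have : a ∈ Finset.univ.filter (fun v : U => v < b) := by simpa using hab
      rw [← he] at this
      simp at this
  intro X Y h
  have key : ∀ Z : Finset U, subsetPos Z =
      ∑ k ∈ Z.image (fun u : U => (Finset.univ.filter (fun v : U => v < u)).card), 2 ^ k := by
    intro Z
    rw [Finset.sum_image (fun a _ b _ hab => hmono.injective hab)]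
    rfl
  rw [key X, key Y] at h
  have h' := Finset.equivBitIndices.symm.injective (a₁ := X.image _) (a₂ := Y.image _) h
  exact Finset.image_injective hmono.injective h'

/-! ## The two computational problems -/

/-- The program `p` multiplies square integer matrices: for all `N ≥ 1` and all `N × N` matrices
whose entries have at most `b` bits, it halts within time `T N b` with the product in the
output array. -/
def MultipliesMatrices (p : Prog) (T : ℕ → ℕ → ℝ) : Prop :=
  ∀ (N b : ℕ) (A B : Matrix (Fin N) (Fin N) ℤ), 1 ≤ N →
    (∀ i j, |A i j| < 2 ^ b) → (∀ i j, |B i j| < 2 ^ b) →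
    HaltsWithin p
      (inputMemory N (arrayOf matrixPos fun x => A x.1 x.2) (arrayOf matrixPos fun x => B x.1 x.2))
      (T N b)
      (fun s => ∀ i j, s outputArray (matrixPos (i, j)) = (A * B) i j)

/-- `w` is an admissible exponent of matrix multiplication: `N × N` integer matrices with `b`-bit
entries can be multiplied in time `N ^ w · poly(b, log N)`. -/
def IsMatrixExponent (w : ℝ) : Prop :=
  ∃ (p : Prog) (C : ℝ) (c : ℕ),
    MultipliesMatrices p fun N b => C * (N : ℝ) ^ w * ((b : ℝ) + Nat.log 2 N + 1) ^ c

/-- The matrix multiplication exponent `ω`. -/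
noncomputable def omega : ℝ := sInf {w : ℝ | IsMatrixExponent w}

/-- The program `p` computes the Non-commutative Subset Convolution: for all finite linearly
ordered universes, with `n` elements, and all `f`, `g` whose values have at most `b` bits,
it halts within time `T n b` with the table of `f ◇ g` in the output array. -/
def ComputesNSC (p : Prog) (T : ℕ → ℕ → ℝ) : Prop :=
  ∀ (U : Type) [Fintype U] [LinearOrder U] (b : ℕ) (f g : Finset U → ℤ),
    (∀ X, |f X| < 2 ^ b) → (∀ X, |g X| < 2 ^ b) →
    HaltsWithin p
      (inputMemory (Fintype.card U) (arrayOf subsetPos f) (arrayOf subsetPos g))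
      (T (Fintype.card U) b)
      (fun s => ∀ X : Finset U, s outputArray (subsetPos X) = nsc f g X)

end NSC

/-!
Write `n` for the size of the universe and `m = ⌈n / 2⌉`. On tables indexed by bit masks the
Non-commutative Subset Convolution is the product of the exterior algebra on the elements of the
universe (`wedge`, `wedge_subsetPos`). The exterior algebra itself has no small faithful matrix
representation, but a deformation of it does: group the generators into `m` pairs `a, b` and replace
`ab + ba = 0` by `ab + ba = 1`, keeping `a² = b² = 0`. The resulting Clifford algebra of a
hyperbolic form is the full algebra of `2 ^ m × 2 ^ m` matrices, already over the integers (`MM`).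

The exterior product is recovered from the Clifford product by rescaling. Multiplying every
coefficient by `q ^ (number of generators b in the monomial)` (`wt`, `sc`) turns the relation into
`ab + ba = q`, so that the Clifford product of the rescaled tables, divided by the weights, is
`f ◇ g + q u` for some integer table `u` (`MM_product`). For `q = 1 + 2 ∑ (f² + g²)` the value of
`f ◇ g` is the remainder of least absolute value modulo `q` (`abs_nsc_le`, `balanced_emod`). The
integer `q` has `O(n + b)` bits and the rescaled tables have `O(n (n + b))` bits, so that a single
product of matrices of size `2 ^ m` with such entries suffices.

Passing from a table to its matrix takes `m` rounds of a transform along the base-four digits of the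
mask, up to a sign and a permutation of the positions (`lev`, `MM_eq_lev`), and the inverse works
in the same way (`lev_one_lev_zero`). Every part of the program outside the matrix multiplication is
a loop that fills a table cell by cell, where a cell may refer to earlier cells of the same table
(`tab`, `tab_runs`). The multiplication program is run once, on the arrays with numbers
from `20` on (`Prog.shift`, `Exec.shift`), where it finds its input in otherwise empty memory and
cannot interfere with the other arrays.

The tables have `(m + 1) 4 ^ m` cells. Every admissible exponent `w` is at least `2`, because the
product has to be written (`IsMatrixExponent.two_le`), so that `4 ^ m ≤ (2 ^ m) ^ w` and the tables
do not dominate the multiplication. Admissible exponents exist, as the definition of the product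
gives the exponent `3` (`isMatrixExponent_three`); hence every `w > ω` exceeds an admissible
exponent, and the first assertion follows from the second.
-/

namespace NSC

/-! ### Tables indexed by bit masks -/

/-- The parity sign `(-1) ^ (number of ones in the binary expansion of x)`. -/
def par (x : ℕ) : ℤ := if x = 0 then 1 else par (x / 2) * (1 - 2 * ((x % 2 : ℕ) : ℤ))
decreasing_by omega

theorem par_zero : par 0 = 1 := by rw [par]; simp

theorem par_two_mul (x : ℕ) : par (2 * x) = par x := by
  rcases Nat.eq_zero_or_pos x with rfl | hx
  · rfl
  · rw [par, if_neg (by omega)]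
    simp

theorem par_two_mul_add_one (x : ℕ) : par (2 * x + 1) = -par x := by
  rw [par, if_neg (by omega), show (2 * x + 1) / 2 = x by omega,
    show (2 * x + 1) % 2 = 1 by omega]
  push_cast
  ring

theorem par_mul_self (x : ℕ) : par x * par x = 1 := by
  induction x using Nat.strong_induction_on with
  | _ x ih =>
    obtain ⟨y, rfl | rfl⟩ : ∃ y, x = 2 * y ∨ x = 2 * y + 1 := ⟨x / 2, by omega⟩
    · rcases Nat.eq_zero_or_pos y with rfl | hy
      · simp [par_zero]
      · rw [par_two_mul]
        exact ih y (by omega)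
    · rw [par_two_mul_add_one, neg_mul_neg]
      exact ih y (by omega)

theorem abs_par (x : ℕ) : |par x| = 1 := by
  rcases mul_self_eq_one_iff.1 (par_mul_self x) with h | h <;> simp [h]

theorem par_four_mul (x : ℕ) : par (4 * x) = par x := by
  rw [show 4 * x = 2 * (2 * x) by ring, par_two_mul, par_two_mul]

theorem par_four_mul_add_one (x : ℕ) : par (4 * x + 1) = -par x := by
  rw [show 4 * x + 1 = 2 * (2 * x) + 1 by ring, par_two_mul_add_one, par_two_mul]

theorem par_four_mul_add_two (x : ℕ) : par (4 * x + 2) = -par x := by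
  rw [show 4 * x + 2 = 2 * (2 * x + 1) by ring, par_two_mul, par_two_mul_add_one]

theorem par_four_mul_add_three (x : ℕ) : par (4 * x + 3) = par x := by
  rw [show 4 * x + 3 = 2 * (2 * x + 1) + 1 by ring, par_two_mul_add_one, par_two_mul_add_one,
    neg_neg]

/-- The grade involution: the coefficient of `e_X` is multiplied by `(-1) ^ |X|`. -/
def tw (f : ℕ → ℤ) : ℕ → ℤ := fun x => par x * f x

theorem tw_tw (f : ℕ → ℤ) : tw (tw f) = f := by
  funext x
  simp only [tw]
  rw [← mul_assoc, par_mul_self, one_mul]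

/-- The subtable of the masks whose lowest base-four digit is `d`. -/
def comp (f : ℕ → ℤ) (d : ℕ) : ℕ → ℤ := fun x => f (4 * x + d)

/-- The subtable of the masks whose lowest bit is `d`. -/
def bsl (f : ℕ → ℤ) (d : ℕ) : ℕ → ℤ := fun x => f (2 * x + d)

theorem bsl_bsl (f : ℕ → ℤ) (d e : ℕ) : bsl (bsl f d) e = comp f (2 * e + d) := by
  funext x
  simp only [bsl, comp]
  congr 1
  ring

theorem bsl_tw_zero (f : ℕ → ℤ) : bsl (tw f) 0 = tw (bsl f 0) := by
  funext x
  simp [bsl, tw, par_two_mul]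

theorem bsl_tw_one (f : ℕ → ℤ) : bsl (tw f) 1 = fun x => -tw (bsl f 1) x := by
  funext x
  simp [bsl, tw, par_two_mul_add_one]

/-! ### The exterior product on masks -/

/-- The product of the exterior algebra on `K` generators, for coefficient tables indexed by
masks. The lowest generator `e` is split off: `(f₀ + e f₁) ∧ (g₀ + e g₁)` has the components
`f₀ ∧ g₀` and `f₁ ∧ g₀ + σ f₀ ∧ g₁`, where `σ` is the grade involution. -/
def wedge : ℕ → (ℕ → ℤ) → (ℕ → ℤ) → ℕ → ℤ
  | 0, f, g, _ => f 0 * g 0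
  | K + 1, f, g, x =>
    if x % 2 = 0 then wedge K (bsl f 0) (bsl g 0) (x / 2)
    else wedge K (bsl f 1) (bsl g 0) (x / 2) + wedge K (tw (bsl f 0)) (bsl g 1) (x / 2)

theorem wedge_even (K : ℕ) (f g : ℕ → ℤ) (x : ℕ) :
    wedge (K + 1) f g (2 * x) = wedge K (bsl f 0) (bsl g 0) x := by
  simp [wedge]

theorem wedge_odd (K : ℕ) (f g : ℕ → ℤ) (x : ℕ) :
    wedge (K + 1) f g (2 * x + 1) =
      wedge K (bsl f 1) (bsl g 0) x + wedge K (tw (bsl f 0)) (bsl g 1) x := by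
  rw [wedge, if_neg (by omega), show (2 * x + 1) / 2 = x by omega]

theorem wedge_neg_left (K : ℕ) (f g : ℕ → ℤ) (x : ℕ) :
    wedge K (fun y => -f y) g x = -wedge K f g x := by
  induction K generalizing f g x with
  | zero => simp [wedge]
  | succ K ih =>
    have h : ∀ d, bsl (fun y => -f y) d = fun y => -bsl f d y := fun d => rfl
    have h' : tw (fun y => -bsl f 0 y) = fun y => -tw (bsl f 0) y := by
      funext y
      simp [tw]
    simp only [wedge, h, h', ih]
    split_ifs <;> ring

theorem wedge_four_mul (K : ℕ) (f g : ℕ → ℤ) (x : ℕ) :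
    wedge (K + 2) f g (4 * x) = wedge K (comp f 0) (comp g 0) x := by
  rw [show 4 * x = 2 * (2 * x) by ring, wedge_even, wedge_even, bsl_bsl, bsl_bsl]

theorem wedge_four_mul_add_one (K : ℕ) (f g : ℕ → ℤ) (x : ℕ) :
    wedge (K + 2) f g (4 * x + 1) =
      wedge K (comp f 1) (comp g 0) x + wedge K (tw (comp f 0)) (comp g 1) x := by
  rw [show 4 * x + 1 = 2 * (2 * x) + 1 by ring, wedge_odd, wedge_even, wedge_even, bsl_tw_zero]
  simp only [bsl_bsl]

theorem wedge_four_mul_add_two (K : ℕ) (f g : ℕ → ℤ) (x : ℕ) :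
    wedge (K + 2) f g (4 * x + 2) =
      wedge K (comp f 2) (comp g 0) x + wedge K (tw (comp f 0)) (comp g 2) x := by
  rw [show 4 * x + 2 = 2 * (2 * x + 1) by ring, wedge_even, wedge_odd]
  simp only [bsl_bsl]

theorem wedge_four_mul_add_three (K : ℕ) (f g : ℕ → ℤ) (x : ℕ) :
    wedge (K + 2) f g (4 * x + 3) =
      wedge K (comp f 3) (comp g 0) x + wedge K (tw (comp f 1)) (comp g 2) x
        - wedge K (tw (comp f 2)) (comp g 1) x + wedge K (comp f 0) (comp g 3) x := by
  rw [show 4 * x + 3 = 2 * (2 * x + 1) + 1 by ring, wedge_odd, wedge_odd, wedge_odd, bsl_tw_zero,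
    tw_tw, bsl_tw_one, wedge_neg_left]
  simp only [bsl_bsl]
  ring

/-! ### The Clifford matrix of a table -/

/-- The matrix of the element with coefficient table `f` in the Clifford algebra of `m` hyperbolic
pairs `a, b` (`a² = b² = 0`, `ab + ba = 1`). The base-four digits of a mask stand for the
monomials `1, a, b, ab` of the pairs; the lowest pair is represented by `a = E₀₁`, `b = E₁₀`, and
an element `x` of the algebra of the other pairs by `diag(x, σ x)`. -/
def MM : ℕ → (ℕ → ℤ) → ℕ → ℕ → ℤ
  | 0, f, _, _ => f 0
  | m + 1, f, r, c =>
    if r % 2 = 0 then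
      if c % 2 = 0 then MM m (fun x => comp f 0 x + comp f 3 x) (r / 2) (c / 2)
      else MM m (tw (comp f 1)) (r / 2) (c / 2)
    else
      if c % 2 = 0 then MM m (comp f 2) (r / 2) (c / 2)
      else MM m (tw (comp f 0)) (r / 2) (c / 2)

theorem MM_lin (m : ℕ) (a b : ℤ) (f g : ℕ → ℤ) (r c : ℕ) :
    MM m (fun x => a * f x + b * g x) r c = a * MM m f r c + b * MM m g r c := by
  induction m generalizing f g r c with
  | zero => simp [MM]
  | succ m ih =>
    have h1 : ∀ d, comp (fun x => a * f x + b * g x) d =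
        fun x => a * comp f d x + b * comp g d x := fun d => rfl
    have h2 : ∀ d, tw (fun x => a * comp f d x + b * comp g d x) =
        fun x => a * tw (comp f d) x + b * tw (comp g d) x := by
      intro d
      funext x
      simp only [tw]
      ring
    have h3 : (fun x => (a * comp f 0 x + b * comp g 0 x) + (a * comp f 3 x + b * comp g 3 x)) =
        fun x => a * (comp f 0 x + comp f 3 x) + b * (comp g 0 x + comp g 3 x) := by
      funext x
      ring
    simp only [MM, h1, h2, h3, ih]
    split_ifs <;> rfl

theorem MM_add (m : ℕ) (f g : ℕ → ℤ) (r c : ℕ) :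
    MM m (fun x => f x + g x) r c = MM m f r c + MM m g r c := by
  simpa using MM_lin m 1 1 f g r c

theorem MM_mul (m : ℕ) (a : ℤ) (f : ℕ → ℤ) (r c : ℕ) :
    MM m (fun x => a * f x) r c = a * MM m f r c := by
  simpa using MM_lin m a 0 f f r c

/-- The grade involution conjugates the Clifford matrix with the diagonal matrix of the parity
signs. -/
theorem MM_tw (m : ℕ) (f : ℕ → ℤ) (r c : ℕ) (hr : r < 2 ^ m) (hc : c < 2 ^ m) :
    MM m (tw f) r c = par r * par c * MM m f r c := by
  induction m generalizing f r c with
  | zero =>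
    obtain rfl : r = 0 := by simpa using hr
    obtain rfl : c = 0 := by simpa using hc
    simp [MM, tw, par_zero]
  | succ m ih =>
    have e0 : comp (tw f) 0 = tw (comp f 0) := by
      funext x; simp [comp, tw, par_four_mul]
    have e1 : comp (tw f) 1 = fun x => -1 * tw (comp f 1) x := by
      funext x; simp [comp, tw, par_four_mul_add_one]
    have e2 : comp (tw f) 2 = fun x => -1 * tw (comp f 2) x := by
      funext x; simp [comp, tw, par_four_mul_add_two]
    have e3 : comp (tw f) 3 = tw (comp f 3) := by
      funext x; simp [comp, tw, par_four_mul_add_three]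
    have t1 : tw (fun x => -1 * tw (comp f 1) x) = fun x => -1 * tw (tw (comp f 1)) x := by
      funext x; simp [tw]
    rw [pow_succ] at hr hc
    obtain ⟨r, rfl | rfl⟩ : ∃ y, r = 2 * y ∨ r = 2 * y + 1 := ⟨r / 2, by omega⟩ <;>
    obtain ⟨c, rfl | rfl⟩ : ∃ y, c = 2 * y ∨ c = 2 * y + 1 := ⟨c / 2, by omega⟩ <;>
    simp only [MM, Nat.mul_mod_right, Nat.mul_add_mod, if_true, e0, e1, e2, e3, t1, MM_mul, MM_add,
      Nat.one_mod, one_ne_zero, if_false, par_two_mul, par_two_mul_add_one,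
      show ∀ y, (2 * y + 1) / 2 = y by omega, show ∀ y, (2 * y) / 2 = y by omega]
    · rw [ih _ _ _ (by omega) (by omega), ih _ _ _ (by omega) (by omega)]
      ring
    · rw [ih _ _ _ (by omega) (by omega)]
      ring
    · rw [ih _ _ _ (by omega) (by omega)]
      ring
    · rw [ih _ _ _ (by omega) (by omega)]
      ring

theorem MM_even_even (m : ℕ) (f : ℕ → ℤ) (r c : ℕ) :
    MM (m + 1) f (2 * r) (2 * c) = MM m (comp f 0) r c + MM m (comp f 3) r c := by
  rw [← MM_add]
  simp [MM]

theorem MM_even_odd (m : ℕ) (f : ℕ → ℤ) (r c : ℕ) :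
    MM (m + 1) f (2 * r) (2 * c + 1) = MM m (tw (comp f 1)) r c := by
  simp [MM, show (2 * c + 1) / 2 = c by omega]

theorem MM_odd_even (m : ℕ) (f : ℕ → ℤ) (r c : ℕ) :
    MM (m + 1) f (2 * r + 1) (2 * c) = MM m (comp f 2) r c := by
  simp [MM, show (2 * r + 1) / 2 = r by omega]

theorem MM_odd_odd (m : ℕ) (f : ℕ → ℤ) (r c : ℕ) :
    MM (m + 1) f (2 * r + 1) (2 * c + 1) = MM m (tw (comp f 0)) r c := by
  simp [MM, show (2 * r + 1) / 2 = r by omega, show (2 * c + 1) / 2 = c by omega]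

/-! ### The Clifford product deforms the exterior product -/

/-- The weight of a mask: one factor `q` for every generator `b`, that is, for every one at an odd
position. -/
def wt (q : ℤ) (x : ℕ) : ℤ := if x = 0 then 1 else wt q (x / 4) * (if 2 ≤ x % 4 then q else 1)
decreasing_by omega

theorem wt_zero (q : ℤ) : wt q 0 = 1 := by rw [wt]; simp

theorem wt_four_mul_add (q : ℤ) (x d : ℕ) (hd : d < 4) :
    wt q (4 * x + d) = wt q x * (if 2 ≤ d then q else 1) := by
  rcases Nat.eq_zero_or_pos (4 * x + d) with h | h
  · obtain ⟨rfl, rfl⟩ : x = 0 ∧ d = 0 := by omega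
    simp
  · rw [wt, if_neg (by omega), show (4 * x + d) / 4 = x by omega, show (4 * x + d) % 4 = d by omega]

/-- The rescaling of a table by the weights. After it the relation `ab + ba = 1` reads
`ab + ba = q` in terms of the original table. -/
def sc (q : ℤ) (f : ℕ → ℤ) : ℕ → ℤ := fun x => wt q x * f x

theorem comp_sc_low (q : ℤ) (f : ℕ → ℤ) (d : ℕ) (hd : d < 2) :
    comp (sc q f) d = sc q (comp f d) := by
  funext x
  simp only [comp, sc]
  rw [wt_four_mul_add q x d (by omega), if_neg (by omega), mul_one]

theorem comp_sc_high (q : ℤ) (f : ℕ → ℤ) (d : ℕ) (hd : 2 ≤ d) (hd' : d < 4) :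
    comp (sc q f) d = fun x => q * sc q (comp f d) x := by
  funext x
  simp only [comp, sc]
  rw [wt_four_mul_add q x d (by omega), if_pos hd]
  ring

theorem sc_tw (q : ℤ) (f : ℕ → ℤ) : sc q (tw f) = tw (sc q f) := by
  funext x
  simp only [sc, tw]
  ring

theorem MM_sc_add (m : ℕ) (q : ℤ) (f g : ℕ → ℤ) (r c : ℕ) :
    MM m (sc q (fun x => f x + g x)) r c = MM m (sc q f) r c + MM m (sc q g) r c := by
  rw [← MM_add]
  congr 1
  funext x
  simp only [sc]
  ring

theorem MM_sc_mul (m : ℕ) (q a : ℤ) (f : ℕ → ℤ) (r c : ℕ) :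
    MM m (sc q (fun x => a * f x)) r c = a * MM m (sc q f) r c := by
  rw [← MM_mul]
  congr 1
  funext x
  simp only [sc]
  ring

theorem sum_range_two_mul (N : ℕ) (φ : ℕ → ℤ) :
    ∑ k ∈ Finset.range (2 * N), φ k = ∑ k ∈ Finset.range N, (φ (2 * k) + φ (2 * k + 1)) := by
  induction N with
  | zero => simp
  | succ N ih =>
    rw [show 2 * (N + 1) = 2 * N + 1 + 1 by ring, Finset.sum_range_succ, Finset.sum_range_succ, ih,
      Finset.sum_range_succ]
    ring

/-- The product of the Clifford matrices of two rescaled tables is the Clifford matrix of a rescaled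
table which agrees with the exterior product modulo `q`. -/
theorem MM_product (q : ℤ) (m : ℕ) (f g : ℕ → ℤ) :
    ∃ u : ℕ → ℤ, ∀ r c, r < 2 ^ m → c < 2 ^ m →
      ∑ k ∈ Finset.range (2 ^ m), MM m (sc q f) r k * MM m (sc q g) k c =
        MM m (sc q (fun x => wedge (2 * m) f g x + q * u x)) r c := by
  induction m generalizing f g with
  | zero =>
    refine ⟨fun _ => 0, fun r c _ _ => ?_⟩
    simp [MM, wedge, sc, wt_zero]
  | succ m ih =>
    choose u hu using ih
    -- the four components of the correction, read off from the block product
    let U : ℕ → ℕ → ℤ := fun d x =>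
      if d = 0 then u (comp f 0) (comp g 0) x +
        (wedge (2 * m) (tw (comp f 2)) (comp g 1) x + q * u (tw (comp f 2)) (comp g 1) x)
      else if d = 1 then u (comp f 1) (comp g 0) x + u (tw (comp f 0)) (comp g 1) x +
        (wedge (2 * m) (tw (comp f 3)) (comp g 1) x + q * u (tw (comp f 3)) (comp g 1) x)
      else if d = 2 then u (comp f 2) (comp g 0) x + u (tw (comp f 0)) (comp g 2) x +
        (wedge (2 * m) (comp f 2) (comp g 3) x + q * u (comp f 2) (comp g 3) x)
      else u (comp f 3) (comp g 0) x + u (tw (comp f 1)) (comp g 2) x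
        - u (tw (comp f 2)) (comp g 1) x + u (comp f 0) (comp g 3) x +
        (wedge (2 * m) (comp f 3) (comp g 3) x + q * u (comp f 3) (comp g 3) x)
    refine ⟨fun x => U (x % 4) (x / 4), fun r c hr hc => ?_⟩
    set h : ℕ → ℤ := fun x => wedge (2 * (m + 1)) f g x + q * U (x % 4) (x / 4) with hh
    -- the product of two components in the algebra of the other pairs
    let B : (ℕ → ℤ) → (ℕ → ℤ) → ℕ → ℤ := fun f g x => wedge (2 * m) f g x + q * u f g x
    have h0 : comp h 0 = fun x => B (comp f 0) (comp g 0) x +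
        q * B (tw (comp f 2)) (comp g 1) x := by
      funext x
      change h (4 * x) = _
      simp only [hh, B, U, mul_add, mul_one, wedge_four_mul, Nat.mul_mod_right,
        if_true, show (4 * x) / 4 = x by omega]
      ring
    have h1 : comp h 1 = fun x => (B (comp f 1) (comp g 0) x + B (tw (comp f 0)) (comp g 1) x) +
        q * B (tw (comp f 3)) (comp g 1) x := by
      funext x
      change h (4 * x + 1) = _
      simp only [hh, B, U, mul_add, mul_one, wedge_four_mul_add_one,
        show (4 * x + 1) % 4 = 1 by omega, show (4 * x + 1) / 4 = x by omega, one_ne_zero, if_false,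
        if_true]
      ring
    have h2 : comp h 2 = fun x => (B (comp f 2) (comp g 0) x + B (tw (comp f 0)) (comp g 2) x) +
        q * B (comp f 2) (comp g 3) x := by
      funext x
      change h (4 * x + 2) = _
      simp only [hh, B, U, mul_add, mul_one, wedge_four_mul_add_two,
        show (4 * x + 2) % 4 = 2 by omega, show (4 * x + 2) / 4 = x by omega,
        show (2 : ℕ) ≠ 0 by omega, show (2 : ℕ) ≠ 1 by omega, if_false, if_true]
      ring
    have h3 : comp h 3 = fun x => (((B (comp f 3) (comp g 0) x +
        B (tw (comp f 1)) (comp g 2) x) + (-1) * B (tw (comp f 2)) (comp g 1) x) +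
        B (comp f 0) (comp g 3) x) + q * B (comp f 3) (comp g 3) x := by
      funext x
      change h (4 * x + 3) = _
      simp only [hh, B, U, mul_add, mul_one, wedge_four_mul_add_three,
        show (4 * x + 3) % 4 = 3 by omega, show (4 * x + 3) / 4 = x by omega,
        show (3 : ℕ) ≠ 0 by omega, show (3 : ℕ) ≠ 1 by omega, show (3 : ℕ) ≠ 2 by omega, if_false]
      ring
    have hu' : ∀ f g, ∀ r c, r < 2 ^ m → c < 2 ^ m → MM m (sc q (B f g)) r c =
        ∑ k ∈ Finset.range (2 ^ m), MM m (sc q f) r k * MM m (sc q g) k c :=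
      fun f g r c hr hc => (hu f g r c hr hc).symm
    have par2 : ∀ k, par k * par k = 1 := par_mul_self
    rw [pow_succ] at hr hc
    -- the four blocks of the matrix product, compared term by term; signs occur in pairs
    rw [pow_succ, mul_comm, sum_range_two_mul]
    obtain ⟨r, rfl | rfl⟩ : ∃ y, r = 2 * y ∨ r = 2 * y + 1 := ⟨r / 2, by omega⟩ <;>
    obtain ⟨c, rfl | rfl⟩ : ∃ y, c = 2 * y ∨ c = 2 * y + 1 := ⟨c / 2, by omega⟩ <;>
    simp only [MM_even_even, MM_even_odd, MM_odd_even, MM_odd_odd, comp_sc_low, comp_sc_high,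
      MM_mul, ← sc_tw, Nat.zero_lt_succ, Nat.one_lt_ofNat, le_refl, Nat.reduceLeDiff,
      Nat.reduceLT] <;>
    have hr' : r < 2 ^ m := (by omega) <;>
    have hc' : c < 2 ^ m := (by omega) <;>
    simp only [sc_tw, MM_tw m _ _ _ hr' hc', h0, h1, h2, h3, MM_sc_add, MM_sc_mul,
      hu' _ _ r c hr' hc', Finset.mul_sum, ← Finset.sum_add_distrib] <;>
    refine Finset.sum_congr rfl fun k hk => ?_ <;>
    have hk' : k < 2 ^ m := (Finset.mem_range.1 hk) <;>
    simp only [MM_tw m _ _ _ hr' hk', MM_tw m _ _ _ hk' hc']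
    · ring
    · linear_combination par r * par c * MM m (sc q (comp f 1)) r k * MM m (sc q (comp g 0)) k c *
        par2 k - par k * par c * MM m (sc q (comp g 1)) k c *
        (MM m (sc q (comp f 0)) r k + q * MM m (sc q (comp f 3)) r k) * par2 r
    · ring
    · linear_combination par r * par c * MM m (sc q (comp f 0)) r k * MM m (sc q (comp g 0)) k c *
        par2 k - par k * par c * q * MM m (sc q (comp f 2)) r k * MM m (sc q (comp g 1)) k c *
        par2 r

/-! ### The Clifford matrix by levelwise transforms -/

/-- The sign that relates the entries of the Clifford matrix to the untwisted transform: every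
pair with column bit one contributes the parity of the bits of all higher pairs. -/
def sg (x : ℕ) : ℤ := if x = 0 then 1 else sg (x / 4) * (if x % 2 = 1 then par (x / 4) else 1)
decreasing_by omega

theorem sg_zero : sg 0 = 1 := by rw [sg]; simp

theorem sg_four_mul_add (x d : ℕ) (hd : d < 4) :
    sg (4 * x + d) = sg x * (if d % 2 = 1 then par x else 1) := by
  rcases Nat.eq_zero_or_pos (4 * x + d) with h | h
  · obtain ⟨rfl, rfl⟩ : x = 0 ∧ d = 0 := by omega
    simp
  · rw [sg, if_neg (by omega), show (4 * x + d) / 4 = x by omega,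
      show (4 * x + d) % 2 = d % 2 by omega]

theorem sg_mul_self (x : ℕ) : sg x * sg x = 1 := by
  induction x using Nat.strong_induction_on with
  | _ x ih =>
    rcases Nat.eq_zero_or_pos x with rfl | hx
    · simp [sg_zero]
    · rw [sg, if_neg (by omega)]
      have h := ih (x / 4) (by omega)
      have h' := par_mul_self (x / 4)
      split_ifs
      · linear_combination h' + par (x / 4) * par (x / 4) * h
      · linear_combination h

theorem abs_sg (x : ℕ) : |sg x| = 1 := by
  rcases mul_self_eq_one_iff.1 (sg_mul_self x) with h | h <;> simp [h]

/-- The mask whose even-position bits are those of `c` and whose odd-position bits are those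
of `r`. -/
def mor (r c : ℕ) : ℕ :=
  if r = 0 ∧ c = 0 then 0 else 4 * mor (r / 2) (c / 2) + 2 * (r % 2) + c % 2
termination_by r + c
decreasing_by omega

theorem mor_zero : mor 0 0 = 0 := by rw [mor]; simp

theorem mor_eq (r c : ℕ) : mor r c = 4 * mor (r / 2) (c / 2) + 2 * (r % 2) + c % 2 := by
  by_cases h : r = 0 ∧ c = 0
  · obtain ⟨rfl, rfl⟩ := h
    simp [mor_zero]
  · rw [mor, if_neg h]

theorem mor_lt (m r c : ℕ) (hr : r < 2 ^ m) (hc : c < 2 ^ m) : mor r c < 4 ^ m := by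
  induction m generalizing r c with
  | zero =>
    obtain rfl : r = 0 := by simpa using hr
    obtain rfl : c = 0 := by simpa using hc
    simp [mor_zero]
  | succ m ih =>
    rw [pow_succ] at hr hc ⊢
    rw [mor_eq]
    have := ih (r / 2) (c / 2) (by omega) (by omega)
    omega

/-- The number formed by the odd-position bits of a mask. -/
def row (x : ℕ) : ℕ := if x = 0 then 0 else 2 * row (x / 4) + x / 2 % 2
decreasing_by omega

/-- The number formed by the even-position bits of a mask. -/
def col (x : ℕ) : ℕ := if x = 0 then 0 else 2 * col (x / 4) + x % 2
decreasing_by omega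

theorem row_zero : row 0 = 0 := by rw [row]; simp

theorem col_zero : col 0 = 0 := by rw [col]; simp

theorem row_eq (x : ℕ) : row x = 2 * row (x / 4) + x / 2 % 2 := by
  rcases Nat.eq_zero_or_pos x with rfl | hx
  · simp [row_zero]
  · rw [row, if_neg (by omega)]

theorem col_eq (x : ℕ) : col x = 2 * col (x / 4) + x % 2 := by
  rcases Nat.eq_zero_or_pos x with rfl | hx
  · simp [col_zero]
  · rw [col, if_neg (by omega)]

theorem mor_row_col (x : ℕ) : mor (row x) (col x) = x := by
  induction x using Nat.strong_induction_on with
  | _ x ih =>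
    rcases Nat.eq_zero_or_pos x with rfl | hx
    · simp [row_zero, col_zero, mor_zero]
    · have h1 := row_eq x
      have h2 := col_eq x
      have h3 := ih (x / 4) (by omega)
      rw [mor_eq, show row x / 2 = row (x / 4) by omega, show col x / 2 = col (x / 4) by omega, h3]
      omega

theorem row_lt (m x : ℕ) (hx : x < 4 ^ m) : row x < 2 ^ m := by
  induction m generalizing x with
  | zero =>
    obtain rfl : x = 0 := by simpa using hx
    simp [row_zero]
  | succ m ih =>
    rw [pow_succ] at hx ⊢
    have := ih (x / 4) (by omega)
    rw [row_eq]
    omega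

theorem col_lt (m x : ℕ) (hx : x < 4 ^ m) : col x < 2 ^ m := by
  induction m generalizing x with
  | zero =>
    obtain rfl : x = 0 := by simpa using hx
    simp [col_zero]
  | succ m ih =>
    rw [pow_succ] at hx ⊢
    have := ih (x / 4) (by omega)
    rw [col_eq]
    omega

/-- The digit that the digit `d` is replaced with in the first term of a digit transform; `κ = 0`
is the forward transform `(v₀, v₁, v₂, v₃) ↦ (v₀ + v₃, v₁, v₂, v₀)` and `κ = 1` its inverse
`(v₀, v₁, v₂, v₃) ↦ (v₃, v₁, v₂, v₀ - v₃)`. -/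
def digA (κ d : ℕ) : ℕ := if d = 0 then 3 * κ else if d = 3 then 0 else d

/-- The digit that the digit `d` is replaced with in the second term of a digit transform. -/
def digB (d : ℕ) : ℕ := if d = 0 then 3 else d

/-- The coefficient of the second term of a digit transform. -/
def digC (κ d : ℕ) : ℤ := if d = 0 then 1 - κ else if d = 3 then -κ else 0

/-- The component `d` of the transform of a table along its lowest base-four digit. -/
def digOp (κ : ℕ) (f : ℕ → ℤ) (d : ℕ) : ℕ → ℤ :=
  fun x => comp f (digA κ d) x + digC κ d * comp f (digB d) x

theorem digOp_zero_zero (f : ℕ → ℤ) : digOp 0 f 0 = fun x => comp f 0 x + comp f 3 x := by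
  funext x
  simp [digOp, digA, digB, digC]

theorem digOp_zero_one (f : ℕ → ℤ) : digOp 0 f 1 = comp f 1 := by
  funext x
  simp [digOp, digA, digB, digC]

theorem digOp_zero_two (f : ℕ → ℤ) : digOp 0 f 2 = comp f 2 := by
  funext x
  simp [digOp, digA, digB, digC]

theorem digOp_zero_three (f : ℕ → ℤ) : digOp 0 f 3 = comp f 0 := by
  funext x
  simp [digOp, digA, digB, digC]

theorem digOp_one_zero (f : ℕ → ℤ) : digOp 1 f 0 = comp f 3 := by
  funext x
  simp [digOp, digA, digB, digC]

theorem digOp_one_one (f : ℕ → ℤ) : digOp 1 f 1 = comp f 1 := by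
  funext x
  simp [digOp, digA, digB, digC]

theorem digOp_one_two (f : ℕ → ℤ) : digOp 1 f 2 = comp f 2 := by
  funext x
  simp [digOp, digA, digB, digC]

theorem digOp_one_three (f : ℕ → ℤ) : digOp 1 f 3 = fun x => comp f 0 x - comp f 3 x := by
  funext x
  simp [digOp, digA, digB, digC, sub_eq_add_neg]

/-- The transform of a table along its `i` lowest base-four digits. -/
def lev (κ : ℕ) : ℕ → (ℕ → ℤ) → ℕ → ℤ
  | 0, f, x => f x
  | i + 1, f, x => lev κ i (digOp κ f (x % 4)) (x / 4)

theorem lev_succ_four_mul_add (κ i : ℕ) (f : ℕ → ℤ) (x d : ℕ) (hd : d < 4) :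
    lev κ (i + 1) f (4 * x + d) = lev κ i (digOp κ f d) x := by
  rw [lev, show (4 * x + d) % 4 = d by omega, show (4 * x + d) / 4 = x by omega]

theorem digA_lt {κ d : ℕ} (hκ : κ ≤ 1) (hd : d < 4) : digA κ d < 4 := by
  unfold digA
  split_ifs <;> omega

theorem digB_lt {d : ℕ} (hd : d < 4) : digB d < 4 := by
  unfold digB
  split_ifs <;> omega

theorem abs_digC_le {κ d : ℕ} (hκ : κ ≤ 1) : |digC κ d| ≤ 1 := by
  unfold digC
  have : κ = 0 ∨ κ = 1 := by omega
  rcases this with rfl | rfl <;> split_ifs <;> simp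

/-- The transform along `i + 1` digits is the transform along `i` digits followed by one along
digit `i`. -/
theorem lev_succ (κ i : ℕ) (f : ℕ → ℤ) (x : ℕ) :
    lev κ (i + 1) f x =
      lev κ i f (x - (x / 4 ^ i % 4) * 4 ^ i + digA κ (x / 4 ^ i % 4) * 4 ^ i) +
      digC κ (x / 4 ^ i % 4) *
        lev κ i f (x - (x / 4 ^ i % 4) * 4 ^ i + digB (x / 4 ^ i % 4) * 4 ^ i) := by
  induction i generalizing f x with
  | zero =>
    simp only [lev, pow_zero, Nat.div_one, mul_one, digOp, comp]
    rw [show x - x % 4 = 4 * (x / 4) by omega]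
  | succ i ih =>
    obtain ⟨y, e, he, rfl⟩ : ∃ y e, e < 4 ∧ x = 4 * y + e :=
      ⟨x / 4, x % 4, by omega, by omega⟩
    rw [lev_succ_four_mul_add κ (i + 1) f y e he, ih]
    have h1 : (4 * y + e) / 4 ^ (i + 1) = y / 4 ^ i := by
      rw [pow_succ', ← Nat.div_div_eq_div_mul, show (4 * y + e) / 4 = y by omega]
    have h2 : y / 4 ^ i % 4 * 4 ^ i ≤ y :=
      (Nat.mul_le_mul_right _ (Nat.mod_le _ _)).trans (Nat.div_mul_le_self _ _)
    have h3 : ∀ a, 4 * y + e - (y / 4 ^ i % 4) * 4 ^ (i + 1) + a * 4 ^ (i + 1) =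
        4 * (y - (y / 4 ^ i % 4) * 4 ^ i + a * 4 ^ i) + e := by
      intro a
      rw [pow_succ', ← mul_assoc, ← mul_assoc, mul_comm _ 4, mul_comm _ 4, mul_assoc, mul_assoc]
      omega
    rw [h1, h3, h3, lev_succ_four_mul_add κ i f _ e he, lev_succ_four_mul_add κ i f _ e he]

theorem lev_congr {κ : ℕ} (hκ : κ ≤ 1) (i : ℕ) {f g : ℕ → ℤ} (h : ∀ x, x < 4 ^ i → f x = g x)
    (x : ℕ) (hx : x < 4 ^ i) : lev κ i f x = lev κ i g x := by
  induction i generalizing f g x with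
  | zero => exact h x hx
  | succ i ih =>
    rw [pow_succ] at hx h
    refine ih (fun y hy => ?_) _ (by omega)
    have hA := digA_lt hκ (Nat.mod_lt x (show 0 < 4 by omega))
    have hB := digB_lt (Nat.mod_lt x (show 0 < 4 by omega))
    simp only [digOp, comp]
    rw [h _ (by omega), h _ (by omega)]

theorem lev_bound {κ : ℕ} (hκ : κ ≤ 1) (i : ℕ) {f : ℕ → ℤ} {B : ℤ} (h : ∀ x, |f x| ≤ B) (x : ℕ) :
    |lev κ i f x| ≤ 2 ^ i * B := by
  induction i generalizing f B x with
  | zero => simpa [lev] using h x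
  | succ i ih =>
    rw [pow_succ, mul_assoc]
    refine ih (fun y => ?_) _
    simp only [digOp, comp]
    have h1 := h (4 * y + digA κ (x % 4))
    have h2 := h (4 * y + digB (x % 4))
    have h3 := mul_le_mul (abs_digC_le (d := x % 4) hκ) h2 (abs_nonneg _) zero_le_one
    rw [← abs_mul] at h3
    have := abs_add_le (f (4 * y + digA κ (x % 4)))
      (digC κ (x % 4) * f (4 * y + digB (x % 4)))
    linarith

theorem lev_sub (κ i : ℕ) (f g : ℕ → ℤ) (x : ℕ) :
    lev κ i (fun y => f y - g y) x = lev κ i f x - lev κ i g x := by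
  induction i generalizing f g x with
  | zero => rfl
  | succ i ih =>
    have : digOp κ (fun y => f y - g y) (x % 4) =
        fun y => digOp κ f (x % 4) y - digOp κ g (x % 4) y := by
      funext y
      simp only [digOp, comp]
      ring
    rw [lev, this, ih]
    rfl

/-- The digit transform with `κ = 1` inverts the one with `κ = 0`. -/
theorem lev_one_lev_zero (i : ℕ) (f : ℕ → ℤ) (x : ℕ) (hx : x < 4 ^ i) :
    lev 1 i (lev 0 i f) x = f x := by
  induction i generalizing f x with
  | zero => rfl
  | succ i ih =>
    rw [pow_succ] at hx
    obtain ⟨y, e, he, rfl⟩ : ∃ y e, e < 4 ∧ x = 4 * y + e :=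
      ⟨x / 4, x % 4, by omega, by omega⟩
    rw [lev_succ_four_mul_add 1 i _ y e he]
    have key : ∀ d, d < 4 → comp (lev 0 (i + 1) f) d = lev 0 i (digOp 0 f d) := by
      intro d hd
      funext z
      exact lev_succ_four_mul_add 0 i f z d hd
    have h : digOp 1 (lev 0 (i + 1) f) e = lev 0 i (comp f e) := by
      funext z
      interval_cases e
      · simp only [digOp_one_zero, key 3 (by omega), digOp_zero_three]
      · simp only [digOp_one_one, key 1 (by omega), digOp_zero_one]
      · simp only [digOp_one_two, key 2 (by omega), digOp_zero_two]
      · simp only [digOp_one_three, key 0 (by omega), key 3 (by omega), digOp_zero_three]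
        rw [← lev_sub]
        congr 1
        funext w
        simp only [digOp_zero_zero, add_sub_cancel_left]
    rw [h, ih _ _ (by omega)]
    rfl

theorem par_mor (m r c : ℕ) (hr : r < 2 ^ m) (hc : c < 2 ^ m) : par (mor r c) = par r * par c := by
  induction m generalizing r c with
  | zero =>
    obtain rfl : r = 0 := by simpa using hr
    obtain rfl : c = 0 := by simpa using hc
    simp [mor_zero, par_zero]
  | succ m ih =>
    rw [pow_succ] at hr hc
    rw [mor_eq]
    have h := ih (r / 2) (c / 2) (by omega) (by omega)
    obtain ⟨r, rfl | rfl⟩ : ∃ y, r = 2 * y ∨ r = 2 * y + 1 := ⟨r / 2, by omega⟩ <;>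
    obtain ⟨c, rfl | rfl⟩ : ∃ y, c = 2 * y ∨ c = 2 * y + 1 := ⟨c / 2, by omega⟩ <;>
    simp only [Nat.mul_mod_right, Nat.mul_add_mod, Nat.one_mod, par_two_mul, par_two_mul_add_one,
      show ∀ y, (2 * y + 1) / 2 = y by omega, show ∀ y, (2 * y) / 2 = y by omega, mul_zero,
      add_zero, mul_one, par_four_mul, par_four_mul_add_one, par_four_mul_add_two] at h ⊢
    · exact h
    · rw [h]; ring
    · rw [h]; ring
    · rw [add_assoc, par_four_mul_add_three, h]; ring

/-- The entries of the Clifford matrix, up to sign, are the values of the digit transform. -/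
theorem MM_eq_lev (m : ℕ) (f : ℕ → ℤ) (r c : ℕ) (hr : r < 2 ^ m) (hc : c < 2 ^ m) :
    MM m f r c = sg (mor r c) * lev 0 m f (mor r c) := by
  induction m generalizing f r c with
  | zero =>
    obtain rfl : r = 0 := by simpa using hr
    obtain rfl : c = 0 := by simpa using hc
    simp [mor_zero, sg_zero, MM, lev]
  | succ m ih =>
    rw [pow_succ] at hr hc
    rw [mor_eq, add_assoc, lev_succ_four_mul_add 0 m f _ _ (by omega),
      sg_four_mul_add _ _ (by omega)]
    obtain ⟨r, rfl | rfl⟩ : ∃ y, r = 2 * y ∨ r = 2 * y + 1 := ⟨r / 2, by omega⟩ <;>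
    obtain ⟨c, rfl | rfl⟩ : ∃ y, c = 2 * y ∨ c = 2 * y + 1 := ⟨c / 2, by omega⟩ <;>
    have hr' : r < 2 ^ m := (by omega) <;>
    have hc' : c < 2 ^ m := (by omega) <;>
    simp only [Nat.mul_mod_right, Nat.mul_add_mod, Nat.one_mod,
      show ∀ y, (2 * y + 1) / 2 = y by omega, show ∀ y, (2 * y) / 2 = y by omega, mul_zero,
      add_zero, zero_add, mul_one, MM_even_even, MM_even_odd, MM_odd_even, MM_odd_odd,
      MM_tw m _ r c hr' hc', par_mor m r c hr' hc', if_true]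
    · rw [← MM_add, ih _ _ _ hr' hc', Nat.zero_mod, if_neg (by omega), mul_one, digOp_zero_zero]
    · rw [ih _ _ _ hr' hc', digOp_zero_one]
      ring
    · rw [ih _ _ _ hr' hc', digOp_zero_two, Nat.mod_self, if_neg (by omega), mul_one]
    · rw [ih _ _ _ hr' hc', digOp_zero_three]
      norm_num
      ring

/-! ### The convolution as an exterior product on masks -/

/-- The bit mask of a finite set of natural numbers. -/
def mask (X : Finset ℕ) : ℕ := ∑ k ∈ X, 2 ^ k

/-- The convolution on sets of natural numbers, for coefficient tables indexed by masks. -/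
def nscNat (f g : ℕ → ℤ) (X : Finset ℕ) : ℤ :=
  ∑ A ∈ X.powerset, f (mask A) * g (mask (X \ A)) * invSign A (X \ A)

theorem invSign_map {U V : Type*} [LinearOrder U] [LinearOrder V] (e : U ↪o V) (A B : Finset U) :
    invSign (A.map e.toEmbedding) (B.map e.toEmbedding) = invSign A B := by
  unfold invSign
  rw [← Finset.prodMap_map_product, Finset.filter_map, Finset.card_map]
  congr 2
  refine Finset.filter_congr fun p _ => ?_
  simp

/-- The order embedding `k ↦ k + 1`. -/
def succEmb : ℕ ↪o ℕ := OrderEmbedding.ofStrictMono Nat.succ fun _ _ h => Nat.succ_lt_succ h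

theorem mask_map_succ (A : Finset ℕ) : mask (A.map succEmb.toEmbedding) = 2 * mask A := by
  unfold mask
  rw [Finset.sum_map, Finset.mul_sum]
  refine Finset.sum_congr rfl fun k _ => ?_
  change 2 ^ (k + 1) = _
  ring

theorem zero_notMem_map_succ (A : Finset ℕ) : 0 ∉ A.map succEmb.toEmbedding := by
  simp only [Finset.mem_map, not_exists, not_and]
  intro x _
  exact Nat.succ_ne_zero x

theorem mask_insert_zero (A : Finset ℕ) :
    mask (insert 0 (A.map succEmb.toEmbedding)) = 2 * mask A + 1 := by
  rw [mask, Finset.sum_insert (zero_notMem_map_succ A), ← mask, mask_map_succ]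
  ring

theorem invSign_insert_left (A B : Finset ℕ) :
    invSign (insert 0 A) B = invSign A B := by
  unfold invSign
  congr 2
  ext ⟨a, b⟩
  simp only [Finset.mem_filter, Finset.mem_product, Finset.mem_insert]
  constructor
  · rintro ⟨⟨rfl | h, h'⟩, h''⟩
    · simp at h''
    · exact ⟨⟨h, h'⟩, h''⟩
  · rintro ⟨⟨h, h'⟩, h''⟩
    exact ⟨⟨Or.inr h, h'⟩, h''⟩

/-- A new least element of `B` forms an inversion with every element of `A`. -/
theorem invSign_insert_right (A B : Finset ℕ) (hA : 0 ∉ A) (hB : 0 ∉ B) :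
    invSign A (insert 0 B) = (-1) ^ A.card * invSign A B := by
  unfold invSign
  rw [← pow_add]
  congr 1
  rw [show (A ×ˢ insert 0 B).filter (fun p => p.1 > p.2) =
      A ×ˢ {0} ∪ (A ×ˢ B).filter (fun p => p.1 > p.2) from ?_, Finset.card_union_of_disjoint,
      Finset.card_product, Finset.card_singleton, mul_one]
  · rw [Finset.disjoint_left]
    rintro ⟨a, b⟩ h h'
    simp only [Finset.mem_singleton, Finset.mem_filter, Finset.mem_product] at h h'
    exact hB (h.2 ▸ h'.1.2)
  · ext ⟨a, b⟩
    simp only [Finset.mem_filter, Finset.mem_product, Finset.mem_insert, Finset.mem_union,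
      Finset.mem_singleton]
    constructor
    · rintro ⟨⟨h, h' | h'⟩, h''⟩
      · exact Or.inl ⟨h, h'⟩
      · exact Or.inr ⟨⟨h, h'⟩, h''⟩
    · rintro (⟨h, rfl⟩ | ⟨⟨h, h'⟩, h''⟩)
      · exact ⟨⟨h, Or.inl rfl⟩, Nat.pos_of_ne_zero fun h0 => hA (h0 ▸ h)⟩
      · exact ⟨⟨h, Or.inr h'⟩, h''⟩

theorem exists_map_succ (K : ℕ) (X : Finset ℕ) (hX : X ⊆ Finset.range (K + 1)) :
    ∃ Y ⊆ Finset.range K, X = Y.map succEmb.toEmbedding ∨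
      X = insert 0 (Y.map succEmb.toEmbedding) := by
  refine ⟨(Finset.range K).filter (fun k => k + 1 ∈ X), Finset.filter_subset _ _, ?_⟩
  have key : ∀ k, k ≠ 0 → (k ∈ ((Finset.range K).filter (fun k => k + 1 ∈ X)).map
      succEmb.toEmbedding ↔ k ∈ X) := by
    intro k hk
    simp only [Finset.mem_map, Finset.mem_filter, Finset.mem_range]
    constructor
    · rintro ⟨j, ⟨_, h⟩, rfl⟩
      exact h
    · intro h
      have := Finset.mem_range.1 (hX h)
      exact ⟨k - 1, ⟨by omega, by rwa [Nat.sub_add_cancel (by omega)]⟩,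
        show k - 1 + 1 = k by omega⟩
  by_cases h0 : 0 ∈ X
  · right
    ext k
    rcases eq_or_ne k 0 with rfl | hk
    · simp [h0]
    · rw [Finset.mem_insert, key k hk]
      simp [hk]
  · left
    ext k
    rcases eq_or_ne k 0 with rfl | hk
    · simp only [h0, zero_notMem_map_succ]
    · rw [key k hk]

theorem sum_powerset_map {U V : Type*} [DecidableEq V] (e : U ↪ V) (Y : Finset U)
    (φ : Finset V → ℤ) : ∑ A ∈ (Y.map e).powerset, φ A = ∑ A ∈ Y.powerset, φ (A.map e) := by
  classical
  rw [Finset.map_eq_image, Finset.powerset_image, Finset.sum_image]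
  · simp only [Finset.map_eq_image]
  · intro A _ B _ h
    exact Finset.image_injective e.injective h

theorem par_mask (K : ℕ) (A : Finset ℕ) (hA : A ⊆ Finset.range K) :
    par (mask A) = (-1) ^ A.card := by
  induction K generalizing A with
  | zero =>
    obtain rfl : A = ∅ := by simpa using hA
    simp [mask, par_zero]
  | succ K ih =>
    obtain ⟨Y, hY, rfl | rfl⟩ := exists_map_succ K A hA
    · rw [mask_map_succ, par_two_mul, ih Y hY, Finset.card_map]
    · rw [mask_insert_zero, par_two_mul_add_one, ih Y hY,
        Finset.card_insert_of_notMem (zero_notMem_map_succ Y), Finset.card_map, pow_succ]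
      ring

/-- Splitting off the lowest generator in `wedge` corresponds to deciding whether the least element
of `X` belongs to `A` or to `B`. -/
theorem wedge_mask (K : ℕ) (f g : ℕ → ℤ) (X : Finset ℕ) (hX : X ⊆ Finset.range K) :
    wedge K f g (mask X) = nscNat f g X := by
  induction K generalizing f g X with
  | zero =>
    obtain rfl : X = ∅ := by simpa using hX
    simp [mask, wedge, nscNat, invSign]
  | succ K ih =>
    obtain ⟨Y, hY, rfl | rfl⟩ := exists_map_succ K X hX
    · rw [mask_map_succ, wedge_even, ih _ _ Y hY, nscNat, nscNat, sum_powerset_map]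
      refine Finset.sum_congr rfl fun A _ => ?_
      rw [← Finset.map_sdiff, mask_map_succ, mask_map_succ, invSign_map]
      rfl
    · rw [mask_insert_zero, wedge_odd, ih _ _ Y hY, ih _ _ Y hY, nscNat, nscNat, nscNat,
        Finset.sum_powerset_insert (zero_notMem_map_succ Y), sum_powerset_map, sum_powerset_map,
        add_comm]
      congr 1
      · refine Finset.sum_congr rfl fun A hA => ?_
        have hA' : A ⊆ Y := Finset.mem_powerset.1 hA
        rw [Finset.insert_sdiff_of_notMem _ (zero_notMem_map_succ A), ← Finset.map_sdiff,
          mask_map_succ, mask_insert_zero,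
          invSign_insert_right _ _ (zero_notMem_map_succ _) (zero_notMem_map_succ _), invSign_map,
          Finset.card_map, ← par_mask K A (hA'.trans hY)]
        simp only [tw, bsl, add_zero]
        ring
      · refine Finset.sum_congr rfl fun A _ => ?_
        rw [Finset.insert_sdiff_insert, Finset.sdiff_insert_of_notMem (zero_notMem_map_succ Y),
          mask_insert_zero, invSign_insert_left]
        rw [← Finset.map_sdiff, mask_map_succ, invSign_map]
        rfl

/-- The rank of an element of a finite linear order. -/
def rankEmb (U : Type*) [Fintype U] [LinearOrder U] : U ↪o ℕ :=
  OrderEmbedding.ofStrictMono (fun u => (Finset.univ.filter (fun v : U => v < u)).card) <| by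
    intro a b hab
    refine Finset.card_lt_card (Finset.ssubset_iff_of_subset (fun v hv => ?_) |>.2 ⟨a, ?_, ?_⟩)
    · simp only [Finset.mem_filter, Finset.mem_univ, true_and] at hv ⊢
      exact hv.trans hab
    · simpa using hab
    · simp

theorem abs_invSign {V : Type*} [LinearOrder V] (A B : Finset V) : |invSign A B| = 1 := by
  simp [invSign, abs_pow]

section Transport

variable {U : Type*} [Fintype U] [LinearOrder U]

theorem rankEmb_lt (u : U) : rankEmb U u < Fintype.card U :=
  Finset.card_lt_card (Finset.ssubset_univ_iff.2 fun h => by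
    have := Finset.mem_univ u
    rw [← h] at this
    simp at this)

theorem map_rankEmb_subset (X : Finset U) :
    X.map (rankEmb U).toEmbedding ⊆ Finset.range (Fintype.card U) := by
  intro k hk
  obtain ⟨u, _, rfl⟩ := Finset.mem_map.1 hk
  exact Finset.mem_range.2 (rankEmb_lt u)

theorem mask_map_rankEmb (X : Finset U) :
    mask (X.map (rankEmb U).toEmbedding) = subsetPos X := by
  rw [mask, Finset.sum_map]
  rfl

theorem mask_lt (K : ℕ) (A : Finset ℕ) (hA : A ⊆ Finset.range K) : mask A < 2 ^ K :=
  lt_of_le_of_lt (Finset.sum_le_sum_of_subset hA) (by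
    rw [Nat.geomSum_eq le_rfl]
    simp)

theorem subsetPos_lt (X : Finset U) : subsetPos X < 2 ^ Fintype.card U := by
  rw [← mask_map_rankEmb]
  exact mask_lt _ _ (map_rankEmb_subset X)

theorem nsc_eq_sum_powerset (f g : Finset U → ℤ) (X : Finset U) :
    nsc f g X = ∑ A ∈ X.powerset, f A * g (X \ A) * invSign A (X \ A) := by
  refine Finset.sum_nbij' (fun p => p.1) (fun A => (A, X \ A)) ?_ ?_ ?_ ?_ ?_
  · rintro ⟨A, B⟩ h
    obtain ⟨rfl, _⟩ := (Finset.mem_filter.1 h).2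
    exact Finset.mem_powerset.2 Finset.subset_union_left
  · intro A hA
    refine Finset.mem_filter.2 ⟨Finset.mem_univ _, ?_, Finset.inter_sdiff_self _ _⟩
    exact Finset.union_sdiff_of_subset (Finset.mem_powerset.1 hA)
  · rintro ⟨A, B⟩ h
    obtain ⟨rfl, h'⟩ := (Finset.mem_filter.1 h).2
    simp only [Prod.mk.injEq, true_and]
    rw [Finset.union_sdiff_left,
      Finset.sdiff_eq_self_of_disjoint (Finset.disjoint_iff_inter_eq_empty.2 h').symm]
  · intro A _
    rfl
  · rintro ⟨A, B⟩ h
    obtain ⟨rfl, h'⟩ := (Finset.mem_filter.1 h).2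
    simp only
    rw [Finset.union_sdiff_left,
      Finset.sdiff_eq_self_of_disjoint (Finset.disjoint_iff_inter_eq_empty.2 h').symm]

/-- The table of a function on subsets, as a function of natural numbers. -/
def tableOf (f : Finset U → ℤ) : ℕ → ℤ := fun x => arrayOf subsetPos f x

theorem tableOf_subsetPos (f : Finset U → ℤ) (X : Finset U) : tableOf f (subsetPos X) = f X :=
  arrayOf_apply subsetPos_injective f X

/-- The convolution is the exterior product, also if the number of generators is rounded up. -/
theorem wedge_subsetPos (K : ℕ) (hK : Fintype.card U ≤ K) (f g : Finset U → ℤ) (X : Finset U) :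
    wedge K (tableOf f) (tableOf g) (subsetPos X) = nsc f g X := by
  rw [← mask_map_rankEmb, wedge_mask K _ _ _
    ((map_rankEmb_subset X).trans (Finset.range_subset_range.2 hK)), nsc_eq_sum_powerset, nscNat,
    sum_powerset_map]
  refine Finset.sum_congr rfl fun A _ => ?_
  rw [← Finset.map_sdiff, mask_map_rankEmb, mask_map_rankEmb, tableOf_subsetPos, tableOf_subsetPos,
    invSign_map]

theorem sum_sq_le_sum_tableOf (M : ℕ) (hM : 2 ^ Fintype.card U ≤ M) (f : Finset U → ℤ) :
    ∑ A : Finset U, f A ^ 2 ≤ ∑ y ∈ Finset.range M, tableOf f y ^ 2 := by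
  have h : ∑ A : Finset U, f A ^ 2 =
      ∑ y ∈ Finset.univ.image (subsetPos (U := U)), tableOf f y ^ 2 := by
    rw [Finset.sum_image fun A _ B _ h => subsetPos_injective h]
    simp only [tableOf_subsetPos]
  rw [h]
  refine Finset.sum_le_sum_of_subset_of_nonneg (fun y hy => ?_) fun y _ _ => sq_nonneg _
  obtain ⟨A, _, rfl⟩ := Finset.mem_image.1 hy
  exact Finset.mem_range.2 ((subsetPos_lt A).trans_le hM)

/-- The values of the convolution are bounded by the sum of the squares of the inputs. -/
theorem abs_nsc_le (M : ℕ) (hM : 2 ^ Fintype.card U ≤ M) (f g : Finset U → ℤ) (X : Finset U) :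
    |nsc f g X| ≤ ∑ y ∈ Finset.range M, (tableOf f y ^ 2 + tableOf g y ^ 2) := by
  rw [Finset.sum_add_distrib, nsc_eq_sum_powerset]
  refine (Finset.abs_sum_le_sum_abs _ _).trans ?_
  have h1 : ∑ A ∈ X.powerset, f A ^ 2 ≤ ∑ A : Finset U, f A ^ 2 :=
    Finset.sum_le_sum_of_subset_of_nonneg (Finset.subset_univ _) fun _ _ _ => sq_nonneg _
  have h2 : ∑ A ∈ X.powerset, g (X \ A) ^ 2 ≤ ∑ A : Finset U, g A ^ 2 := by
    have : ∑ A ∈ X.powerset, g (X \ A) ^ 2 = ∑ A ∈ X.powerset, g A ^ 2 := by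
      refine Finset.sum_nbij' (fun A => X \ A) (fun A => X \ A) ?_ ?_ ?_ ?_ ?_
      · exact fun A _ => Finset.mem_powerset.2 Finset.sdiff_subset
      · exact fun A _ => Finset.mem_powerset.2 Finset.sdiff_subset
      · exact fun A hA => Finset.sdiff_sdiff_eq_self (Finset.mem_powerset.1 hA)
      · exact fun A hA => Finset.sdiff_sdiff_eq_self (Finset.mem_powerset.1 hA)
      · exact fun A _ => rfl
    rw [this]
    exact Finset.sum_le_sum_of_subset_of_nonneg (Finset.subset_univ _) fun _ _ _ => sq_nonneg _
  have h3 : ∑ A ∈ X.powerset, |f A * g (X \ A) * invSign A (X \ A)| ≤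
      ∑ A ∈ X.powerset, (f A ^ 2 + g (X \ A) ^ 2) := by
    refine Finset.sum_le_sum fun A _ => ?_
    rw [abs_mul, abs_invSign, mul_one, abs_mul, ← sq_abs (f A), ← sq_abs (g (X \ A))]
    nlinarith [sq_nonneg (|f A| - |g (X \ A)|), sq_nonneg (|f A|), sq_nonneg (|g (X \ A)|)]
  rw [Finset.sum_add_distrib] at h3
  have h4 := sum_sq_le_sum_tableOf M hM f
  have h5 := sum_sq_le_sum_tableOf M hM g
  linarith

theorem tableOf_eq_zero (f : Finset U → ℤ) (x : ℕ) (hx : 2 ^ Fintype.card U ≤ x) :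
    tableOf f x = 0 := by
  refine Finset.sum_eq_zero fun A _ => if_neg fun h => ?_
  have := subsetPos_lt A
  omega

theorem abs_arrayOf_le {ι : Type*} [Fintype ι] {pos : ι → ℕ} (hpos : Function.Injective pos)
    (v : ι → ℤ) (B : ℤ) (hB : 0 ≤ B) (h : ∀ x, |v x| ≤ B) (i : ℤ) : |arrayOf pos v i| ≤ B := by
  by_cases hi : ∃ x, (pos x : ℤ) = i
  · obtain ⟨x, rfl⟩ := hi
    rw [arrayOf_apply hpos]
    exact h x
  · rw [arrayOf, Finset.sum_eq_zero fun x _ => if_neg fun hx => hi ⟨x, hx⟩]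
    simpa using hB

end Transport

/-! ### Cost of expressions -/

/-- The number of nodes of an expression, where the absolute value of a literal is added to the
count, so that the length of the value is linear in the size. -/
def Exp.size : Exp → ℕ
  | .const z => z.natAbs + 1
  | .cell _ i => i.size + 1
  | .add d e => d.size + e.size + 1
  | .sub d e => d.size + e.size + 1
  | .mul d e => d.size + e.size + 1
  | .div d e => d.size + e.size + 1

/-- All arrays that occur in an expression have numbers below `20`. The arrays from `20` on are
left to the multiplication program, whose cells have no known bound. -/
def Exp.Low : Exp → Prop
  | .const _ => True
  | .cell a i => a < 20 ∧ i.Low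
  | .add d e => d.Low ∧ e.Low
  | .sub d e => d.Low ∧ e.Low
  | .mul d e => d.Low ∧ e.Low
  | .div d e => d.Low ∧ e.Low

/-- All cells of the arrays with numbers below `20` are bounded by `2 ^ L`. -/
def MemBdd (s : Memory) (L : ℕ) : Prop := ∀ a < 20, ∀ i, |s a i| ≤ 2 ^ L

theorem bits_le {z : ℤ} {k : ℕ} (h : |z| ≤ 2 ^ k) : bits z ≤ k + 2 := by
  have h1 : z.natAbs ≤ 2 ^ k := by
    zify
    exact h
  have h2 : Nat.size z.natAbs ≤ k + 1 :=
    Nat.size_le.2 (h1.trans_lt (Nat.pow_lt_pow_right (by norm_num) (Nat.lt_succ_self k)))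
  unfold bits
  omega

theorem one_le_bits (z : ℤ) : 1 ≤ bits z := Nat.le_add_left _ _

theorem two_pow_add_le {a b c L : ℕ} (ha : 1 ≤ a) (hb : 1 ≤ b) (hL : 1 ≤ L) (hc : a + b ≤ c) :
    (2 : ℤ) ^ (a * L) + 2 ^ (b * L) ≤ 2 ^ (c * L) := by
  have h1 : (2 : ℤ) ^ 1 ≤ 2 ^ (a * L) := pow_le_pow_right₀ (by norm_num) (Nat.mul_pos ha hL)
  have h2 : (2 : ℤ) ^ 1 ≤ 2 ^ (b * L) := pow_le_pow_right₀ (by norm_num) (Nat.mul_pos hb hL)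
  have h3 : (2 : ℤ) ^ (a * L) * 2 ^ (b * L) ≤ 2 ^ (c * L) := by
    rw [← pow_add, ← add_mul]
    exact pow_le_pow_right₀ (by norm_num) (Nat.mul_le_mul_right _ hc)
  nlinarith

theorem Exp.one_le_size (e : Exp) : 1 ≤ e.size := by
  cases e <;> simp [Exp.size]

theorem Exp.abs_val_le {s : Memory} {L : ℕ} (hL : 1 ≤ L) (hs : MemBdd s L) {e : Exp}
    (he : e.Low) : |e.val s| ≤ 2 ^ (e.size * L) := by
  have pos : ∀ k, (0 : ℤ) < 2 ^ k := fun k => by positivity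
  have mono : ∀ a b : ℕ, a ≤ b → (2 : ℤ) ^ (a * L) ≤ 2 ^ (b * L) := fun a b h =>
    pow_le_pow_right₀ (by norm_num) (Nat.mul_le_mul_right _ h)
  have mulb : ∀ d e : Exp, |d.val s| ≤ 2 ^ (d.size * L) → |e.val s| ≤ 2 ^ (e.size * L) →
      |d.val s * e.val s| ≤ 2 ^ ((d.size + e.size + 1) * L) := by
    intro d e hd he
    rw [abs_mul]
    calc |d.val s| * |e.val s| ≤ 2 ^ (d.size * L) * 2 ^ (e.size * L) :=
          mul_le_mul hd he (abs_nonneg _) (pos _).le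
      _ = 2 ^ ((d.size + e.size) * L) := by rw [← pow_add, ← add_mul]
      _ ≤ _ := mono _ _ (Nat.le_succ _)
  induction e with
  | const z =>
    simp only [Exp.val, Exp.size]
    have h1 : z.natAbs ≤ 2 ^ ((z.natAbs + 1) * L) :=
      (Nat.lt_two_pow_self).le.trans (Nat.pow_le_pow_right (by norm_num)
        ((Nat.le_succ _).trans (Nat.le_mul_of_pos_right _ hL)))
    rw [Int.abs_eq_natAbs]
    exact_mod_cast h1
  | cell a i ih =>
    refine (hs a he.1 _).trans ?_
    have := mono 1 (i.size + 1) (by omega)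
    rwa [one_mul] at this
  | add d e ihd ihe =>
    exact (abs_add_le _ _).trans ((add_le_add (ihd he.1) (ihe he.2)).trans
      (two_pow_add_le d.one_le_size e.one_le_size hL (Nat.le_succ _)))
  | sub d e ihd ihe =>
    exact (abs_sub _ _).trans ((add_le_add (ihd he.1) (ihe he.2)).trans
      (two_pow_add_le d.one_le_size e.one_le_size hL (Nat.le_succ _)))
  | mul d e ihd ihe => exact mulb d e (ihd he.1) (ihe he.2)
  | div d e ihd ihe =>
    refine (Int.abs_ediv_le_abs _ _).trans ((ihd he.1).trans (mono _ _ ?_))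
    simp only [Exp.size]
    omega

theorem Exp.bits_val_le {s : Memory} {L : ℕ} (hL : 1 ≤ L) (hs : MemBdd s L) {e : Exp}
    (he : e.Low) : bits (e.val s) ≤ e.size * L + 2 := bits_le (Exp.abs_val_le hL hs he)

/-- The number `B` bounds the lengths of the values of all subexpressions, and each node costs at
most `2 * B ^ 2`. -/
theorem Exp.cost_le_aux {s : Memory} {L : ℕ} (hL : 1 ≤ L) (hs : MemBdd s L) {e : Exp}
    (he : e.Low) (B : ℕ) (hB : e.size * L + 2 ≤ B) : e.cost s ≤ 2 * e.size * B ^ 2 := by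
  have mono : ∀ {a b : ℕ}, a ≤ b → a * L + 2 ≤ b * L + 2 := fun h =>
    Nat.add_le_add_right (Nat.mul_le_mul_right _ h) _
  have hBB : B ≤ B ^ 2 := Nat.le_self_pow (by norm_num) B
  induction e with
  | const z =>
    have h := (Exp.bits_val_le hL hs he).trans hB
    simp only [Exp.cost, Exp.val, Exp.size] at *
    nlinarith [Nat.zero_le (z.natAbs * B ^ 2)]
  | cell a i ih =>
    have h := (Exp.bits_val_le hL hs he).trans hB
    have h1 := (Exp.bits_val_le hL hs he.2).trans ((mono (by simp only [Exp.size]; omega)).trans hB)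
    have h2 := ih he.2 ((mono (by simp only [Exp.size]; omega)).trans hB)
    simp only [Exp.cost, Exp.val, Exp.size] at *
    linarith
  | add d e ihd ihe =>
    have h1 := (Exp.bits_val_le hL hs he.1).trans ((mono (by simp only [Exp.size]; omega)).trans hB)
    have h2 := (Exp.bits_val_le hL hs he.2).trans ((mono (by simp only [Exp.size]; omega)).trans hB)
    have h3 := ihd he.1 ((mono (by simp only [Exp.size]; omega)).trans hB)
    have h4 := ihe he.2 ((mono (by simp only [Exp.size]; omega)).trans hB)
    simp only [Exp.cost, Exp.size]
    linarith
  | sub d e ihd ihe =>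
    have h1 := (Exp.bits_val_le hL hs he.1).trans ((mono (by simp only [Exp.size]; omega)).trans hB)
    have h2 := (Exp.bits_val_le hL hs he.2).trans ((mono (by simp only [Exp.size]; omega)).trans hB)
    have h3 := ihd he.1 ((mono (by simp only [Exp.size]; omega)).trans hB)
    have h4 := ihe he.2 ((mono (by simp only [Exp.size]; omega)).trans hB)
    simp only [Exp.cost, Exp.size]
    linarith
  | mul d e ihd ihe =>
    have h1 := (Exp.bits_val_le hL hs he.1).trans ((mono (by simp only [Exp.size]; omega)).trans hB)
    have h2 := (Exp.bits_val_le hL hs he.2).trans ((mono (by simp only [Exp.size]; omega)).trans hB)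
    have h3 := ihd he.1 ((mono (by simp only [Exp.size]; omega)).trans hB)
    have h4 := ihe he.2 ((mono (by simp only [Exp.size]; omega)).trans hB)
    simp only [Exp.cost, Exp.size]
    have h5 := Nat.mul_le_mul h1 h2
    linarith
  | div d e ihd ihe =>
    have h1 := (Exp.bits_val_le hL hs he.1).trans ((mono (by simp only [Exp.size]; omega)).trans hB)
    have h2 := (Exp.bits_val_le hL hs he.2).trans ((mono (by simp only [Exp.size]; omega)).trans hB)
    have h3 := ihd he.1 ((mono (by simp only [Exp.size]; omega)).trans hB)
    have h4 := ihe he.2 ((mono (by simp only [Exp.size]; omega)).trans hB)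
    simp only [Exp.cost, Exp.size]
    have h5 := Nat.mul_le_mul h1 h2
    linarith

/-- The factor in the cost bound of an expression on a memory with cells of length `L`. -/
def Exp.costConst (e : Exp) : ℕ := 2 * e.size * (e.size + 2) ^ 2

theorem Exp.cost_le {s : Memory} {L : ℕ} (hL : 1 ≤ L) (hs : MemBdd s L) {e : Exp}
    (he : e.Low) : e.cost s ≤ e.costConst * L ^ 2 := by
  have := Exp.cost_le_aux hL hs he ((e.size + 2) * L) (by nlinarith)
  rw [Exp.costConst]
  calc _ ≤ _ := this
    _ = _ := by ring

/-! ### Arithmetic notation for expressions -/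

instance : Add Exp := ⟨.add⟩
instance : Sub Exp := ⟨.sub⟩
instance : Mul Exp := ⟨.mul⟩
instance : Div Exp := ⟨.div⟩
instance (n : ℕ) : OfNat Exp n := ⟨.const n⟩

/-- The value of the scalar in cell `0` of the array `a`. -/
def scalar (a : ℕ) : Exp := .cell a (.const 0)

/-- The loop variable: cell `0` of array `4`. -/
def loopVar : Exp := scalar 4

@[simp] theorem Exp.val_add (s : Memory) (d e : Exp) : (d + e).val s = d.val s + e.val s := rfl

@[simp] theorem Exp.val_sub (s : Memory) (d e : Exp) : (d - e).val s = d.val s - e.val s := rfl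

@[simp] theorem Exp.val_mul (s : Memory) (d e : Exp) : (d * e).val s = d.val s * e.val s := rfl

@[simp] theorem Exp.val_div (s : Memory) (d e : Exp) : (d / e).val s = d.val s / e.val s := rfl

@[simp] theorem Exp.val_ofNat (s : Memory) (n : ℕ) :
    (ofNat(n) : Exp).val s = ((OfNat.ofNat n : ℕ) : ℤ) := rfl

@[simp] theorem Exp.val_const (s : Memory) (z : ℤ) : (Exp.const z).val s = z := rfl

@[simp] theorem Exp.val_cell (s : Memory) (a : ℕ) (i : Exp) :
    (Exp.cell a i).val s = s a (i.val s) := rfl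

@[simp] theorem scalar_val (s : Memory) (a : ℕ) : (scalar a).val s = s a 0 := rfl

@[simp] theorem loopVar_val (s : Memory) : loopVar.val s = s 4 0 := rfl

theorem loopVar_cost (s : Memory) : loopVar.cost s = 2 + bits (s 4 0) := by
  simp [loopVar, scalar, Exp.cost, Exp.val, bits]

@[simp] theorem Exp.low_add (d e : Exp) : (d + e).Low ↔ d.Low ∧ e.Low := Iff.rfl

@[simp] theorem Exp.low_sub (d e : Exp) : (d - e).Low ↔ d.Low ∧ e.Low := Iff.rfl

@[simp] theorem Exp.low_mul (d e : Exp) : (d * e).Low ↔ d.Low ∧ e.Low := Iff.rfl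

@[simp] theorem Exp.low_div (d e : Exp) : (d / e).Low ↔ d.Low ∧ e.Low := Iff.rfl

@[simp] theorem Exp.low_ofNat (n : ℕ) : (ofNat(n) : Exp).Low := trivial

@[simp] theorem Exp.low_const (z : ℤ) : (Exp.const z).Low := trivial

@[simp] theorem Exp.low_cell (a : ℕ) (i : Exp) : (Exp.cell a i).Low ↔ a < 20 ∧ i.Low := Iff.rfl

@[simp] theorem low_scalar (a : ℕ) : (scalar a).Low ↔ a < 20 := and_iff_left trivial

@[simp] theorem low_loopVar : loopVar.Low := ⟨by norm_num, trivial⟩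

/-! ### Programs that fill a table -/

/-- `Runs p s T s'`: the program `p`, started on `s`, halts in the memory `s'` within time `T`. -/
def Runs (p : Prog) (s : Memory) (T : ℕ) (s' : Memory) : Prop := ∃ t ≤ T, Exec p s t s'

theorem Runs.seq {p q : Prog} {s s₁ s₂ : Memory} {T₁ T₂ : ℕ} (h₁ : Runs p s T₁ s₁)
    (h₂ : Runs q s₁ T₂ s₂) : Runs (.seq p q) s (T₁ + T₂) s₂ := by
  obtain ⟨t₁, ht₁, h₁⟩ := h₁
  obtain ⟨t₂, ht₂, h₂⟩ := h₂
  exact ⟨t₁ + t₂, add_le_add ht₁ ht₂, .seq h₁ h₂⟩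

/-- The program that stores the value of `E` in cell `x` of array `a`, for `x = 0, 1, …` below the
value of `lim`. The number `x` is available to `E` as the loop variable, and the cells of `a` filled
before as well. -/
def tab (a : ℕ) (lim E : Exp) : Prog :=
  .seq (.store 4 (.const 0) (.const 0))
    (.loop (.sub lim loopVar)
      (.seq (.store a loopVar E) (.store 4 (.const 0) (.add loopVar (.const 1)))))

/-- The array with the values `φ 0, …, φ (M - 1)` in the cells `0, …, M - 1`, and `0` in all
other cells. -/
def cut (φ : ℕ → ℤ) (M : ℕ) : ℤ → ℤ := fun i => if 0 ≤ i ∧ i < M then φ i.toNat else 0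

theorem cut_natCast (φ : ℕ → ℤ) (M x : ℕ) : cut φ M (x : ℤ) = if x < M then φ x else 0 := by
  simp [cut]

theorem cut_of_lt (φ : ℕ → ℤ) {M x : ℕ} (h : x < M) : cut φ M (x : ℤ) = φ x := by
  simp [cut, h]

theorem cut_of_neg (φ : ℕ → ℤ) (M : ℕ) {i : ℤ} (h : i < 0) : cut φ M i = 0 :=
  if_neg fun h' => by omega

theorem cut_zero (φ : ℕ → ℤ) : cut φ 0 = fun _ => 0 := by
  funext i
  exact if_neg fun h => by push_cast at h; omega

theorem cut_succ (φ : ℕ → ℤ) (M : ℕ) : Function.update (cut φ M) (M : ℤ) (φ M) = cut φ (M + 1) := by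
  funext i
  rcases eq_or_ne i (M : ℤ) with rfl | hi
  · rw [Function.update_self, cut_natCast, if_pos (Nat.lt_succ_self M)]
  · rw [Function.update_of_ne hi]
    unfold cut
    push_cast
    congr 1
    simp only [eq_iff_iff, and_congr_right_iff]
    intro _
    omega

theorem abs_cut_le {φ : ℕ → ℤ} {M : ℕ} {B : ℤ} (hB : 0 ≤ B) (h : ∀ x < M, |φ x| ≤ B) (i : ℤ) :
    |cut φ M i| ≤ B := by
  unfold cut
  split_ifs with hi
  · exact h _ (by omega)
  · simpa using hB

/-- The memory after `x` rounds of a table program for the array `a`. -/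
def tabState (s : Memory) (a : ℕ) (φ : ℕ → ℤ) (x : ℕ) : Memory :=
  Function.update (Function.update s 4 (Function.update (s 4) 0 (x : ℤ))) a (cut φ x)

theorem tabState_self (s : Memory) (a : ℕ) (φ : ℕ → ℤ) (x : ℕ) :
    tabState s a φ x a = cut φ x := Function.update_self ..

theorem tabState_loop {a : ℕ} (ha : a ≠ 4) (s : Memory) (φ : ℕ → ℤ) (x : ℕ) :
    tabState s a φ x 4 = Function.update (s 4) 0 (x : ℤ) := by
  rw [tabState, Function.update_of_ne ha.symm, Function.update_self]

theorem tabState_of_ne {a b : ℕ} (hb : b ≠ a) (hb' : b ≠ 4) (s : Memory) (φ : ℕ → ℤ) (x : ℕ) :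
    tabState s a φ x b = s b := by
  rw [tabState, Function.update_of_ne hb, Function.update_of_ne hb']

theorem tabState_store {a : ℕ} (ha : a ≠ 4) (s : Memory) (φ : ℕ → ℤ) (x : ℕ) :
    Function.update (Function.update (tabState s a φ x) a (cut φ (x + 1))) 4
      (Function.update (tabState s a φ x 4) 0 ((x : ℤ) + 1)) = tabState s a φ (x + 1) := by
  rw [tabState_loop ha, Function.update_idem]
  unfold tabState
  rw [Function.update_idem, Function.update_comm ha, Function.update_idem]
  push_cast
  rfl

/-- Correctness and running time of a table program, for a given bound `c` on the cost of the
expressions and on the lengths of the numbers. -/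
theorem tab_runs_of_cost {a : ℕ} (ha : a ≠ 4) {lim E : Exp} {s : Memory} {φ : ℕ → ℤ} {M c : ℕ}
    (h0 : s a = fun _ => 0)
    (hlim : ∀ x ≤ M, lim.val (tabState s a φ x) = M ∧ lim.cost (tabState s a φ x) ≤ c)
    (hE : ∀ x < M, E.val (tabState s a φ x) = φ x ∧ E.cost (tabState s a φ x) ≤ c)
    (hM : bits M ≤ c) (hx : ∀ x ≤ M, bits x ≤ c) (hφ : ∀ x < M, bits (φ x) ≤ c) :
    Runs (tab a lim E) s (30 * c * (M + 1)) (tabState s a φ M) := by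
  have b0 : bits 0 = 1 := by simp [bits]
  have b1 : bits 1 = 2 := by simp [bits]
  have hc : 1 ≤ c := (one_le_bits _).trans hM
  have hvar : ∀ x, tabState s a φ x 4 0 = x := by
    intro x
    simp [tabState_loop ha]
  have loop : ∀ k x, x + k = M →
      Runs (.loop (.sub lim loopVar)
        (.seq (.store a loopVar E) (.store 4 (.const 0) (.add loopVar (.const 1)))))
        (tabState s a φ x) (26 * c * (k + 1)) (tabState s a φ M) := by
    intro k
    induction k with
    | zero =>
      rintro x rfl
      obtain ⟨h1, h2⟩ := hlim x le_rfl
      have h3 := hx x le_rfl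
      refine ⟨_, ?_, .loop_done ?_⟩
      · simp only [Exp.cost, Exp.val, h1, loopVar_val, loopVar_cost, hvar, add_zero, sub_self, b0]
          at *
        omega
      · simp only [Exp.val, h1, loopVar_val, hvar]
        simp
    | succ k ih =>
      intro x hxk
      obtain ⟨t, ht, hr⟩ := ih (x + 1) (by omega)
      have hxM : x < M := by omega
      obtain ⟨h1, h2⟩ := hlim x hxM.le
      have h3 := hx x hxM.le
      obtain ⟨h4, h4'⟩ := hE x hxM
      have h5 := hφ x hxM
      have h6 := hx (x + 1) (by omega)
      have h7 := hx (M - x) (by omega)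
      rw [Nat.cast_sub hxM.le] at h7
      have g1 : Function.update (tabState s a φ x) a (cut φ (x + 1)) 4 = tabState s a φ x 4 :=
        Function.update_of_ne ha.symm _ _
      have e1 := Exec.store a loopVar E (tabState s a φ x)
      rw [loopVar_val, hvar, h4, tabState_self, cut_succ, loopVar_cost, hvar] at e1
      have e2 := Exec.store 4 (.const 0) (.add loopVar (.const 1))
        (Function.update (tabState s a φ x) a (cut φ (x + 1)))
      rw [g1] at e2
      simp only [Exp.val, Exp.cost, loopVar_val, loopVar_cost, g1, hvar, b0, b1] at e2
      rw [tabState_store ha] at e2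
      refine ⟨_, ?_, .loop_step ?_ (.seq e1 e2) hr⟩
      · simp only [Exp.cost, Exp.val, h1, loopVar_cost, loopVar_val, hvar]
        push_cast at h6
        have : 26 * c * (k + 1 + 1) = 26 * c * (k + 1) + 26 * c := by ring
        omega
      · simp only [Exp.val, h1, loopVar_val, hvar]
        omega
  obtain ⟨t, ht, hr⟩ := loop M 0 (zero_add M)
  have e0 := Exec.store 4 (.const 0) (.const 0) s
  have m0 : Function.update s 4 (Function.update (s 4) 0 0) = tabState s a φ 0 := by
    unfold tabState
    rw [cut_zero, ← h0, Nat.cast_zero]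
    exact (Function.update_eq_self_iff.2 (Function.update_of_ne ha _ _).symm).symm
  simp only [Exp.val, Exp.cost, b0] at e0
  rw [m0] at e0
  refine ⟨_, ?_, .seq e0 hr⟩
  have : 30 * c * (M + 1) = 26 * c * (M + 1) + 4 * c * M + 4 * c := by ring
  have := Nat.zero_le (4 * c * M)
  omega

/-- The factor in the running time bound of a table program. -/
def tabConst (lim E : Exp) : ℕ := 30 * (lim.costConst + E.costConst + 3)

theorem abs_natCast_le {x L : ℕ} (hx : x ≤ 2 ^ L) : |(x : ℤ)| ≤ 2 ^ L := by
  rw [Nat.abs_cast]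
  exact_mod_cast hx

theorem MemBdd.tabState {s : Memory} {L a x : ℕ} {φ : ℕ → ℤ} (hs : MemBdd s L) (ha : a ≠ 4)
    (hx : x ≤ 2 ^ L) (hφ : ∀ y < x, |φ y| ≤ 2 ^ L) : MemBdd (tabState s a φ x) L := by
  intro b hb20 i
  rcases eq_or_ne b a with rfl | hb
  · rw [tabState_self]
    exact abs_cut_le (by positivity) hφ i
  · rcases eq_or_ne b 4 with rfl | hb'
    · rw [tabState_loop ha]
      rcases eq_or_ne i 0 with rfl | hi
      · simpa using abs_natCast_le hx
      · rw [Function.update_of_ne hi]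
        exact hs 4 hb20 i
    · rw [tabState_of_ne hb hb']
      exact hs b hb20 i

/-- Correctness and running time of a table program on a memory with cells of length `L`. The
value of `E` has to be known only on memories in which the cells of `a` before the current one are
filled, and which differ from the initial memory in no other array except that of the loop
variable. -/
theorem tab_runs {a : ℕ} (ha : a ≠ 4) {lim E : Exp} (hl : lim.Low) (he : E.Low) {s : Memory}
    {φ : ℕ → ℤ} {M L : ℕ} (hL : 1 ≤ L) (hs : MemBdd s L) (h0 : s a = fun _ => 0)
    (hlim : ∀ s' : Memory, (∀ b, b ≠ a → b ≠ 4 → s' b = s b) → lim.val s' = M)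
    (hM : M ≤ 2 ^ L) (hφ : ∀ x < M, |φ x| ≤ 2 ^ L)
    (hE : ∀ x < M, ∀ s' : Memory, s' 4 0 = x → s' a = cut φ x →
      (∀ b, b ≠ a → b ≠ 4 → s' b = s b) → E.val s' = φ x) :
    ∃ s', Runs (tab a lim E) s (tabConst lim E * (M + 1) * L ^ 2) s' ∧ s' a = cut φ M ∧
      (∀ b, b ≠ a → b ≠ 4 → s' b = s b) ∧ MemBdd s' L := by
  have hb : ∀ x ≤ M, MemBdd (tabState s a φ x) L := fun x hx =>
    hs.tabState ha (hx.trans hM) fun y hy => hφ y (by omega)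
  have hL2 : L + 2 ≤ 3 * L ^ 2 := by nlinarith
  have hx : ∀ x ≤ M, bits x ≤ (lim.costConst + E.costConst + 3) * L ^ 2 := by
    intro x hx
    have := bits_le (abs_natCast_le (hx.trans hM))
    nlinarith [Nat.zero_le (lim.costConst * L ^ 2), Nat.zero_le (E.costConst * L ^ 2)]
  refine ⟨tabState s a φ M, ?_, tabState_self .., fun b h h' => tabState_of_ne h h' .., hb M le_rfl⟩
  obtain ⟨t, ht, hr⟩ := tab_runs_of_cost (c := (lim.costConst + E.costConst + 3) * L ^ 2) ha h0
    (lim := lim) (E := E) (φ := φ) (M := M)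
    (fun x hxM => ⟨hlim _ fun b h h' => tabState_of_ne h h' .., (Exp.cost_le hL (hb x hxM) hl).trans
      (Nat.mul_le_mul_right _ (by omega))⟩)
    (fun x hxM => ⟨hE x hxM _ (by simp [tabState_loop ha]) (tabState_self ..)
      fun b h h' => tabState_of_ne h h' .., (Exp.cost_le hL (hb x hxM.le) he).trans
      (Nat.mul_le_mul_right _ (by omega))⟩)
    (hx M le_rfl) hx
    (fun x hxM => (bits_le (hφ x hxM)).trans (by
      nlinarith [Nat.zero_le (lim.costConst * L ^ 2), Nat.zero_le (E.costConst * L ^ 2)]))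
  refine ⟨t, ht.trans (le_of_eq ?_), hr⟩
  unfold tabConst
  ring

/-! ### Programs on shifted arrays -/

/-- The expression with all array numbers increased by `d`. -/
def Exp.shift (d : ℕ) : Exp → Exp
  | .const z => .const z
  | .cell a i => .cell (a + d) (i.shift d)
  | .add e f => .add (e.shift d) (f.shift d)
  | .sub e f => .sub (e.shift d) (f.shift d)
  | .mul e f => .mul (e.shift d) (f.shift d)
  | .div e f => .div (e.shift d) (f.shift d)

/-- The program with all array numbers increased by `d`. -/
def Prog.shift (d : ℕ) : Prog → Prog
  | .skip => .skip
  | .store a i e => .store (a + d) (i.shift d) (e.shift d)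
  | .seq p q => .seq (p.shift d) (q.shift d)
  | .ite e p q => .ite (e.shift d) (p.shift d) (q.shift d)
  | .loop e p => .loop (e.shift d) (p.shift d)

theorem Exp.val_shift {d : ℕ} {s s₀ : Memory} (h : ∀ a, s (a + d) = s₀ a) (e : Exp) :
    (e.shift d).val s = e.val s₀ := by
  induction e with
  | const z => rfl
  | cell a i ih => simp only [Exp.shift, Exp.val, ih, h]
  | add e f ihe ihf => simp only [Exp.shift, Exp.val, ihe, ihf]
  | sub e f ihe ihf => simp only [Exp.shift, Exp.val, ihe, ihf]
  | mul e f ihe ihf => simp only [Exp.shift, Exp.val, ihe, ihf]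
  | div e f ihe ihf => simp only [Exp.shift, Exp.val, ihe, ihf]

theorem Exp.cost_shift {d : ℕ} {s s₀ : Memory} (h : ∀ a, s (a + d) = s₀ a) (e : Exp) :
    (e.shift d).cost s = e.cost s₀ := by
  induction e with
  | const z => rfl
  | cell a i ih => simp only [Exp.shift, Exp.cost, Exp.val_shift h, ih, h]
  | add e f ihe ihf => simp only [Exp.shift, Exp.cost, Exp.val_shift h, ihe, ihf]
  | sub e f ihe ihf => simp only [Exp.shift, Exp.cost, Exp.val_shift h, ihe, ihf]
  | mul e f ihe ihf => simp only [Exp.shift, Exp.cost, Exp.val_shift h, ihe, ihf]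
  | div e f ihe ihf => simp only [Exp.shift, Exp.cost, Exp.val_shift h, ihe, ihf]

/-- A shifted program works on the arrays from number `d` on as the original program works on all
arrays, in the same time, and leaves the arrays with numbers below `d` alone. -/
theorem Exec.shift {p : Prog} {s₀ s₁ : Memory} {t : ℕ} (h : Exec p s₀ t s₁) (d : ℕ) (s : Memory)
    (hs : ∀ a, s (a + d) = s₀ a) :
    ∃ s', Exec (p.shift d) s t s' ∧ (∀ a, s' (a + d) = s₁ a) ∧ ∀ a < d, s' a = s a := by
  induction h generalizing s with
  | skip s₀ => exact ⟨s, .skip s, hs, fun _ _ => rfl⟩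
  | store a i e s₀ =>
    have h := Exec.store (a + d) (i.shift d) (e.shift d) s
    rw [Exp.cost_shift hs, Exp.cost_shift hs, Exp.val_shift hs, Exp.val_shift hs] at h
    refine ⟨_, h, fun b => ?_, fun b hb => Function.update_of_ne (by omega) _ _⟩
    rcases eq_or_ne b a with rfl | hb
    · rw [Function.update_self, Function.update_self, hs]
    · rw [Function.update_of_ne (by omega), Function.update_of_ne hb, hs]
  | seq _ _ ih₁ ih₂ =>
    obtain ⟨s', h₁, h₁', k₁⟩ := ih₁ s hs
    obtain ⟨s'', h₂, h₂', k₂⟩ := ih₂ s' h₁'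
    exact ⟨s'', .seq h₁ h₂, h₂', fun a ha => (k₂ a ha).trans (k₁ a ha)⟩
  | ite_pos he _ ih =>
    obtain ⟨s', h, h', k⟩ := ih s hs
    rw [← Exp.val_shift hs] at he
    refine ⟨s', ?_, h', k⟩
    rw [← Exp.val_shift hs, ← Exp.cost_shift hs]
    exact .ite_pos he h
  | ite_neg he _ ih =>
    obtain ⟨s', h, h', k⟩ := ih s hs
    rw [← Exp.val_shift hs] at he
    refine ⟨s', ?_, h', k⟩
    rw [← Exp.val_shift hs, ← Exp.cost_shift hs]
    exact .ite_neg he h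
  | loop_done he =>
    rw [← Exp.val_shift hs] at he
    refine ⟨s, ?_, hs, fun _ _ => rfl⟩
    rw [← Exp.val_shift hs, ← Exp.cost_shift hs]
    exact .loop_done he
  | loop_step he _ _ ih₁ ih₂ =>
    obtain ⟨s', h₁, h₁', k₁⟩ := ih₁ s hs
    obtain ⟨s'', h₂, h₂', k₂⟩ := ih₂ s' h₁'
    rw [← Exp.val_shift hs] at he
    refine ⟨s'', ?_, h₂', fun a ha => (k₂ a ha).trans (k₁ a ha)⟩
    rw [← Exp.val_shift hs, ← Exp.cost_shift hs]
    exact .loop_step he h₁ h₂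

/-! ### Admissible exponents are at least two -/

/-- Every step changes at most one cell, so that the running time bounds the number of cells of an
array that a program changes. -/
theorem Exec.card_changed_le {p : Prog} {s s' : Memory} {t : ℕ} (h : Exec p s t s') (a : ℕ)
    (S : Finset ℤ) : (S.filter fun i => s' a i ≠ s a i).card ≤ t := by
  have trans : ∀ (s₁ s₂ s₃ : Memory) (t₁ t₂ : ℕ), (S.filter fun i => s₂ a i ≠ s₁ a i).card ≤ t₁ →
      (S.filter fun i => s₃ a i ≠ s₂ a i).card ≤ t₂ →
      (S.filter fun i => s₃ a i ≠ s₁ a i).card ≤ t₁ + t₂ := by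
    intro s₁ s₂ s₃ t₁ t₂ h₁ h₂
    refine le_trans ?_ (add_le_add h₁ h₂)
    refine (Finset.card_le_card fun i hi => ?_).trans (Finset.card_union_le _ _)
    rw [Finset.mem_union, Finset.mem_filter, Finset.mem_filter]
    rw [Finset.mem_filter] at hi
    by_cases h : s₂ a i = s₁ a i
    · exact Or.inr ⟨hi.1, h ▸ hi.2⟩
    · exact Or.inl ⟨hi.1, h⟩
  induction h with
  | skip s => simp
  | store b i e s =>
    refine le_trans (Finset.card_le_card (t := {i.val s}) fun j hj => ?_) ?_
    · rw [Finset.mem_filter] at hj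
      rw [Finset.mem_singleton]
      by_contra hne
      refine hj.2 ?_
      rcases eq_or_ne a b with rfl | hab
      · rw [Function.update_self, Function.update_of_ne hne]
      · rw [Function.update_of_ne hab]
    · have := one_le_bits (i.val s)
      rw [Finset.card_singleton]
      omega
  | seq _ _ ih₁ ih₂ => exact trans _ _ _ _ _ ih₁ ih₂
  | ite_pos _ _ ih => omega
  | ite_neg _ _ ih => omega
  | loop_done _ => simp
  | loop_step _ _ _ ih₁ ih₂ => have := trans _ _ _ _ _ ih₁ ih₂; omega

/-- A product of two matrices with all entries `1` has no zero entries, and writing it takes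
`N ^ 2` steps. -/
theorem MultipliesMatrices.sq_le {p : Prog} {T : ℕ → ℕ → ℝ} (h : MultipliesMatrices p T) (N : ℕ)
    (hN : 1 ≤ N) : (N : ℝ) ^ 2 ≤ T N 1 := by
  obtain ⟨t, s', he, ht, hs⟩ := h N 1 (Matrix.of fun _ _ => 1) (Matrix.of fun _ _ => 1) hN
    (by simp) (by simp)
  refine le_trans ?_ ht
  have h1 := he.card_changed_le outputArray
    (Finset.univ.image fun x : Fin N × Fin N => (matrixPos x : ℤ))
  rw [Finset.filter_true_of_mem, Finset.card_image_of_injective, Finset.card_univ,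
    Fintype.card_prod, Fintype.card_fin] at h1
  · rw [sq]
    exact_mod_cast h1
  · exact fun x y hxy => matrixPos_injective (Nat.cast_injective hxy)
  · intro i hi
    obtain ⟨⟨r, c⟩, _, rfl⟩ := Finset.mem_image.1 hi
    rw [hs r c, Matrix.mul_apply]
    simp only [Matrix.of_apply, mul_one, Finset.sum_const, Finset.card_univ, Fintype.card_fin,
      nsmul_eq_mul]
    change (N : ℤ) ≠ 0
    omega

/-- For `w < 2` the bound `4 ^ k ≤ C * 2 ^ (w * k) * (k + 2) ^ c` fails for large `k`. -/
theorem IsMatrixExponent.two_le {w : ℝ} (hw : IsMatrixExponent w) : 2 ≤ w := by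
  obtain ⟨p, C, c, hp⟩ := hw
  by_contra! hlt
  have h : ∀ k : ℕ, (1 : ℝ) ≤ C * (((k + 2 : ℕ) : ℝ) ^ c / ((2 : ℝ) ^ (2 - w)) ^ (k + 2)) *
      ((2 : ℝ) ^ (2 - w)) ^ 2 := by
    intro k
    have h1 := hp.sq_le (2 ^ k) Nat.one_le_two_pow
    simp only [Nat.log_pow Nat.one_lt_two] at h1
    push_cast at h1 ⊢
    have e1 : ((2 : ℝ) ^ k) ^ 2 = (2 : ℝ) ^ ((2 : ℝ) * k) := by
      rw [← pow_mul, mul_comm, ← Real.rpow_natCast]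
      push_cast
      rfl
    have e2 : ((2 : ℝ) ^ k) ^ w = (2 : ℝ) ^ (w * k) := by
      rw [← Real.rpow_natCast, ← Real.rpow_mul (by norm_num), mul_comm]
    have e3 : (2 : ℝ) ^ ((2 : ℝ) * k) = ((2 : ℝ) ^ (2 - w)) ^ k * (2 : ℝ) ^ (w * k) := by
      rw [← Real.rpow_natCast, ← Real.rpow_mul (by norm_num), ← Real.rpow_add (by norm_num)]
      congr 1
      ring
    have p1 : (0 : ℝ) < (2 : ℝ) ^ (w * k) := by positivity
    have p2 : (0 : ℝ) < (2 : ℝ) ^ (2 - w) := by positivity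
    rw [e1, e2, e3] at h1
    have h2 : ((2 : ℝ) ^ (2 - w)) ^ k ≤ C * (k + 2) ^ c := by
      refine le_of_mul_le_mul_right (h1.trans (le_of_eq ?_)) p1
      ring
    rw [pow_add]
    field_simp
    exact h2
  have h2 : (1 : ℝ) < (2 : ℝ) ^ (2 - w) := Real.one_lt_rpow (by norm_num) (by linarith)
  have h3 := (tendsto_pow_const_div_const_pow_of_one_lt c h2).comp (Filter.tendsto_add_atTop_nat 2)
  have h4 := (h3.const_mul C).mul_const (((2 : ℝ) ^ (2 - w)) ^ 2)
  have h5 := ge_of_tendsto' h4 h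
  norm_num at h5

/-! ### The cubic matrix multiplication -/

/-- The partial sums of the scalar products of rows of `u` and columns of `v`: block `i` of length
`N ^ 2` holds the sums of the first `i` terms. -/
def dotTable (N : ℕ) (u v : ℤ → ℤ) (y : ℕ) : ℤ :=
  ∑ k ∈ Finset.range (y / (N * N)),
    u ((y % (N * N) / N * N + k : ℕ) : ℤ) * v ((k * N + y % (N * N) % N : ℕ) : ℤ)

/-- The number `N ^ 2` of matrix entries. -/
def naiveBlock : Exp := scalar 0 * scalar 0

/-- The number of the current block, minus one. -/
def naiveIdx : Exp := loopVar / naiveBlock - 1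

/-- The position in the current block. -/
def naivePos : Exp := loopVar - loopVar / naiveBlock * naiveBlock

/-- The position of the first entry of the current row. -/
def naiveRow : Exp := naivePos / scalar 0 * scalar 0

/-- The value of the next cell of the table of partial sums. In the first block, the cell of array
`2` has a negative number and contributes `0`. -/
def naiveEntry : Exp :=
  .cell 5 (loopVar - naiveBlock) +
    .cell 1 (naiveRow + naiveIdx) * .cell 2 (naiveIdx * scalar 0 + (naivePos - naiveRow))

/-- The multiplication of matrices by the definition. -/
def naiveProg : Prog :=
  .seq (tab 5 ((scalar 0 + 1) * naiveBlock) naiveEntry)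
    (tab 3 naiveBlock (.cell 5 (scalar 0 * naiveBlock + loopVar)))

theorem naiveEntry_val {N : ℕ} (hN : 1 ≤ N) {u v : ℤ → ℤ} (hv : ∀ i < 0, v i = 0) (y : ℕ)
    (s : Memory) (h4 : s 4 0 = y) (h5 : s 5 = cut (dotTable N u v) y) (h0 : s 0 0 = N)
    (h1 : s 1 = u) (h2 : s 2 = v) : naiveEntry.val s = dotTable N u v y := by
  have hNN : 0 < N * N := Nat.mul_pos hN hN
  simp only [naiveEntry, naiveRow, naivePos, naiveIdx, naiveBlock, Exp.val_add, Exp.val_sub,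
    Exp.val_mul, Exp.val_div,
    Exp.val_ofNat, Exp.val_cell, scalar_val, loopVar_val, h4, h5, h0, h1, h2,
    Nat.cast_one]
  obtain ⟨i, x, hx, rfl⟩ : ∃ i x, x < N * N ∧ y = i * (N * N) + x :=
    ⟨y / (N * N), y % (N * N), Nat.mod_lt _ hNN, (Nat.div_add_mod' _ _).symm⟩
  have d1 : ∀ j, (j * (N * N) + x) / (N * N) = j := fun j => by
    rw [Nat.add_comm, Nat.add_mul_div_right _ _ hNN, Nat.div_eq_of_lt hx, zero_add]
  have m1 : ∀ j, (j * (N * N) + x) % (N * N) = x := fun j => by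
    rw [Nat.add_comm, Nat.add_mul_mod_self_right, Nat.mod_eq_of_lt hx]
  have e1 : ((i * (N * N) + x : ℕ) : ℤ) / ((N : ℤ) * N) = i := by
    exact_mod_cast congrArg (Nat.cast (R := ℤ)) (d1 i)
  have e2 : ((i * (N * N) + x : ℕ) : ℤ) - i * ((N : ℤ) * N) = x := by
    push_cast
    ring
  have e3 : (x : ℤ) / (N : ℤ) = ((x / N : ℕ) : ℤ) := (Int.natCast_ediv _ _).symm
  have e4 : (x : ℤ) - ((x / N : ℕ) : ℤ) * N = ((x % N : ℕ) : ℤ) := by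
    rw [sub_eq_iff_eq_add]
    exact_mod_cast (Nat.mod_add_div' x N).symm
  rw [e1, e2, e3, e4]
  rcases i with _ | j
  · have hlt : x % N < N := Nat.mod_lt _ hN
    rw [cut_of_neg _ _ (by push_cast; nlinarith), hv _ (by push_cast; nlinarith)]
    unfold dotTable
    rw [d1]
    simp
  · rw [show (((j + 1) * (N * N) + x : ℕ) : ℤ) - (N : ℤ) * N = ((j * (N * N) + x : ℕ) : ℤ) by
        push_cast; ring, cut_of_lt _ (by nlinarith)]
    unfold dotTable
    rw [d1, d1, m1, m1, Finset.sum_range_succ]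
    push_cast
    ring_nf

theorem abs_dotTable_le {N : ℕ} {u v : ℤ → ℤ} {B : ℤ} (hB : 0 ≤ B) (hu : ∀ i, |u i| ≤ B)
    (hv : ∀ i, |v i| ≤ B) (y : ℕ) : |dotTable N u v y| ≤ (y / (N * N) : ℕ) * (B * B) := by
  refine (Finset.abs_sum_le_sum_abs _ _).trans ?_
  refine (Finset.sum_le_card_nsmul _ _ (B * B) fun k _ => ?_).trans (le_of_eq ?_)
  · rw [abs_mul]
    exact mul_le_mul (hu _) (hv _) (abs_nonneg _) hB
  · rw [Finset.card_range, nsmul_eq_mul]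

theorem arrayOf_matrixPos_neg {N : ℕ} (v : Fin N × Fin N → ℤ) (i : ℤ) (hi : i < 0) :
    arrayOf matrixPos v i = 0 :=
  Finset.sum_eq_zero fun A _ => if_neg fun h => by omega

/-- The matrix multiplication by the definition has the exponent `3`. -/
theorem isMatrixExponent_three : IsMatrixExponent 3 := by
  set κ₁ := tabConst ((scalar 0 + 1) * naiveBlock) naiveEntry
  set κ₂ := tabConst naiveBlock (.cell 5 (scalar 0 * naiveBlock + loopVar))
  refine ⟨naiveProg, ((27 * (κ₁ + κ₂) : ℕ) : ℝ), 2, fun N b A B hN hA hB => ?_⟩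
  set u := arrayOf matrixPos fun x : Fin N × Fin N => A x.1 x.2
  set v := arrayOf matrixPos fun x : Fin N × Fin N => B x.1 x.2
  have hv : ∀ i < 0, v i = 0 := arrayOf_matrixPos_neg _
  set ℓ := Nat.log 2 N + 1 with hℓ
  have hNℓ : N + 1 ≤ 2 ^ ℓ := Nat.lt_pow_succ_log_self (by norm_num) N
  set L := 2 * b + 3 * ℓ with hLdef
  have hL : 1 ≤ L := by omega
  have hNN : 0 < N * N := Nat.mul_pos hN hN
  have mono : ∀ k, k ≤ L → (2 : ℤ) ^ k ≤ 2 ^ L := fun k h => pow_le_pow_right₀ (by norm_num) h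
  have hu1 : ∀ i, |u i| ≤ 2 ^ b :=
    abs_arrayOf_le matrixPos_injective _ _ (by positivity) fun x => (hA _ _).le
  have hv1 : ∀ i, |v i| ≤ 2 ^ b :=
    abs_arrayOf_le matrixPos_injective _ _ (by positivity) fun x => (hB _ _).le
  have hlim : (N + 1) * (N * N) ≤ 2 ^ L := by
    calc (N + 1) * (N * N) ≤ 2 ^ ℓ * (2 ^ ℓ * 2 ^ ℓ) := by gcongr <;> omega
      _ = 2 ^ (3 * ℓ) := by ring
      _ ≤ 2 ^ L := Nat.pow_le_pow_right (by norm_num) (by omega)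
  have hdot : ∀ y < (N + 1) * (N * N), |dotTable N u v y| ≤ 2 ^ L := by
    intro y hy
    refine (abs_dotTable_le (by positivity) hu1 hv1 y).trans ?_
    have h1 : y / (N * N) ≤ 2 ^ ℓ := ((Nat.div_lt_iff_lt_mul hNN).2 hy).le.trans hNℓ
    calc ((y / (N * N) : ℕ) : ℤ) * (2 ^ b * 2 ^ b) ≤ 2 ^ ℓ * (2 ^ b * 2 ^ b) := by
          gcongr
          exact_mod_cast h1
      _ = 2 ^ (2 * b + ℓ) := by ring
      _ ≤ 2 ^ L := mono _ (by omega)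
  have hN' : |(N : ℤ)| ≤ 2 ^ L := by
    rw [Nat.abs_cast]
    exact_mod_cast (show N ≤ (N + 1) * (N * N) by nlinarith).trans hlim
  have hmem : MemBdd (inputMemory N u v) L := by
    intro a _ i
    match a with
    | 0 =>
      simp only [inputMemory]
      split_ifs
      · exact hN'
      · simp
    | 1 => exact (hu1 i).trans (mono _ (by omega))
    | 2 => exact (hv1 i).trans (mono _ (by omega))
    | _ + 3 => simp [inputMemory]
  obtain ⟨s₁, r₁, t₁, f₁, b₁⟩ := tab_runs (a := 5) (by norm_num)
    (lim := (scalar 0 + 1) * naiveBlock) (E := naiveEntry)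
    (φ := dotTable N u v) (M := (N + 1) * (N * N))
    (by simp [naiveBlock])
    (by simp [naiveEntry, naiveRow, naivePos, naiveIdx, naiveBlock])
    hL hmem rfl
    (by
      intro s' h
      simp [naiveBlock, h 0 (by norm_num) (by norm_num), inputMemory])
    hlim hdot
    (by
      intro y hy s' h4 h5 h
      refine naiveEntry_val hN hv y s' h4 h5 ?_ ?_ ?_
      · rw [h 0 (by norm_num) (by norm_num)]
        simp [inputMemory]
      · exact h 1 (by norm_num) (by norm_num)
      · exact h 2 (by norm_num) (by norm_num))
  have f₁0 : s₁ 0 0 = N := by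
    rw [f₁ 0 (by norm_num) (by norm_num)]
    simp [inputMemory]
  have hidx : ∀ x < N * N, N * (N * N) + x < (N + 1) * (N * N) := fun x hx => by linarith
  obtain ⟨s₂, r₂, t₂, -, -⟩ := tab_runs (a := 3) (by norm_num)
    (lim := naiveBlock) (E := .cell 5 (scalar 0 * naiveBlock + loopVar))
    (φ := fun x => dotTable N u v (N * (N * N) + x)) (M := N * N)
    (by simp [naiveBlock])
    (by simp [naiveBlock])
    hL b₁ (by rw [f₁ 3 (by norm_num) (by norm_num)]; rfl)
    (by
      intro s' h
      simp [naiveBlock, h 0 (by norm_num) (by norm_num), f₁0])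
    ((show N * N ≤ (N + 1) * (N * N) by nlinarith).trans hlim)
    (fun x hx => hdot _ (hidx x hx))
    (by
      intro x hx s' h4 h3 h
      have : s' 5 ((N * (N * N) + x : ℕ) : ℤ) = dotTable N u v (N * (N * N) + x) := by
        rw [h 5 (by norm_num) (by norm_num), t₁, cut_of_lt _ (hidx x hx)]
      push_cast at this
      simp only [naiveBlock, Exp.val_add, Exp.val_mul, Exp.val_cell, scalar_val, loopVar_val,
        h4, h 0 (by norm_num) (by norm_num),
        f₁0, this])
  obtain ⟨t, ht, hr⟩ := r₁.seq r₂
  refine ⟨t, s₂, hr, ?_, ?_⟩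
  · have h1 : t ≤ 27 * (κ₁ + κ₂) * N ^ 3 * (b + Nat.log 2 N + 1) ^ 2 := by
      have hN3 : N * N + 1 ≤ 2 * N ^ 3 := by nlinarith [Nat.mul_le_mul_left (N * N) hN]
      have hN3' : (N + 1) * (N * N) + 1 ≤ 3 * N ^ 3 := by
        nlinarith [Nat.mul_le_mul_left (N * N) hN]
      have hL3 : L ^ 2 ≤ 9 * (b + Nat.log 2 N + 1) ^ 2 := by
        rw [show 9 * (b + Nat.log 2 N + 1) ^ 2 = (3 * (b + Nat.log 2 N + 1)) ^ 2 by ring]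
        exact Nat.pow_le_pow_left (by omega) 2
      calc t ≤ κ₁ * ((N + 1) * (N * N) + 1) * L ^ 2 + κ₂ * (N * N + 1) * L ^ 2 := ht
        _ ≤ κ₁ * (3 * N ^ 3) * L ^ 2 + κ₂ * (3 * N ^ 3) * L ^ 2 := by
          gcongr
          omega
        _ = 3 * (κ₁ + κ₂) * N ^ 3 * L ^ 2 := by ring
        _ ≤ 3 * (κ₁ + κ₂) * N ^ 3 * (9 * (b + Nat.log 2 N + 1) ^ 2) := by gcongr
        _ = _ := by ring
    have h2 : (N : ℝ) ^ (3 : ℝ) = (N : ℝ) ^ 3 := by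
      rw [← Real.rpow_natCast]
      norm_num
    simp only [h2]
    exact_mod_cast h1
  · intro i j
    have hpos : matrixPos (i, j) < N * N := by
      have h1 := i.isLt
      have h2 := j.isLt
      simp only [matrixPos]
      nlinarith
    change s₂ 3 _ = _
    rw [t₂, cut_of_lt _ hpos, Matrix.mul_apply, Finset.sum_fin_eq_sum_range]
    unfold dotTable
    rw [show (N * (N * N) + matrixPos (i, j)) / (N * N) = N by
      rw [Nat.add_comm, Nat.add_mul_div_right _ _ hNN, Nat.div_eq_of_lt hpos, zero_add],
      show (N * (N * N) + matrixPos (i, j)) % (N * N) = matrixPos (i, j) by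
      rw [Nat.add_comm, Nat.add_mul_mod_self_right, Nat.mod_eq_of_lt hpos]]
    refine Finset.sum_congr rfl fun k hk => ?_
    have hk' := Finset.mem_range.1 hk
    rw [dif_pos hk']
    have e1 : matrixPos (i, j) / N = i := by
      simp only [matrixPos]
      rw [Nat.add_comm, Nat.add_mul_div_right _ _ hN, Nat.div_eq_of_lt j.isLt, zero_add]
    have e2 : matrixPos (i, j) % N = j := by
      simp only [matrixPos]
      rw [Nat.add_comm, Nat.add_mul_mod_self_right, Nat.mod_eq_of_lt j.isLt]
    rw [e1, e2]
    exact congrArg₂ (· * ·)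
      (arrayOf_apply matrixPos_injective (fun x : Fin N × Fin N => A x.1 x.2) (i, ⟨k, hk'⟩))
      (arrayOf_apply matrixPos_injective (fun x : Fin N × Fin N => B x.1 x.2) (⟨k, hk'⟩, j))

/-! ### The expressions of the convolution program -/

/-- The number `m = ⌈n / 2⌉` of pairs. -/
def pairsE : Exp := (scalar 0 + 1) / 2

/-- The next power of two. Dividing `1` by `x + 1` yields `1` for `x = 0` and `0` otherwise. -/
def powE : Exp := .cell 5 (loopVar - 1) + .cell 5 (loopVar - 1) + 1 / (loopVar + 1)

/-- The size `N = 2 ^ m` of the matrices. -/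
def sizeE : Exp := .cell 5 pairsE

/-- The number `N ^ 2` of matrix entries, which is the length of the tables. -/
def blockE : Exp := scalar 7 * scalar 7

/-- The next partial sum of the squares of the inputs. -/
def sumE : Exp :=
  .cell 6 (loopVar - 1) +
    2 * (.cell 1 loopVar * .cell 1 loopVar + .cell 2 loopVar * .cell 2 loopVar)

/-- The modulus `q`. -/
def modulusE : Exp := 1 + .cell 6 (blockE - 1)

/-- The next parity sign, from the one in cell `x / 2`. For `x = 0` that cell is still `0`, and the
summand `1 / (x + 1)` supplies the initial value. -/
def parE : Exp := .cell 9 (loopVar / 2) * (1 - 2 * (loopVar - loopVar / 2 * 2)) + 1 / (loopVar + 1)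

/-- The next value of `sg`, from the one in cell `x / 4` and the parity signs. -/
def sgE : Exp :=
  .cell 10 (loopVar / 4) * (1 + (loopVar - loopVar / 2 * 2) * (.cell 9 (loopVar / 4) - 1)) +
    1 / (loopVar + 1)

/-- The next weight, from the one in cell `x / 4`. -/
def wtE : Exp :=
  .cell 11 (loopVar / 4) * (1 + (loopVar - loopVar / 4 * 4) / 2 * (scalar 8 - 1)) +
    1 / (loopVar + 1)

/-- The row of the matrix entry at the current position. -/
def rowE : Exp := loopVar / scalar 7

/-- The column of the matrix entry at the current position. -/
def colE : Exp := loopVar - loopVar / scalar 7 * scalar 7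

/-- The next value of `mor` on matrix positions, from the one for half the row and half the
column. -/
def morE : Exp :=
  4 * .cell 12 (rowE / 2 * scalar 7 + colE / 2) + 2 * (rowE - rowE / 2 * 2) + (colE - colE / 2 * 2)

/-- The matrix position of the next mask, from the one in cell `x / 4`. -/
def posE : Exp :=
  2 * .cell 13 (loopVar / 4) + scalar 7 * (loopVar / 2 - loopVar / 2 / 2 * 2) +
    (loopVar - loopVar / 2 * 2)

/-- The place value `4 ^ (i - 1)` of the digit that is transformed in block `i`. -/
def placeE : Exp := .cell 5 (loopVar / blockE - 1) * .cell 5 (loopVar / blockE - 1)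

/-- The base-four digit at the current place. -/
def digitE : Exp := loopVar / placeE - loopVar / placeE / 4 * 4

/-- The next value of the table `a` of the successive digit transforms with parameter `κ` of the
table given by the expression `init`: block `i` is obtained from block `i - 1`, and block `0` from
`init`, which vanishes in all other blocks. For a digit `d` the quotients `(3 - d) / 3` and `d / 3`
are the indicators of `d = 0` and `d = 3`. -/
def levE (a κ : ℕ) (init : Exp) : Exp :=
  init + (.cell a (loopVar - blockE + placeE * (3 * (.const κ * ((3 - digitE) / 3) - digitE / 3))) +
    ((1 - .const κ) * ((3 - digitE) / 3) - .const κ * (digitE / 3)) *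
      .cell a (loopVar - blockE + placeE * (3 * ((3 - digitE) / 3))))

/-- The matrix entry at the current position, from the table `a` of transforms. -/
def entryE (a : ℕ) : Exp :=
  .cell 10 (.cell 12 loopVar) * .cell a (pairsE * blockE + .cell 12 loopVar)

/-- The quotient of the transformed value by its weight, shifted by half of the modulus. -/
def quotE : Exp := .cell 17 (pairsE * blockE + loopVar) / .cell 11 loopVar + scalar 8 / 2

/-- The remainder of least absolute value modulo `q`. -/
def finalE : Exp := quotE - scalar 8 * (quotE / scalar 8) - scalar 8 / 2

theorem one_div_succ (x : ℕ) : (1 : ℤ) / ((x : ℤ) + 1) = if x = 0 then 1 else 0 := by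
  split_ifs with h
  · simp [h]
  · exact Int.ediv_eq_zero_of_lt (by norm_num) (by omega)

theorem natCast_sub_div_mul (x k : ℕ) : (x : ℤ) - (x : ℤ) / k * k = ((x % k : ℕ) : ℤ) := by
  rw [sub_eq_iff_eq_add]
  exact_mod_cast (Nat.mod_add_div' x k).symm

theorem natCast_mod_two (x : ℕ) : (x : ℤ) - ((x / 2 : ℕ) : ℤ) * 2 = ((x % 2 : ℕ) : ℤ) := by
  omega

theorem natCast_mod_four (x : ℕ) : (x : ℤ) - ((x / 4 : ℕ) : ℤ) * 4 = ((x % 4 : ℕ) : ℤ) := by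
  omega

theorem natCast_div_two (x : ℕ) : (x : ℤ) / 2 = ((x / 2 : ℕ) : ℤ) := by simp

theorem natCast_div_four (x : ℕ) : (x : ℤ) / 4 = ((x / 4 : ℕ) : ℤ) := by simp

theorem pairsE_val {s : Memory} {n : ℕ} (h0 : s 0 0 = n) :
    pairsE.val s = (((n + 1) / 2 : ℕ) : ℤ) := by
  simp [pairsE, h0]

theorem blockE_val {s : Memory} {m : ℕ} (h7 : s 7 0 = 2 ^ m) :
    blockE.val s = ((4 ^ m : ℕ) : ℤ) := by
  simp only [blockE, Exp.val_mul, scalar_val, h7]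
  push_cast
  rw [← mul_pow]
  norm_num

theorem powE_val {s : Memory} (x : ℕ) (h4 : s 4 0 = x) (h5 : s 5 = cut (fun k => 2 ^ k) x) :
    powE.val s = 2 ^ x := by
  simp only [powE, Exp.val_add, Exp.val_sub, Exp.val_div, Exp.val_ofNat, Exp.val_cell, loopVar_val,
    h4, h5]
  rcases x with _ | x
  · simp [cut_zero]
  · rw [show ((x + 1 : ℕ) : ℤ) - ((1 : ℕ) : ℤ) = (x : ℤ) by push_cast; ring,
      cut_of_lt _ (Nat.lt_succ_self x), Nat.cast_one, one_div_succ, if_neg (by omega)]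
    ring

theorem sumE_val {s : Memory} {f g : ℕ → ℤ} (x : ℕ) (h4 : s 4 0 = x)
    (h6 : s 6 = cut (fun x => 2 * ∑ y ∈ Finset.range (x + 1), (f y ^ 2 + g y ^ 2)) x)
    (h1 : ∀ x : ℕ, s 1 x = f x) (h2 : ∀ x : ℕ, s 2 x = g x) :
    sumE.val s = 2 * ∑ y ∈ Finset.range (x + 1), (f y ^ 2 + g y ^ 2) := by
  simp only [sumE, Exp.val_add, Exp.val_sub, Exp.val_mul, Exp.val_ofNat, Exp.val_cell, loopVar_val,
    h4, h6, h1, h2]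
  rcases x with _ | x
  · simp [cut_zero]
    ring
  · rw [show ((x + 1 : ℕ) : ℤ) - ((1 : ℕ) : ℤ) = (x : ℤ) by push_cast; ring,
      cut_of_lt _ (Nat.lt_succ_self x), Finset.sum_range_succ _ (x + 1)]
    push_cast
    ring

theorem parE_val {s : Memory} (x : ℕ) (h4 : s 4 0 = x) (h9 : s 9 = cut par x) :
    parE.val s = par x := by
  simp only [parE, Exp.val_add, Exp.val_sub, Exp.val_mul, Exp.val_div, Exp.val_ofNat, Exp.val_cell,
    loopVar_val, h4, h9, Nat.cast_ofNat, Nat.cast_one, natCast_mod_two, natCast_div_two,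
    one_div_succ]
  rcases Nat.eq_zero_or_pos x with rfl | hx
  · simp [cut_zero, par_zero]
  · rw [cut_of_lt _ (by omega), if_neg (by omega), add_zero, par.eq_1 x, if_neg (by omega)]

theorem sgE_val {s : Memory} {M : ℕ} (x : ℕ) (hx : x < M) (h4 : s 4 0 = x) (h10 : s 10 = cut sg x)
    (h9 : s 9 = cut par M) : sgE.val s = sg x := by
  simp only [sgE, Exp.val_add, Exp.val_sub, Exp.val_mul, Exp.val_div, Exp.val_ofNat, Exp.val_cell,
    loopVar_val, h4, h9, h10, Nat.cast_ofNat, Nat.cast_one, natCast_mod_two, natCast_div_two,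
    natCast_div_four, one_div_succ]
  rcases Nat.eq_zero_or_pos x with rfl | hx0
  · simp [cut_zero, sg_zero]
  · rw [cut_of_lt _ (by omega), cut_of_lt _ (by omega), if_neg (by omega), add_zero, sg.eq_1 x,
      if_neg (by omega)]
    rcases Nat.mod_two_eq_zero_or_one x with h | h <;> simp [h]

theorem wtE_val {s : Memory} {q : ℤ} (x : ℕ) (h4 : s 4 0 = x) (h11 : s 11 = cut (wt q) x)
    (h8 : s 8 0 = q) : wtE.val s = wt q x := by
  simp only [wtE, Exp.val_add, Exp.val_sub, Exp.val_mul, Exp.val_div, Exp.val_ofNat, Exp.val_cell,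
    loopVar_val, scalar_val, h4, h8, h11, Nat.cast_ofNat, Nat.cast_one, natCast_mod_four,
    natCast_div_four, natCast_div_two, one_div_succ]
  rcases Nat.eq_zero_or_pos x with rfl | hx0
  · simp [cut_zero, wt_zero]
  · rw [cut_of_lt _ (by omega), if_neg (by omega), add_zero, wt.eq_1 q x, if_neg (by omega)]
    split_ifs with h
    · rw [show x % 4 / 2 = 1 by omega]
      push_cast
      ring
    · rw [show x % 4 / 2 = 0 by omega]
      push_cast
      ring

theorem morE_val {s : Memory} {N : ℕ} (hN : 1 ≤ N) (y : ℕ) (h4 : s 4 0 = y)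
    (h12 : s 12 = cut (fun y => (mor (y / N) (y % N) : ℤ)) y) (h7 : s 7 0 = N) :
    morE.val s = mor (y / N) (y % N) := by
  have e1 : (y : ℤ) / (N : ℤ) = ((y / N : ℕ) : ℤ) := (Int.natCast_ediv _ _).symm
  have e2 := natCast_sub_div_mul y N
  rw [e1] at e2
  simp only [morE, rowE, colE, Exp.val_add, Exp.val_sub, Exp.val_mul, Exp.val_div, Exp.val_ofNat,
    Exp.val_cell, loopVar_val, scalar_val, h4, h7, h12, Nat.cast_ofNat, e1, e2, natCast_mod_two,
    natCast_div_two]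
  obtain ⟨r, c, hc, rfl⟩ : ∃ r c, c < N ∧ y = r * N + c :=
    ⟨y / N, y % N, Nat.mod_lt _ hN, (Nat.div_add_mod' _ _).symm⟩
  have d1 : ∀ r c, c < N → (r * N + c) / N = r := fun r c hc => by
    rw [Nat.add_comm, Nat.add_mul_div_right _ _ hN, Nat.div_eq_of_lt hc, zero_add]
  have m1 : ∀ r c, c < N → (r * N + c) % N = c := fun r c hc => by
    rw [Nat.add_comm, Nat.add_mul_mod_self_right, Nat.mod_eq_of_lt hc]
  rw [d1 r c hc, m1 r c hc, mor_eq r c]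
  have e3 : cut (fun y => (mor (y / N) (y % N) : ℤ)) (r * N + c)
      (((r / 2 : ℕ) : ℤ) * (N : ℤ) + ((c / 2 : ℕ) : ℤ)) = mor (r / 2) (c / 2) := by
    rw [show ((r / 2 : ℕ) : ℤ) * (N : ℤ) + ((c / 2 : ℕ) : ℤ) =
      ((r / 2 * N + c / 2 : ℕ) : ℤ) by push_cast; ring, cut_natCast, d1 _ _ (by omega),
      m1 _ _ (by omega)]
    split_ifs with h
    · rfl
    · -- only the position `0` reads a cell that is not filled yet, and `mor 0 0 = 0`
      have h1 : r / 2 * N ≤ r * N := Nat.mul_le_mul_right _ (by omega)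
      obtain ⟨h2, h3⟩ : r * N = 0 ∧ c = 0 := by
        rcases Nat.eq_zero_or_pos r with rfl | hr
        · simp at h ⊢
          omega
        · have : r / 2 * N < r * N := Nat.mul_lt_mul_of_pos_right (by omega) hN
          omega
      have h4 : r = 0 := by
        rcases Nat.mul_eq_zero.1 h2 with h | h <;> omega
      simp [h4, h3, mor_zero]
  rw [e3]
  push_cast
  ring

theorem posE_val {s : Memory} {N : ℕ} (x : ℕ) (h4 : s 4 0 = x)
    (h13 : s 13 = cut (fun x => ((row x * N + col x : ℕ) : ℤ)) x) (h7 : s 7 0 = N) :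
    posE.val s = ((row x * N + col x : ℕ) : ℤ) := by
  simp only [posE, Exp.val_add, Exp.val_sub, Exp.val_mul, Exp.val_div, Exp.val_ofNat, Exp.val_cell,
    loopVar_val, scalar_val, h4, h7, h13, Nat.cast_ofNat, natCast_mod_two, natCast_div_two,
    natCast_div_four]
  rcases Nat.eq_zero_or_pos x with rfl | hx
  · simp [cut_zero, row_zero, col_zero]
  · rw [cut_of_lt _ (by omega), row_eq x, col_eq x]
    push_cast
    ring

/-- The arithmetic in `levE` computes the digits and the coefficient of the transform. -/
theorem digitE_cases {d : ℕ} (κ : ℕ) (hd : d < 4) :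
    3 * ((κ : ℤ) * ((3 - (d : ℤ)) / 3) - (d : ℤ) / 3) = (digA κ d : ℤ) - d ∧
    3 * ((3 - (d : ℤ)) / 3) = (digB d : ℤ) - d ∧
    (1 - (κ : ℤ)) * ((3 - (d : ℤ)) / 3) - κ * ((d : ℤ) / 3) = digC κ d := by
  interval_cases d <;> norm_num [digA, digB, digC]

/-- Replacing a digit of `x < P * (4 * K)` at the place `P` does not lead out of the range. -/
theorem replace_digit_lt {P K x a : ℕ} (hP : 0 < P) (hx : x < P * (4 * K)) (ha : a < 4) :
    x - x / P % 4 * P + a * P < P * (4 * K) := by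
  have h1 := Nat.div_add_mod x P
  have h2 := Nat.mod_lt x hP
  have h3 := Nat.div_add_mod (x / P) 4
  have h4 : x / P < 4 * K := (Nat.div_lt_iff_lt_mul hP).2 (by linarith)
  have h5 : x / P / 4 < K := by omega
  set h := x / P / 4
  set d := x / P % 4
  have h6 : x = d * P + (P * (4 * h) + x % P) := by
    conv_lhs => rw [← h1, ← h3]
    ring
  have h7 : x - d * P = P * (4 * h) + x % P := by
    conv_lhs => rw [h6]
    rw [Nat.add_sub_cancel_left]
  rw [h7]
  calc P * (4 * h) + x % P + a * P < P * (4 * h) + P + 3 * P := by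
        have : a * P ≤ 3 * P := Nat.mul_le_mul_right _ (by omega)
        omega
    _ = P * (4 * (h + 1)) := by ring
    _ ≤ _ := Nat.mul_le_mul_left _ (by omega)

theorem levE_val {s : Memory} {a m κ : ℕ} (hκ : κ ≤ 1) {init : Exp} {F : ℕ → ℤ} (y : ℕ)
    (hy : y < (m + 1) * 4 ^ m) (h4 : s 4 0 = y)
    (ha : s a = cut (fun y => lev κ (y / 4 ^ m) F (y % 4 ^ m)) y)
    (h5 : s 5 = cut (fun k => 2 ^ k) (m + 1)) (h7 : s 7 0 = 2 ^ m)
    (hinit : init.val s = if y < 4 ^ m then F y else 0) :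
    (levE a κ init).val s = lev κ (y / 4 ^ m) F (y % 4 ^ m) := by
  have hM : 0 < 4 ^ m := by positivity
  obtain ⟨i, x, hx, rfl⟩ : ∃ i x, x < 4 ^ m ∧ y = i * 4 ^ m + x :=
    ⟨y / 4 ^ m, y % 4 ^ m, Nat.mod_lt _ hM, (Nat.div_add_mod' _ _).symm⟩
  have d1 : ∀ j x, x < 4 ^ m → (j * 4 ^ m + x) / 4 ^ m = j := fun j x hx => by
    rw [Nat.add_comm, Nat.add_mul_div_right _ _ hM, Nat.div_eq_of_lt hx, zero_add]
  have m1 : ∀ j x, x < 4 ^ m → (j * 4 ^ m + x) % 4 ^ m = x := fun j x hx => by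
    rw [Nat.add_comm, Nat.add_mul_mod_self_right, Nat.mod_eq_of_lt hx]
  have e1 : ((i * 4 ^ m + x : ℕ) : ℤ) / ((4 ^ m : ℕ) : ℤ) = i := by
    rw [← Int.natCast_ediv, d1 i x hx]
  have hi : i < m + 1 := by
    by_contra! h
    have := Nat.mul_le_mul_right (4 ^ m) h
    omega
  simp only [levE, digitE, placeE, Exp.val_add, Exp.val_sub, Exp.val_mul, Exp.val_div,
    Exp.val_ofNat, Exp.val_cell, loopVar_val, Exp.val_const, blockE_val h7, hinit, h4, h5, ha,
    Nat.cast_ofNat, Nat.cast_one, e1, d1 i x hx, m1 i x hx]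
  rcases i with _ | j
  · -- in block `0` the place value reads as `0`, and the preceding block as `0`
    simp only [Nat.zero_mul, Nat.zero_add]
    have hneg : (x : ℤ) - ((4 ^ m : ℕ) : ℤ) < 0 := by omega
    rw [cut_of_neg (fun k => (2 : ℤ) ^ k) _ (by simp : ((0 : ℕ) : ℤ) - 1 < 0)]
    simp only [mul_zero, zero_mul, add_zero, cut_of_neg _ _ hneg, if_pos hx]
    rfl
  · rw [if_neg (by rw [add_mul]; omega), zero_add]
    rw [show ((j + 1 : ℕ) : ℤ) - 1 = (j : ℤ) by push_cast; ring, cut_of_lt _ (by omega)]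
    have eP : (2 : ℤ) ^ j * 2 ^ j = ((4 ^ j : ℕ) : ℤ) := by
      push_cast
      rw [← mul_pow]
      norm_num
    obtain ⟨K, hK⟩ : ∃ K, 4 ^ m = 4 ^ j * (4 * K) := by
      refine ⟨4 ^ (m - j - 1), ?_⟩
      rw [← pow_succ', ← pow_add]
      congr 1
      omega
    have hP : 0 < 4 ^ j := by positivity
    have ed : ((j + 1) * 4 ^ m + x) / 4 ^ j % 4 = x / 4 ^ j % 4 := by
      rw [hK, show (j + 1) * (4 ^ j * (4 * K)) + x = x + 4 ^ j * ((j + 1) * K * 4) by ring,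
        Nat.add_mul_div_left _ _ hP, Nat.add_mul_mod_self_right]
    have ed' : (((j + 1) * 4 ^ m + x : ℕ) : ℤ) / ((4 ^ j : ℕ) : ℤ) -
        (((j + 1) * 4 ^ m + x : ℕ) : ℤ) / ((4 ^ j : ℕ) : ℤ) / 4 * 4 =
        ((x / 4 ^ j % 4 : ℕ) : ℤ) := by
      rw [← Int.natCast_ediv, natCast_div_four, natCast_mod_four, ed]
    rw [eP, ed']
    have hd : x / 4 ^ j % 4 < 4 := Nat.mod_lt _ (by norm_num)
    obtain ⟨c1, c2, c3⟩ := digitE_cases κ hd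
    rw [c1, c2, c3, lev_succ]
    have hdx : x / 4 ^ j % 4 * 4 ^ j ≤ x :=
      (Nat.mul_le_mul_right _ (Nat.mod_le _ _)).trans (Nat.div_mul_le_self _ _)
    have haddr : ∀ a : ℕ, a < 4 →
        cut (fun y => lev κ (y / 4 ^ m) F (y % 4 ^ m)) ((j + 1) * 4 ^ m + x)
          ((((j + 1) * 4 ^ m + x : ℕ) : ℤ) - ((4 ^ m : ℕ) : ℤ) +
            ((4 ^ j : ℕ) : ℤ) * ((a : ℤ) - ((x / 4 ^ j % 4 : ℕ) : ℤ))) =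
        lev κ j F (x - x / 4 ^ j % 4 * 4 ^ j + a * 4 ^ j) := by
      intro a ha
      have hlt : x - x / 4 ^ j % 4 * 4 ^ j + a * 4 ^ j < 4 ^ m := by
        rw [hK] at hx ⊢
        exact replace_digit_lt hP hx ha
      rw [show (((j + 1) * 4 ^ m + x : ℕ) : ℤ) - ((4 ^ m : ℕ) : ℤ) +
          ((4 ^ j : ℕ) : ℤ) * ((a : ℤ) - ((x / 4 ^ j % 4 : ℕ) : ℤ)) =
          ((j * 4 ^ m + (x - x / 4 ^ j % 4 * 4 ^ j + a * 4 ^ j) : ℕ) : ℤ) by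
        generalize x / 4 ^ j % 4 = d at hdx
        push_cast [Nat.cast_sub hdx]
        ring, cut_of_lt _ (by rw [add_mul]; omega), d1 _ _ hlt, m1 _ _ hlt]
    rw [haddr _ (digA_lt hκ hd), haddr _ (digB_lt hd)]

/-! ### The convolution program -/

/-- The program that fills the tables of a list one after the other. -/
def tabs : List (ℕ × Exp × Exp) → Prog
  | [] => .skip
  | x :: l => .seq (tab x.1 x.2.1 x.2.2) (tabs l)

/-- The factor in the running time bound of a list of table programs. -/
def tabsConst : List (ℕ × Exp × Exp) → ℕ
  | [] => 1
  | x :: l => tabConst x.2.1 x.2.2 + tabsConst l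

theorem Runs.tabs_nil (s : Memory) {R : ℕ} (hR : 1 ≤ R) : Runs (tabs []) s (tabsConst [] * R) s :=
  ⟨1, by simpa [tabsConst] using hR, .skip s⟩

theorem Runs.tabs_cons {a : ℕ} {lim E : Exp} {l : List (ℕ × Exp × Exp)} {s s₁ s₂ : Memory} {R : ℕ}
    (h : Runs (tab a lim E) s (tabConst lim E * R) s₁)
    (h' : Runs (tabs l) s₁ (tabsConst l * R) s₂) :
    Runs (tabs ((a, lim, E) :: l)) s (tabsConst ((a, lim, E) :: l) * R) s₂ := by
  have := h.seq h'
  rwa [← add_mul] at this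

/-- The part of the convolution program before the matrix multiplication. It computes the modulus,
the tables of signs, weights and positions, the transforms of the rescaled inputs, and from
array `20` on the input of the multiplication program. -/
def preTabs : List (ℕ × Exp × Exp) :=
  [(5, pairsE + 1, powE), (7, 1, sizeE), (6, blockE, sumE), (8, 1, modulusE), (9, blockE, parE),
    (10, blockE, sgE), (11, blockE, wtE), (12, blockE, morE), (13, blockE, posE),
    (14, (pairsE + 1) * blockE, levE 14 0 (.cell 1 loopVar * .cell 11 loopVar)),
    (15, (pairsE + 1) * blockE, levE 15 0 (.cell 2 loopVar * .cell 11 loopVar)),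
    (20, 1, scalar 7), (21, blockE, entryE 14), (22, blockE, entryE 15)]

/-- The expression for the entry of the product matrix that belongs to the current mask. -/
def productE : Exp := .cell 23 (.cell 13 loopVar)

/-- The part of the convolution program after the matrix multiplication: the inverse transform and
the reduction modulo `q`. -/
def postTabs : List (ℕ × Exp × Exp) :=
  [(17, (pairsE + 1) * blockE, levE 17 1 (.cell 16 loopVar * .cell 10 loopVar)),
    (3, blockE, finalE)]

/-- The convolution program that uses the program `p` for the multiplication of matrices. -/
def nscProg (p : Prog) : Prog :=
  .seq (tabs preTabs) (.seq (p.shift 20) (.seq (tab 16 blockE productE) (tabs postTabs)))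

/-- The modulus `q`, which is odd and more than twice as large as all values of the convolution. -/
def modulus (m : ℕ) (f g : ℕ → ℤ) : ℤ :=
  1 + 2 * ∑ y ∈ Finset.range (4 ^ m), (f y ^ 2 + g y ^ 2)

/-- What the parts of the program after `preTabs` rely on: the tables are filled, the arrays
`20, 21, 22` are the input of the multiplication program, and the arrays still to be written are
empty. -/
structure Prepared (s : Memory) (n m L : ℕ) (q : ℤ) (f g : ℕ → ℤ) : Prop where
  bdd : MemBdd s L
  num : s 0 0 = n
  pow : s 5 = cut (fun k => 2 ^ k) (m + 1)
  size : s 7 0 = 2 ^ m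
  mod : s 8 0 = q
  sign : s 10 = cut sg (4 ^ m)
  weight : s 11 = cut (wt q) (4 ^ m)
  pos : s 13 = cut (fun x => ((row x * 2 ^ m + col x : ℕ) : ℤ)) (4 ^ m)
  fresh : ∀ a, a = 3 ∨ a = 16 ∨ a = 17 ∨ 23 ≤ a → s a = fun _ => 0
  dim : s 20 = cut (fun _ => 2 ^ m) 1
  left : s 21 = cut (fun y => MM m (sc q f) (y / 2 ^ m) (y % 2 ^ m)) (4 ^ m)
  right : s 22 = cut (fun y => MM m (sc q g) (y / 2 ^ m) (y % 2 ^ m)) (4 ^ m)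

/-- A table program with a time bound `R` that is common to all tables. -/
theorem tab_step {a : ℕ} (ha : a ≠ 4) {lim E : Exp} (hl : lim.Low) (he : E.Low) {s : Memory}
    {φ : ℕ → ℤ} {M L R : ℕ} (hL : 1 ≤ L) (hR : (M + 1) * L ^ 2 ≤ R) (hs : MemBdd s L)
    (h0 : s a = fun _ => 0)
    (hlim : ∀ s' : Memory, (∀ b, b ≠ a → b ≠ 4 → s' b = s b) → lim.val s' = M)
    (hM : M ≤ 2 ^ L) (hφ : ∀ x < M, |φ x| ≤ 2 ^ L)
    (hE : ∀ x < M, ∀ s' : Memory, s' 4 0 = x → s' a = cut φ x →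
      (∀ b, b ≠ a → b ≠ 4 → s' b = s b) → E.val s' = φ x) :
    ∃ s', Runs (tab a lim E) s (tabConst lim E * R) s' ∧ s' a = cut φ M ∧
      (∀ b, b ≠ a → b ≠ 4 → s' b = s b) ∧ MemBdd s' L := by
  obtain ⟨s', ⟨t, ht, hr⟩, h⟩ := tab_runs ha hl he hL hs h0 hlim hM hφ hE
  refine ⟨s', ⟨t, ht.trans ?_, hr⟩, h⟩
  rw [mul_assoc]
  exact Nat.mul_le_mul_left _ hR

theorem pow_mul_pow_two (m : ℕ) : 2 ^ m * 2 ^ m = 4 ^ m := by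
  rw [← mul_pow]
  norm_num

/-- The entries of the Clifford matrix are read off from the last block of the transforms. -/
theorem entryE_val {s : Memory} {a m n : ℕ} {F : ℕ → ℤ} (hm : m = (n + 1) / 2) (y : ℕ)
    (hy : y < 4 ^ m) (h0 : s 0 0 = n) (h4 : s 4 0 = y) (h7 : s 7 0 = 2 ^ m)
    (h10 : s 10 = cut sg (4 ^ m))
    (h12 : s 12 = cut (fun y => (mor (y / 2 ^ m) (y % 2 ^ m) : ℤ)) (4 ^ m))
    (ha : s a = cut (fun y => lev 0 (y / 4 ^ m) F (y % 4 ^ m)) ((m + 1) * 4 ^ m)) :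
    (entryE a).val s = MM m F (y / 2 ^ m) (y % 2 ^ m) := by
  have hr : y / 2 ^ m < 2 ^ m := by
    rw [Nat.div_lt_iff_lt_mul (by positivity), pow_mul_pow_two]
    exact hy
  have hc : y % 2 ^ m < 2 ^ m := Nat.mod_lt _ (by positivity)
  have hmor := mor_lt m _ _ hr hc
  simp only [entryE, Exp.val_add, Exp.val_mul, Exp.val_cell, loopVar_val, h4, h12, h10,
    cut_of_lt _ hy, cut_of_lt _ hmor, pairsE_val h0, ← hm, blockE_val h7, ha]
  rw [show (m : ℤ) * ((4 ^ m : ℕ) : ℤ) + (mor (y / 2 ^ m) (y % 2 ^ m) : ℤ) =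
    ((m * 4 ^ m + mor (y / 2 ^ m) (y % 2 ^ m) : ℕ) : ℤ) by push_cast; ring,
    cut_of_lt _ (by rw [add_mul]; omega), MM_eq_lev m F _ _ hr hc, Nat.add_comm,
    Nat.add_mul_div_right _ _ (by positivity), Nat.div_eq_of_lt hmor, zero_add,
    Nat.add_mul_mod_self_right, Nat.mod_eq_of_lt hmor]

/-- Correctness and running time of the part before the matrix multiplication. Here `B` bounds the
rescaled inputs, and each of the `m` rounds of the transform at most doubles the values. -/
theorem run_preTabs {n m L R : ℕ} {f g : ℕ → ℤ} {s : Memory} {B : ℤ} (hm : m = (n + 1) / 2)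
    (hL : 1 ≤ L) (hR : ((m + 1) * 4 ^ m + 1) * L ^ 2 ≤ R)
    (h0 : s 0 0 = n) (h1 : ∀ x : ℕ, s 1 x = f x) (h2 : ∀ x : ℕ, s 2 x = g x)
    (h3 : ∀ a, 3 ≤ a → s a = fun _ => 0) (hs : MemBdd s L)
    (hf : ∀ x, 4 ^ m ≤ x → f x = 0) (hg : ∀ x, 4 ^ m ≤ x → g x = 0)
    (hM : (m + 1) * 4 ^ m ≤ 2 ^ L) (hq : modulus m f g ≤ 2 ^ L)
    (hw : ∀ x < 4 ^ m, |wt (modulus m f g) x| ≤ 2 ^ L)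
    (hfB : ∀ x, |sc (modulus m f g) f x| ≤ B) (hgB : ∀ x, |sc (modulus m f g) g x| ≤ B)
    (hB : 2 ^ m * B ≤ 2 ^ L) :
    ∃ s', Runs (tabs preTabs) s (tabsConst preTabs * R) s' ∧
      Prepared s' n m L (modulus m f g) f g := by
  set q := modulus m f g with hqdef
  have hM4 : 1 ≤ 4 ^ m := Nat.one_le_pow _ _ (by norm_num)
  have hmM : m + 1 ≤ (m + 1) * 4 ^ m := Nat.le_mul_of_pos_right _ hM4
  have h4M : 4 ^ m ≤ (m + 1) * 4 ^ m := Nat.le_mul_of_pos_left _ (by omega)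
  have h2M : 2 ^ m ≤ 4 ^ m := Nat.pow_le_pow_left (by norm_num) m
  have castle : ∀ k : ℕ, k ≤ (m + 1) * 4 ^ m → |(k : ℤ)| ≤ 2 ^ L := by
    intro k hk
    rw [Nat.abs_cast]
    exact_mod_cast hk.trans hM
  have hR' : ∀ k, k ≤ (m + 1) * 4 ^ m → (k + 1) * L ^ 2 ≤ R := fun k hk =>
    (Nat.mul_le_mul_right _ (by omega)).trans hR
  have hone : ∀ s' : Memory, (1 : Exp).val s' = ((1 : ℕ) : ℤ) := fun _ => by simp
  have hlen : ∀ s' : Memory, s' 0 0 = n → s' 7 0 = 2 ^ m →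
      ((pairsE + 1) * blockE).val s' = (((m + 1) * 4 ^ m : ℕ) : ℤ) := by
    intro s' e0 e7
    rw [Exp.val_mul, Exp.val_add, pairsE_val e0, ← hm, blockE_val e7]
    push_cast
    simp
  have hsum : ∀ x < 4 ^ m, |2 * ∑ y ∈ Finset.range (x + 1), (f y ^ 2 + g y ^ 2)| ≤ 2 ^ L := by
    intro x hx
    have hn : ∀ s : Finset ℕ, 0 ≤ ∑ y ∈ s, (f y ^ 2 + g y ^ 2) := fun s =>
      Finset.sum_nonneg fun y _ => by positivity
    have hle : ∑ y ∈ Finset.range (x + 1), (f y ^ 2 + g y ^ 2) ≤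
        ∑ y ∈ Finset.range (4 ^ m), (f y ^ 2 + g y ^ 2) :=
      Finset.sum_le_sum_of_subset_of_nonneg (Finset.range_subset_range.2 hx)
        fun y _ _ => by positivity
    rw [abs_of_nonneg (by have := hn (Finset.range (x + 1)); positivity)]
    simp only [hqdef, modulus] at hq
    linarith
  have hq0 : 0 < q := by
    have : 0 ≤ ∑ y ∈ Finset.range (4 ^ m), (f y ^ 2 + g y ^ 2) :=
      Finset.sum_nonneg fun y _ => by positivity
    simp only [hqdef, modulus]
    linarith
  have hlev : ∀ F : ℕ → ℤ, (∀ x, |F x| ≤ B) → ∀ y < (m + 1) * 4 ^ m,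
      |lev 0 (y / 4 ^ m) F (y % 4 ^ m)| ≤ 2 ^ L := by
    intro F hF y hy
    have hB0 : 0 ≤ B := (abs_nonneg _).trans (hF 0)
    refine (lev_bound (by norm_num) _ hF _).trans (le_trans ?_ hB)
    have : y / 4 ^ m < m + 1 := (Nat.div_lt_iff_lt_mul hM4).2 hy
    exact mul_le_mul_of_nonneg_right (pow_le_pow_right₀ (by norm_num) (by omega)) hB0
  have hent : ∀ F : ℕ → ℤ, (∀ x, |F x| ≤ B) → ∀ y < 4 ^ m,
      |MM m F (y / 2 ^ m) (y % 2 ^ m)| ≤ 2 ^ L := by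
    intro F hF y hy
    have hr : y / 2 ^ m < 2 ^ m := by
      rw [Nat.div_lt_iff_lt_mul (by positivity), pow_mul_pow_two]
      exact hy
    rw [MM_eq_lev m F _ _ hr (Nat.mod_lt _ (by positivity)), abs_mul, abs_sg, one_mul]
    exact (lev_bound (by norm_num) _ hF _).trans hB
  obtain ⟨s1, r1, t1, f1, b1⟩ := tab_step (a := 5) (lim := pairsE + 1) (E := powE)
    (φ := fun k => 2 ^ k) (M := m + 1) (by norm_num) (by simp [pairsE]) (by simp [powE]) hL
    (hR' _ hmM) hs (h3 5 (by norm_num))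
    (fun s' h => by simp [pairsE_val (s := s') (n := n) (by simp [h, h0]), ← hm])
    (hmM.trans hM)
    (fun x hx => by
      have := castle (2 ^ x) ((Nat.pow_le_pow_right (by norm_num) (by omega)).trans (h2M.trans h4M))
      exact_mod_cast this)
    (fun x hx s' h4 ha h => powE_val x h4 ha)
  obtain ⟨s2, r2, t2, f2, b2⟩ := tab_step (a := 7) (lim := 1) (E := sizeE)
    (φ := fun _ => 2 ^ m) (M := 1) (by norm_num) (by simp) (by simp [sizeE, pairsE]) hL
    (hR' _ (by omega)) b1 (by simp [f1, h3])
    (fun s' h => hone s') ((by omega : 1 ≤ (m + 1) * 4 ^ m).trans hM)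
    (fun x hx => by
      have := castle (2 ^ m) (h2M.trans h4M)
      exact_mod_cast this)
    (fun x hx s' h4 ha h => by
      simp only [sizeE, Exp.val_cell]
      rw [pairsE_val (n := n) (by simp [h, f1, h0]), ← hm, h 5 (by norm_num) (by norm_num), t1,
        cut_of_lt _ (by omega)])
  have e2 : s2 7 0 = 2 ^ m := by simp [t2, cut]
  obtain ⟨s3, r3, t3, f3, b3⟩ := tab_step (a := 6) (lim := blockE) (E := sumE)
    (φ := fun x => 2 * ∑ y ∈ Finset.range (x + 1), (f y ^ 2 + g y ^ 2)) (M := 4 ^ m)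
    (by norm_num) (by simp [blockE]) (by simp [sumE]) hL
    (hR' _ h4M) b2 (by simp [f1, f2, h3])
    (fun s' h => blockE_val (by simp [h, e2])) (h4M.trans hM) hsum
    (fun x hx s' h4 ha h => sumE_val x h4 ha (by simp [h, f1, f2, h1]) (by simp [h, f1, f2, h2]))
  obtain ⟨s4, r4, t4, f4, b4⟩ := tab_step (a := 8) (lim := 1) (E := modulusE)
    (φ := fun _ => q) (M := 1) (by norm_num) (by simp) (by simp [modulusE, blockE]) hL
    (hR' _ (by omega)) b3 (by simp [f1, f2, f3, h3])
    (fun s' h => hone s') ((by omega : 1 ≤ (m + 1) * 4 ^ m).trans hM)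
    (fun x hx => by rwa [abs_of_pos hq0])
    (fun x hx s' h4 ha h => by
      simp only [modulusE, Exp.val_add, Exp.val_sub, Exp.val_cell, Exp.val_ofNat]
      rw [blockE_val (m := m) (by simp [h, f3, e2]), h 6 (by norm_num) (by norm_num), t3,
        show ((4 ^ m : ℕ) : ℤ) - ((1 : ℕ) : ℤ) = ((4 ^ m - 1 : ℕ) : ℤ) from (Nat.cast_sub hM4).symm,
        cut_of_lt _ (by omega), Nat.sub_add_cancel hM4]
      simp [hqdef, modulus])
  have e4 : s4 8 0 = q := by simp [t4, cut]
  obtain ⟨s5, r5, t5, f5, b5⟩ := tab_step (a := 9) (lim := blockE) (E := parE)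
    (φ := par) (M := 4 ^ m) (by norm_num) (by simp [blockE]) (by simp [parE]) hL
    (hR' _ h4M) b4 (by simp [f1, f2, f3, f4, h3])
    (fun s' h => blockE_val (by simp [h, f3, f4, e2])) (h4M.trans hM)
    (fun x hx => by rw [abs_par]; exact one_le_pow₀ (by norm_num))
    (fun x hx s' h4 ha h => parE_val x h4 ha)
  obtain ⟨s6, r6, t6, f6, b6⟩ := tab_step (a := 10) (lim := blockE) (E := sgE)
    (φ := sg) (M := 4 ^ m) (by norm_num) (by simp [blockE]) (by simp [sgE]) hL
    (hR' _ h4M) b5 (by simp [f1, f2, f3, f4, f5, h3])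
    (fun s' h => blockE_val (by simp [h, f3, f4, f5, e2])) (h4M.trans hM)
    (fun x hx => by rw [abs_sg]; exact one_le_pow₀ (by norm_num))
    (fun x hx s' h4 ha h => sgE_val x hx h4 ha (by simp [h, t5]))
  obtain ⟨s7, r7, t7, f7, b7⟩ := tab_step (a := 11) (lim := blockE) (E := wtE)
    (φ := wt q) (M := 4 ^ m) (by norm_num) (by simp [blockE]) (by simp [wtE]) hL
    (hR' _ h4M) b6 (by simp [f1, f2, f3, f4, f5, f6, h3])
    (fun s' h => blockE_val (by simp [h, f3, f4, f5, f6, e2])) (h4M.trans hM) hw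
    (fun x hx s' h4 ha h => wtE_val x h4 ha (by simp [h, f5, f6, e4]))
  obtain ⟨s8, r8, t8, f8, b8⟩ := tab_step (a := 12) (lim := blockE) (E := morE)
    (φ := fun y => (mor (y / 2 ^ m) (y % 2 ^ m) : ℤ)) (M := 4 ^ m) (by norm_num)
    (by simp [blockE]) (by simp [morE, rowE, colE]) hL
    (hR' _ h4M) b7 (by simp [f1, f2, f3, f4, f5, f6, f7, h3])
    (fun s' h => blockE_val (by simp [h, f3, f4, f5, f6, f7, e2])) (h4M.trans hM)
    (fun x hx => castle _ ((mor_lt m _ _ (by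
      rw [Nat.div_lt_iff_lt_mul (by positivity), pow_mul_pow_two]
      exact hx) (Nat.mod_lt _ (by positivity))).le.trans h4M))
    (fun x hx s' h4 ha h => morE_val Nat.one_le_two_pow x h4 ha
      (by simp [h, f3, f4, f5, f6, f7, e2]))
  obtain ⟨s9, r9, t9, f9, b9⟩ := tab_step (a := 13) (lim := blockE) (E := posE)
    (φ := fun x => ((row x * 2 ^ m + col x : ℕ) : ℤ)) (M := 4 ^ m) (by norm_num)
    (by simp [blockE]) (by simp [posE]) hL
    (hR' _ h4M) b8 (by simp [f1, f2, f3, f4, f5, f6, f7, f8, h3])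
    (fun s' h => blockE_val (by simp [h, f3, f4, f5, f6, f7, f8, e2])) (h4M.trans hM)
    (fun x hx => castle _ (le_trans (by
      have e1 := row_lt m x hx
      have e2 := col_lt m x hx
      have e3 : (row x + 1) * 2 ^ m ≤ 2 ^ m * 2 ^ m := Nat.mul_le_mul_right _ e1
      rw [pow_mul_pow_two] at e3
      rw [add_mul] at e3
      omega) h4M))
    (fun x hx s' h4 ha h => posE_val x h4 ha (by simp [h, f3, f4, f5, f6, f7, f8, e2]))
  have e9 : s9 7 0 = 2 ^ m := by simp [f3, f4, f5, f6, f7, f8, f9, e2]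
  have g9 : s9 0 0 = n := by simp [f1, f2, f3, f4, f5, f6, f7, f8, f9, h0]
  have p9 : s9 5 = cut (fun k => 2 ^ k) (m + 1) := by
    simp [f2, f3, f4, f5, f6, f7, f8, f9, t1]
  have w9 : s9 11 = cut (wt q) (4 ^ m) := by simp [f8, f9, t7]
  have z9 : ∀ a, 14 ≤ a → s9 a = fun _ => 0 := by
    intro a ha
    rw [f9 a (by omega) (by omega), f8 a (by omega) (by omega), f7 a (by omega) (by omega),
      f6 a (by omega) (by omega), f5 a (by omega) (by omega), f4 a (by omega) (by omega),
      f3 a (by omega) (by omega), f2 a (by omega) (by omega), f1 a (by omega) (by omega),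
      h3 a (by omega)]
  -- outside block `0` the table of weights reads as `0`
  have hinit : ∀ (F : ℕ → ℤ), (∀ x, 4 ^ m ≤ x → F x = 0) → ∀ y : ℕ,
      F y * cut (wt q) (4 ^ m) y = if y < 4 ^ m then sc q F y else 0 := by
    intro F hF y
    rw [cut_natCast]
    split_ifs with h
    · simp only [sc]
      ring
    · rw [mul_zero]
  obtain ⟨s10, r10, t10, f10, b10⟩ := tab_step (a := 14) (lim := (pairsE + 1) * blockE)
    (E := levE 14 0 (.cell 1 loopVar * .cell 11 loopVar))
    (φ := fun y => lev 0 (y / 4 ^ m) (sc q f) (y % 4 ^ m)) (M := (m + 1) * 4 ^ m) (by norm_num)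
    (by simp [blockE, pairsE]) (by simp [levE, digitE, placeE, blockE]) hL
    (hR' _ le_rfl) b9 (z9 _ (by norm_num))
    (fun s' h => hlen s' (by simp [h, g9]) (by simp [h, e9])) hM (hlev _ hfB)
    (fun y hy s' h4 ha h => levE_val (by norm_num) y hy h4 ha (by simp [h, p9]) (by simp [h, e9])
      (by
        rw [← hinit f hf]
        simp only [Exp.val_mul, Exp.val_cell, loopVar_val, h4]
        simp [h, f1, f2, f3, f4, f5, f6, f7, f8, f9, h1, t7]))
  obtain ⟨s11, r11, t11, f11, b11⟩ := tab_step (a := 15) (lim := (pairsE + 1) * blockE)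
    (E := levE 15 0 (.cell 2 loopVar * .cell 11 loopVar))
    (φ := fun y => lev 0 (y / 4 ^ m) (sc q g) (y % 4 ^ m)) (M := (m + 1) * 4 ^ m) (by norm_num)
    (by simp [blockE, pairsE]) (by simp [levE, digitE, placeE, blockE]) hL
    (hR' _ le_rfl) b10 (by simp [f10, z9])
    (fun s' h => hlen s' (by simp [h, f10, g9]) (by simp [h, f10, e9])) hM (hlev _ hgB)
    (fun y hy s' h4 ha h => levE_val (by norm_num) y hy h4 ha (by simp [h, f10, p9])
      (by simp [h, f10, e9])
      (by
        rw [← hinit g hg]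
        simp only [Exp.val_mul, Exp.val_cell, loopVar_val, h4]
        simp [h, f1, f2, f3, f4, f5, f6, f7, f8, f9, f10, h2, t7]))
  obtain ⟨s12, r12, t12, f12, b12⟩ := tab_step (a := 20) (lim := 1) (E := scalar 7)
    (φ := fun _ => 2 ^ m) (M := 1) (by norm_num) (by simp) (by simp) hL
    (hR' _ (by omega)) b11 (by simp [f10, f11, z9])
    (fun s' h => hone s') ((by omega : 1 ≤ (m + 1) * 4 ^ m).trans hM)
    (fun x hx => by
      have := castle (2 ^ m) (h2M.trans h4M)
      exact_mod_cast this)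
    (fun x hx s' h4 ha h => by simp [h, f10, f11, e9])
  obtain ⟨s13, r13, t13, f13, b13⟩ := tab_step (a := 21) (lim := blockE) (E := entryE 14)
    (φ := fun y => MM m (sc q f) (y / 2 ^ m) (y % 2 ^ m)) (M := 4 ^ m) (by norm_num)
    (by simp [blockE]) (by simp [entryE, pairsE, blockE]) hL
    (hR' _ h4M) b12 (by simp [f10, f11, f12, z9])
    (fun s' h => blockE_val (by simp [h, f10, f11, f12, e9])) (h4M.trans hM) (hent _ hfB)
    (fun y hy s' h4 ha h => entryE_val hm y hy (by simp [h, f10, f11, f12, g9]) h4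
      (by simp [h, f10, f11, f12, e9])
      (by simp [h, f7, f8, f9, f10, f11, f12, t6]) (by simp [h, f9, f10, f11, f12, t8])
      (by simp [h, f11, f12, t10]))
  obtain ⟨s14, r14, t14, f14, b14⟩ := tab_step (a := 22) (lim := blockE) (E := entryE 15)
    (φ := fun y => MM m (sc q g) (y / 2 ^ m) (y % 2 ^ m)) (M := 4 ^ m) (by norm_num)
    (by simp [blockE]) (by simp [entryE, pairsE, blockE]) hL
    (hR' _ h4M) b13 (by simp [f10, f11, f12, f13, z9])
    (fun s' h => blockE_val (by simp [h, f10, f11, f12, f13, e9])) (h4M.trans hM) (hent _ hgB)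
    (fun y hy s' h4 ha h => entryE_val hm y hy (by simp [h, f10, f11, f12, f13, g9]) h4
      (by simp [h, f10, f11, f12, f13, e9])
      (by simp [h, f7, f8, f9, f10, f11, f12, f13, t6])
      (by simp [h, f9, f10, f11, f12, f13, t8])
      (by simp [h, f12, f13, t11]))
  refine ⟨s14, .tabs_cons r1 (.tabs_cons r2 (.tabs_cons r3 (.tabs_cons r4 (.tabs_cons r5
    (.tabs_cons r6 (.tabs_cons r7 (.tabs_cons r8 (.tabs_cons r9 (.tabs_cons r10 (.tabs_cons r11
    (.tabs_cons r12 (.tabs_cons r13 (.tabs_cons r14 (.tabs_nil _ ?_)))))))))))))), ?_⟩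
  · exact (Nat.mul_pos (by omega) (by positivity)).trans_le hR
  · exact {
      bdd := b14
      num := by simp [f10, f11, f12, f13, f14, g9]
      pow := by simp [f10, f11, f12, f13, f14, p9]
      size := by simp [f10, f11, f12, f13, f14, e9]
      mod := by simp [f5, f6, f7, f8, f9, f10, f11, f12, f13, f14, e4]
      sign := by simp [f7, f8, f9, f10, f11, f12, f13, f14, t6]
      weight := by simp [f10, f11, f12, f13, f14, w9]
      pos := by simp [f10, f11, f12, f13, f14, t9]
      fresh := by
        intro a ha
        rw [f14 a (by omega) (by omega), f13 a (by omega) (by omega), f12 a (by omega) (by omega),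
          f11 a (by omega) (by omega), f10 a (by omega) (by omega)]
        rcases eq_or_ne a 3 with rfl | h
        · simp [f1, f2, f3, f4, f5, f6, f7, f8, f9, h3]
        · exact z9 a (by omega)
      dim := by simp [f13, f14, t12]
      left := by simp [f14, t13]
      right := t14 }

/-! ### Correctness of the convolution program -/

theorem cut_eq_arrayOf {N : ℕ} (φ : ℕ → ℤ) :
    cut φ (N * N) = arrayOf matrixPos fun x : Fin N × Fin N => φ (matrixPos x) := by
  funext i
  by_cases hi : 0 ≤ i ∧ i < (N * N : ℕ)
  · obtain ⟨k, rfl⟩ := Int.eq_ofNat_of_zero_le hi.1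
    have hk : k < N * N := by exact_mod_cast hi.2
    have hN : 0 < N := Nat.pos_of_ne_zero fun h => by simp [h] at hk
    have hpos : matrixPos ((⟨k / N, (Nat.div_lt_iff_lt_mul hN).2 hk⟩, ⟨k % N, Nat.mod_lt _ hN⟩) :
        Fin N × Fin N) = k := Nat.div_add_mod' k N
    rw [cut_of_lt _ hk]
    conv_rhs => rw [← hpos]
    rw [arrayOf_apply matrixPos_injective, hpos]
  · rw [cut, if_neg hi, arrayOf, Finset.sum_eq_zero]
    rintro ⟨r, c⟩ _
    refine if_neg fun h => hi ?_
    have h1 : ((r : ℕ) + 1) * N ≤ N * N := Nat.mul_le_mul_right _ r.isLt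
    have h2 := c.isLt
    rw [add_mul] at h1
    simp only [matrixPos] at h
    omega

theorem matrixPos_div {N : ℕ} (i j : Fin N) : matrixPos (i, j) / N = i := by
  have hN : 0 < N := (Nat.zero_le _).trans_lt i.isLt
  rw [matrixPos, Nat.add_comm, Nat.add_mul_div_right _ _ hN, Nat.div_eq_of_lt j.isLt, zero_add]

theorem matrixPos_mod {N : ℕ} (i j : Fin N) : matrixPos (i, j) % N = j := by
  rw [matrixPos, Nat.add_comm, Nat.add_mul_mod_self_right, Nat.mod_eq_of_lt j.isLt]

/-- The Clifford matrix as a matrix. -/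
def cliffordMatrix (m : ℕ) (f : ℕ → ℤ) : Matrix (Fin (2 ^ m)) (Fin (2 ^ m)) ℤ :=
  Matrix.of fun i j => MM m f i j

theorem cut_eq_cliffordMatrix (m : ℕ) (f : ℕ → ℤ) :
    cut (fun y => MM m f (y / 2 ^ m) (y % 2 ^ m)) (4 ^ m) =
      arrayOf matrixPos fun x => cliffordMatrix m f x.1 x.2 := by
  rw [← pow_mul_pow_two, cut_eq_arrayOf]
  congr 1
  funext ⟨i, j⟩
  simp only [matrixPos_div, matrixPos_mod]
  rfl

/-- From array `20` on, a prepared memory is the input of the multiplication program. -/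
theorem Prepared.input {s : Memory} {n m L : ℕ} {q : ℤ} {f g : ℕ → ℤ}
    (h : Prepared s n m L q f g) (a : ℕ) :
    s (a + 20) = inputMemory (2 ^ m)
      (arrayOf matrixPos fun x => cliffordMatrix m (sc q f) x.1 x.2)
      (arrayOf matrixPos fun x => cliffordMatrix m (sc q g) x.1 x.2) a := by
  match a with
  | 0 =>
    rw [Nat.zero_add, h.dim]
    funext i
    simp only [cut, inputMemory]
    push_cast
    congr 1
    simp only [eq_iff_iff]
    omega
  | 1 => exact h.left.trans (cut_eq_cliffordMatrix m _)
  | 2 => exact h.right.trans (cut_eq_cliffordMatrix m _)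
  | k + 3 => exact h.fresh _ (by omega)

theorem MM_product_matrix {m : ℕ} {q : ℤ} {f g h : ℕ → ℤ}
    (hh : ∀ r c, r < 2 ^ m → c < 2 ^ m →
      ∑ k ∈ Finset.range (2 ^ m), MM m (sc q f) r k * MM m (sc q g) k c = MM m h r c)
    (i j : Fin (2 ^ m)) :
    (cliffordMatrix m (sc q f) * cliffordMatrix m (sc q g)) i j = MM m h i j := by
  rw [Matrix.mul_apply, ← hh i j i.isLt j.isLt, Finset.sum_range]
  rfl

theorem abs_MM_le {m : ℕ} {f : ℕ → ℤ} {B : ℤ} (hf : ∀ x, |f x| ≤ B) (i j : Fin (2 ^ m)) :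
    |MM m f i j| ≤ 2 ^ m * B := by
  rw [MM_eq_lev m f _ _ i.isLt j.isLt, abs_mul, abs_sg, one_mul]
  exact lev_bound (by norm_num) _ hf _

/-- The factor in the running time bound of the step that reads the product matrix. -/
def productConst : ℕ := 30 * (blockE.costConst + (Exp.cell 13 loopVar).costConst + 9)

/-- The step that reads the product matrix. The output array of the multiplication program has the
number `23` and only its cells at matrix positions are bounded, so that the cost is estimated
directly. -/
theorem run_product {s : Memory} {m L R : ℕ} {P : ℕ → ℤ} (hL : 1 ≤ L)
    (hR : (4 ^ m + 1) * L ^ 2 ≤ R) (hs : MemBdd s L) (h16 : s 16 = fun _ => 0)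
    (h7 : s 7 0 = 2 ^ m)
    (h13 : s 13 = cut (fun x => ((row x * 2 ^ m + col x : ℕ) : ℤ)) (4 ^ m)) (hM : 4 ^ m ≤ 2 ^ L)
    (h23 : ∀ x < 4 ^ m, s 23 ((row x * 2 ^ m + col x : ℕ) : ℤ) = P x)
    (hP : ∀ x < 4 ^ m, |P x| ≤ 2 ^ L) :
    ∃ s', Runs (tab 16 blockE productE) s (productConst * R) s' ∧ s' 16 = cut P (4 ^ m) ∧
      (∀ b, b ≠ 16 → b ≠ 4 → s' b = s b) ∧ MemBdd s' L := by
  have hb : ∀ x ≤ 4 ^ m, MemBdd (tabState s 16 P x) L := fun x hx =>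
    hs.tabState (by norm_num) (hx.trans hM) fun y hy => hP y (by omega)
  refine ⟨tabState s 16 P (4 ^ m), ?_, tabState_self .., fun b h h' => tabState_of_ne h h' ..,
    hb _ le_rfl⟩
  set c := (blockE.costConst + (Exp.cell 13 loopVar).costConst + 9) * L ^ 2 with hc
  have hL2 : L + 2 ≤ 3 * L ^ 2 := by nlinarith
  have hc1 : blockE.costConst * L ^ 2 + (Exp.cell 13 loopVar).costConst * L ^ 2 + 9 * L ^ 2 =
      c := by
    rw [hc]
    ring
  have hx : ∀ x : ℕ, x ≤ 4 ^ m → bits x ≤ L + 2 := fun x hx =>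
    bits_le (abs_natCast_le (hx.trans hM))
  have hpos : ∀ x < 4 ^ m, row x * 2 ^ m + col x < 4 ^ m := by
    intro x hx
    have e1 := row_lt m x hx
    have e2 := col_lt m x hx
    have e3 : (row x + 1) * 2 ^ m ≤ 2 ^ m * 2 ^ m := Nat.mul_le_mul_right _ e1
    rw [pow_mul_pow_two, add_mul] at e3
    omega
  obtain ⟨t, ht, hr⟩ := tab_runs_of_cost (a := 16) (by norm_num) (lim := blockE) (E := productE)
    (φ := P) (M := 4 ^ m) (c := c) h16
    (fun x hx => ⟨blockE_val (by rw [tabState_of_ne (by norm_num) (by norm_num), h7]),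
      (Exp.cost_le hL (hb x hx) (by simp [blockE])).trans (by omega)⟩)
    (fun x hx => by
      have h4 : tabState s 16 P x 4 0 = x := by simp [tabState_loop]
      have hv : (Exp.cell 13 loopVar).val (tabState s 16 P x) =
          ((row x * 2 ^ m + col x : ℕ) : ℤ) := by
        rw [Exp.val_cell, loopVar_val, h4, tabState_of_ne (by norm_num) (by norm_num), h13,
          cut_of_lt _ hx]
      have hv' : tabState s 16 P x 23 ((row x * 2 ^ m + col x : ℕ) : ℤ) = P x := by
        rw [tabState_of_ne (by norm_num) (by norm_num), h23 x hx]
      refine ⟨by rw [productE, Exp.val_cell, hv, hv'], ?_⟩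
      rw [productE, Exp.cost, hv, hv']
      have h1 : (Exp.cell 13 loopVar).cost (tabState s 16 P x) ≤ _ :=
        Exp.cost_le hL (hb x hx.le) (by simp)
      have h2 := bits_le (hP x hx)
      have h3 := bits_le (abs_natCast_le ((hpos x hx).le.trans hM))
      omega)
    ((hx _ le_rfl).trans (by omega)) (fun x h => (hx x h).trans (by omega))
    (fun x hx => (bits_le (hP x hx)).trans (by omega))
  refine ⟨t, ht.trans ?_, hr⟩
  calc 30 * c * (4 ^ m + 1) = productConst * ((4 ^ m + 1) * L ^ 2) := by
        rw [hc, productConst]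
        ring
    _ ≤ _ := Nat.mul_le_mul_left _ hR

theorem wt_pos {q : ℤ} (hq : 0 < q) (x : ℕ) : 0 < wt q x := by
  induction x using Nat.strong_induction_on with
  | _ x ih =>
    rw [wt]
    split_ifs
    · norm_num
    · exact mul_pos (ih _ (by omega)) hq
    · exact mul_pos (ih _ (by omega)) one_pos

/-- The inverse digit transform recovers a table from its Clifford matrix. -/
theorem lev_one_MM (m : ℕ) (h : ℕ → ℤ) (x : ℕ) (hx : x < 4 ^ m) :
    lev 1 m (fun x => if x < 4 ^ m then MM m h (row x) (col x) * sg x else 0) x = h x := by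
  rw [← lev_one_lev_zero m h x hx]
  refine lev_congr le_rfl m (fun y hy => ?_) x hx
  rw [if_pos hy, MM_eq_lev m h _ _ (row_lt m y hy) (col_lt m y hy), mor_row_col]
  linear_combination lev 0 m h y * sg_mul_self y

/-- The part after the matrix multiplication leaves the remainders of least absolute value modulo
`q` of `w + q * u` if the product is the Clifford matrix of this table after rescaling. -/
theorem run_postTabs {s : Memory} {n m L R : ℕ} {q B : ℤ} {w u : ℕ → ℤ} (hm : m = (n + 1) / 2)
    (hL : 1 ≤ L) (hR : ((m + 1) * 4 ^ m + 1) * L ^ 2 ≤ R) (hs : MemBdd s L) (h0 : s 0 0 = n)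
    (h5 : s 5 = cut (fun k => 2 ^ k) (m + 1)) (h7 : s 7 0 = 2 ^ m) (h8 : s 8 0 = q)
    (h10 : s 10 = cut sg (4 ^ m)) (h11 : s 11 = cut (wt q) (4 ^ m))
    (h16 : s 16 = cut (fun x => MM m (sc q fun x => w x + q * u x) (row x) (col x)) (4 ^ m))
    (h17 : s 17 = fun _ => 0) (h3 : s 3 = fun _ => 0) (hM : (m + 1) * 4 ^ m ≤ 2 ^ L)
    (hq0 : 0 < q) (hq : q ≤ 2 ^ L) (hB0 : 0 ≤ B)
    (hB : ∀ x < 4 ^ m, |MM m (sc q fun x => w x + q * u x) (row x) (col x)| ≤ B)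
    (hBL : 2 ^ m * B ≤ 2 ^ L) :
    ∃ s', Runs (tabs postTabs) s (tabsConst postTabs * R) s' ∧
      s' 3 = cut (fun x => (w x + q * u x + q / 2) % q - q / 2) (4 ^ m) := by
  set h : ℕ → ℤ := sc q fun x => w x + q * u x with hh
  set F : ℕ → ℤ := fun x => if x < 4 ^ m then MM m h (row x) (col x) * sg x else 0 with hF
  have hM4 : 1 ≤ 4 ^ m := Nat.one_le_pow _ _ (by norm_num)
  have h4M : 4 ^ m ≤ (m + 1) * 4 ^ m := Nat.le_mul_of_pos_left _ (by omega)
  have hFB : ∀ x, |F x| ≤ B := by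
    intro x
    simp only [hF]
    split_ifs with hx
    · rw [abs_mul, abs_sg, mul_one]
      exact hB x hx
    · simpa using hB0
  obtain ⟨s1, r1, t1, f1, b1⟩ := tab_step (a := 17) (lim := (pairsE + 1) * blockE)
    (E := levE 17 1 (.cell 16 loopVar * .cell 10 loopVar))
    (φ := fun y => lev 1 (y / 4 ^ m) F (y % 4 ^ m)) (M := (m + 1) * 4 ^ m) (by norm_num)
    (by simp [blockE, pairsE]) (by simp [levE, digitE, placeE, blockE]) hL hR hs h17
    (fun s' k => by
      rw [Exp.val_mul, Exp.val_add, pairsE_val (n := n) (by simp [k, h0]), ← hm,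
        blockE_val (m := m) (by simp [k, h7])]
      push_cast
      simp) hM
    (fun y hy => by
      refine (lev_bound le_rfl _ hFB _).trans (le_trans ?_ hBL)
      have : y / 4 ^ m < m + 1 := (Nat.div_lt_iff_lt_mul hM4).2 hy
      exact mul_le_mul_of_nonneg_right (pow_le_pow_right₀ (by norm_num) (by omega)) hB0)
    (fun y hy s' h4 ha k => levE_val le_rfl y hy h4 ha (by simp [k, h5]) (by simp [k, h7]) (by
      simp only [Exp.val_mul, Exp.val_cell, loopVar_val, h4, k 16 (by norm_num) (by norm_num),
        k 10 (by norm_num) (by norm_num), h16, h10, cut_natCast, hF]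
      split_ifs <;> simp))
  obtain ⟨s2, r2, t2, -, -⟩ := tab_step (a := 3) (lim := blockE) (E := finalE)
    (φ := fun x => (w x + q * u x + q / 2) % q - q / 2) (M := 4 ^ m) (by norm_num)
    (by simp [blockE]) (by simp [finalE, quotE, pairsE, blockE]) hL
    ((Nat.mul_le_mul_right _ (by omega)).trans hR) b1 (by simp [f1, h3])
    (fun s' k => blockE_val (by simp [k, f1, h7])) (h4M.trans hM)
    (fun x hx => by
      have e1 := Int.emod_nonneg (w x + q * u x + q / 2) hq0.ne'
      have e2 := Int.emod_lt_of_pos (w x + q * u x + q / 2) hq0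
      refine le_trans (abs_le.2 ⟨?_, ?_⟩) hq <;> omega)
    (fun x hx s' h4 ha k => by
      have e1 : s' 17 ((m * 4 ^ m + x : ℕ) : ℤ) = wt q x * (w x + q * u x) := by
        rw [k 17 (by norm_num) (by norm_num), t1, cut_of_lt _ (by rw [add_mul]; omega),
          Nat.add_comm, Nat.add_mul_div_right _ _ (by omega), Nat.div_eq_of_lt hx, zero_add,
          Nat.add_mul_mod_self_right, Nat.mod_eq_of_lt hx, hF, lev_one_MM m h x hx]
        rfl
      have e2 : quotE.val s' = w x + q * u x + q / 2 := by
        simp only [quotE, Exp.val_add, Exp.val_div, Exp.val_mul, Exp.val_cell, Exp.val_ofNat,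
          loopVar_val, scalar_val, h4]
        rw [pairsE_val (n := n) (by simp [k, f1, h0]), ← hm,
          blockE_val (m := m) (by simp [k, f1, h7]),
          show (m : ℤ) * ((4 ^ m : ℕ) : ℤ) + (x : ℤ) = ((m * 4 ^ m + x : ℕ) : ℤ) by push_cast; ring,
          e1, k 11 (by norm_num) (by norm_num), f1 11 (by norm_num) (by norm_num), h11,
          cut_of_lt _ hx, Int.mul_ediv_cancel_left _ (wt_pos hq0 x).ne',
          k 8 (by norm_num) (by norm_num), f1 8 (by norm_num) (by norm_num), h8]
        rfl
      simp only [finalE, Exp.val_sub, Exp.val_mul, Exp.val_div, Exp.val_ofNat, scalar_val, e2]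
      rw [k 8 (by norm_num) (by norm_num), f1 8 (by norm_num) (by norm_num), h8, Int.emod_def]
      rfl)
  exact ⟨s2, .tabs_cons r1 (.tabs_cons r2 (.tabs_nil _ ((Nat.mul_pos (by omega)
    (by positivity)).trans_le hR))), t2⟩

/-- The remainder of least absolute value modulo `q = 1 + 2 S` recovers an integer `w` with
`|w| ≤ S`. -/
theorem balanced_emod {S q w u : ℤ} (hq : q = 1 + 2 * S) (hw : |w| ≤ S) :
    (w + q * u + q / 2) % q - q / 2 = w := by
  have h1 : q / 2 = S := by omega
  rw [abs_le] at hw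
  rw [h1, show w + q * u + S = w + S + q * u by ring, Int.add_mul_emod_self_left,
    Int.emod_eq_of_lt (by omega) (by omega)]
  ring

/-- The factor in the running time bound of the steps outside the matrix multiplication. -/
def nscConst : ℕ := tabsConst preTabs + productConst + tabsConst postTabs

/-- Correctness and running time of the convolution program: `B` bounds the rescaled inputs, `b` is
the length of the entries of the two matrices, and `L` is the length of all cells in use outside the
multiplication program. -/
theorem run_nscProg {p : Prog} {T : ℕ → ℕ → ℝ} (hp : MultipliesMatrices p T) {n m L R b : ℕ}
    {f g : ℕ → ℤ} {s : Memory} {B : ℤ} (hm : m = (n + 1) / 2)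
    (hL : 1 ≤ L) (hR : ((m + 1) * 4 ^ m + 1) * L ^ 2 ≤ R)
    (h0 : s 0 0 = n) (h1 : ∀ x : ℕ, s 1 x = f x) (h2 : ∀ x : ℕ, s 2 x = g x)
    (h3 : ∀ a, 3 ≤ a → s a = fun _ => 0) (hs : MemBdd s L)
    (hf : ∀ x, 4 ^ m ≤ x → f x = 0) (hg : ∀ x, 4 ^ m ≤ x → g x = 0)
    (hM : (m + 1) * 4 ^ m ≤ 2 ^ L) (hq : modulus m f g ≤ 2 ^ L)
    (hw : ∀ x < 4 ^ m, |wt (modulus m f g) x| ≤ 2 ^ L)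
    (hfB : ∀ x, |sc (modulus m f g) f x| ≤ B) (hgB : ∀ x, |sc (modulus m f g) g x| ≤ B)
    (hB : 2 ^ m * B < 2 ^ b) (hb : 2 * m + 2 * b ≤ L) :
    ∃ (t : ℕ) (s' : Memory), Exec (nscProg p) s t s' ∧ (t : ℝ) ≤ (nscConst * R : ℕ) + T (2 ^ m) b ∧
      ∀ x < 4 ^ m, |wedge (2 * m) f g x| ≤ ∑ y ∈ Finset.range (4 ^ m), (f y ^ 2 + g y ^ 2) →
        s' 3 x = wedge (2 * m) f g x := by
  have h4M : 4 ^ m ≤ (m + 1) * 4 ^ m := Nat.le_mul_of_pos_left _ (by omega)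
  have hbL : (2 : ℤ) ^ b ≤ 2 ^ L := pow_le_pow_right₀ (by norm_num) (by omega)
  obtain ⟨s1, ⟨t1, ht1, r1⟩, hprep⟩ := run_preTabs hm hL hR h0 h1 h2 h3 hs hf hg hM hq hw hfB hgB
    (hB.le.trans hbL)
  set q := modulus m f g with hqdef
  have hS : 0 ≤ ∑ y ∈ Finset.range (4 ^ m), (f y ^ 2 + g y ^ 2) :=
    Finset.sum_nonneg fun y _ => by positivity
  have hq0 : 0 < q := by
    simp only [hqdef, modulus]
    linarith
  obtain ⟨u, hu⟩ := MM_product q m f g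
  obtain ⟨t2, s2, r2, ht2, hs2⟩ := hp (2 ^ m) b (cliffordMatrix m (sc q f))
    (cliffordMatrix m (sc q g)) Nat.one_le_two_pow
    (fun i j => (abs_MM_le hfB i j).trans_lt hB) (fun i j => (abs_MM_le hgB i j).trans_lt hB)
  obtain ⟨s3, r3, hs3, f3⟩ := r2.shift 20 s1 hprep.input
  have hprod := MM_product_matrix hu
  -- a bound for the entries of the product
  have hP : ∀ x < 4 ^ m, |MM m (sc q fun x => wedge (2 * m) f g x + q * u x) (row x) (col x)| ≤
      2 ^ (m + 2 * b) := by
    intro x hx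
    rw [← hu _ _ (row_lt m x hx) (col_lt m x hx)]
    refine (Finset.abs_sum_le_sum_abs _ _).trans ?_
    refine (Finset.sum_le_card_nsmul _ _ (2 ^ b * 2 ^ b) fun k hk => ?_).trans (le_of_eq ?_)
    · have hk' := Finset.mem_range.1 hk
      rw [abs_mul]
      exact mul_le_mul ((abs_MM_le hfB ⟨row x, row_lt m x hx⟩ ⟨k, hk'⟩).trans hB.le)
        ((abs_MM_le hgB ⟨k, hk'⟩ ⟨col x, col_lt m x hx⟩).trans hB.le) (abs_nonneg _)
        (by positivity)
    · rw [Finset.card_range, nsmul_eq_mul]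
      push_cast
      ring
  obtain ⟨s4, ⟨t4, ht4, r4⟩, e4, f4, b4⟩ := run_product (s := s3) (m := m) (R := R)
    (P := fun x => MM m (sc q fun x => wedge (2 * m) f g x + q * u x) (row x) (col x)) hL
    ((Nat.mul_le_mul_right _ (by omega)).trans hR)
    (fun a ha i => by rw [f3 a ha]; exact hprep.bdd a ha i)
    (by rw [f3 16 (by norm_num)]; exact hprep.fresh 16 (by norm_num))
    (by rw [f3 7 (by norm_num)]; exact hprep.size)
    (by rw [f3 13 (by norm_num)]; exact hprep.pos) (h4M.trans hM)
    (fun x hx => by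
      rw [← hprod ⟨row x, row_lt m x hx⟩ ⟨col x, col_lt m x hx⟩, ← hs2]
      exact congrFun (hs3 3) _)
    (fun x hx => (hP x hx).trans (pow_le_pow_right₀ (by norm_num) (by omega)))
  have g4 : ∀ a, a < 20 → a ≠ 16 → a ≠ 4 → s4 a = s1 a := fun a h h' h'' =>
    (f4 a h' h'').trans (f3 a h)
  obtain ⟨s5, ⟨t5, ht5, r5⟩, e5⟩ := run_postTabs (s := s4) (w := wedge (2 * m) f g) (u := u)
    (q := q) (B := 2 ^ (m + 2 * b)) hm hL hR b4
    (by rw [g4 0 (by norm_num) (by norm_num) (by norm_num)]; exact hprep.num)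
    (by rw [g4 5 (by norm_num) (by norm_num) (by norm_num)]; exact hprep.pow)
    (by rw [g4 7 (by norm_num) (by norm_num) (by norm_num)]; exact hprep.size)
    (by rw [g4 8 (by norm_num) (by norm_num) (by norm_num)]; exact hprep.mod)
    (by rw [g4 10 (by norm_num) (by norm_num) (by norm_num)]; exact hprep.sign)
    (by rw [g4 11 (by norm_num) (by norm_num) (by norm_num)]; exact hprep.weight) e4
    (by rw [g4 17 (by norm_num) (by norm_num) (by norm_num)]; exact hprep.fresh 17 (by norm_num))
    (by rw [g4 3 (by norm_num) (by norm_num) (by norm_num)]; exact hprep.fresh 3 (by norm_num))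
    hM hq0 hq (by positivity) hP
    (by rw [← pow_add]; exact pow_le_pow_right₀ (by norm_num) (by omega))
  refine ⟨_, s5, .seq r1 (.seq r3 (.seq r4 r5)), ?_, fun x hx hle => ?_⟩
  · have : t1 + t4 + t5 ≤ nscConst * R := by
      rw [nscConst, add_mul, add_mul]
      omega
    have h' : ((t1 + t4 + t5 : ℕ) : ℝ) ≤ (nscConst * R : ℕ) := Nat.cast_le.2 this
    push_cast at h' ht2 ⊢
    linarith
  · rw [e5, cut_of_lt _ hx]
    exact balanced_emod rfl hle

/-! ### The running time -/

theorem wt_le_pow {q : ℤ} (hq : 1 ≤ q) (m x : ℕ) (hx : x < 4 ^ m) : wt q x ≤ q ^ m := by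
  induction m generalizing x with
  | zero =>
    obtain rfl : x = 0 := by simpa using hx
    simp [wt_zero]
  | succ m ih =>
    rw [pow_succ] at hx ⊢
    have h1 := ih (x / 4) (by omega)
    have h2 : (0 : ℤ) ≤ q ^ m := by positivity
    rw [wt]
    split_ifs
    · rw [← pow_succ]
      exact one_le_pow₀ hq
    · exact mul_le_mul_of_nonneg_right h1 (by omega)
    · nlinarith

theorem modulus_le {m b : ℕ} {f g : ℕ → ℤ} (hf : ∀ x, |f x| ≤ 2 ^ b) (hg : ∀ x, |g x| ≤ 2 ^ b) :
    modulus m f g ≤ 2 ^ (2 * m + 2 * b + 3) := by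
  have h1 : ∑ y ∈ Finset.range (4 ^ m), (f y ^ 2 + g y ^ 2) ≤
      ∑ y ∈ Finset.range (4 ^ m), 2 * ((2 : ℤ) ^ b) ^ 2 := by
    refine Finset.sum_le_sum fun y _ => ?_
    have e1 := sq_le_sq' (abs_le.1 (hf y)).1 (abs_le.1 (hf y)).2
    have e2 := sq_le_sq' (abs_le.1 (hg y)).1 (abs_le.1 (hg y)).2
    linarith
  rw [Finset.sum_const, Finset.card_range, nsmul_eq_mul] at h1
  have e : ((4 ^ m : ℕ) : ℤ) * (2 * ((2 : ℤ) ^ b) ^ 2) = 2 ^ (2 * m + 2 * b + 1) := by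
    rw [show (4 : ℕ) = 2 ^ 2 by norm_num, ← pow_mul]
    push_cast
    ring
  have h2 : (1 : ℤ) ≤ 2 ^ (2 * m + 2 * b + 1) := one_le_pow₀ (by norm_num)
  rw [show 2 * m + 2 * b + 3 = 2 * m + 2 * b + 1 + 2 by ring, pow_add (2 : ℤ) _ 2]
  unfold modulus
  rw [e] at h1
  linarith

theorem abs_sc_le {m b Λ : ℕ} {q : ℤ} (hq1 : 1 ≤ q) (hq : q ≤ 2 ^ Λ) {f : ℕ → ℤ}
    (hf : ∀ x, |f x| ≤ 2 ^ b) (hf0 : ∀ x, 4 ^ m ≤ x → f x = 0) (x : ℕ) :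
    |sc q f x| ≤ 2 ^ (m * Λ + b) := by
  rcases lt_or_ge x (4 ^ m) with hx | hx
  · have h1 := (wt_le_pow hq1 m x hx).trans (pow_le_pow_left₀ (by omega) hq m)
    rw [← pow_mul, mul_comm] at h1
    rw [sc, abs_mul, abs_of_pos (wt_pos (by omega) x), pow_add]
    exact mul_le_mul h1 (hf x) (abs_nonneg _) (by positivity)
  · rw [sc, hf0 x hx]
    simp

/-- The convolution program works in time `2 ^ (w n / 2)` up to a polynomial factor if the
multiplication program has exponent `w`. -/
theorem IsMatrixExponent.exists_computesNSC {w : ℝ} (hw : IsMatrixExponent w) :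
    ∃ (p : Prog) (C : ℝ) (c : ℕ),
      ComputesNSC p fun n b => C * (2 : ℝ) ^ (w * n / 2) * ((n : ℝ) + b + 1) ^ c := by
  have hw2 := hw.two_le
  obtain ⟨p, C, c, hp⟩ := hw
  refine ⟨nscProg p, (1323 * nscConst + |C| * 8 ^ c) * 2 ^ (w / 2), 5 + 2 * c, ?_⟩
  intro U _ _ b F G hF hG
  set n := Fintype.card U with hn
  set f := tableOf F with hfdef
  set g := tableOf G with hgdef
  set m := (n + 1) / 2 with hm
  -- bounds for the lengths of the modulus, of the matrix entries and of the cells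
  set Λ := 2 * m + 2 * b + 3 with hΛ
  set b' := m + (m * Λ + b) + 1 with hb'
  set L := 3 * m + 2 * b' + n + Λ with hLdef
  have hnm : 2 ^ n ≤ 4 ^ m := by
    rw [show (4 : ℕ) = 2 ^ 2 by norm_num, ← pow_mul]
    exact Nat.pow_le_pow_right (by norm_num) (by omega)
  have mono : ∀ k, k ≤ L → (2 : ℤ) ^ k ≤ 2 ^ L := fun k h => pow_le_pow_right₀ (by norm_num) h
  have hFb : ∀ i, |arrayOf subsetPos F i| ≤ 2 ^ b :=
    abs_arrayOf_le subsetPos_injective F _ (by positivity) fun X => (hF X).le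
  have hGb : ∀ i, |arrayOf subsetPos G i| ≤ 2 ^ b :=
    abs_arrayOf_le subsetPos_injective G _ (by positivity) fun X => (hG X).le
  have hf0 : ∀ x, 4 ^ m ≤ x → f x = 0 := fun x hx => tableOf_eq_zero F x (hnm.trans hx)
  have hg0 : ∀ x, 4 ^ m ≤ x → g x = 0 := fun x hx => tableOf_eq_zero G x (hnm.trans hx)
  have hq : modulus m f g ≤ 2 ^ Λ := modulus_le (fun x => hFb x) fun x => hGb x
  have hq1 : 1 ≤ modulus m f g := by
    have : 0 ≤ ∑ y ∈ Finset.range (4 ^ m), (f y ^ 2 + g y ^ 2) :=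
      Finset.sum_nonneg fun y _ => by positivity
    unfold modulus
    linarith
  have hM : (m + 1) * 4 ^ m ≤ 2 ^ L := by
    calc (m + 1) * 4 ^ m ≤ 2 ^ m * 2 ^ (2 * m) := by
          rw [pow_mul]
          exact Nat.mul_le_mul_right _ Nat.lt_two_pow_self
      _ = 2 ^ (3 * m) := by ring
      _ ≤ _ := Nat.pow_le_pow_right (by norm_num) (by omega)
  obtain ⟨t, s', hr, ht, hs⟩ := run_nscProg hp (n := n) (m := m) (L := L)
    (R := ((m + 1) * 4 ^ m + 1) * L ^ 2) (b := b') (f := f) (g := g) (B := 2 ^ (m * Λ + b))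
    (s := inputMemory n (arrayOf subsetPos F) (arrayOf subsetPos G)) hm (by omega) le_rfl
    (by simp [inputMemory]) (fun x => rfl) (fun x => rfl)
    (fun a ha => by
      match a, ha with
      | k + 3, _ => rfl)
    (fun a _ i => by
      match a with
      | 0 =>
        simp only [inputMemory]
        split_ifs
        · exact abs_natCast_le (Nat.lt_two_pow_self.le.trans
            (Nat.pow_le_pow_right (by norm_num) (by omega)))
        · simp
      | 1 => exact (hFb i).trans (mono _ (by omega))
      | 2 => exact (hGb i).trans (mono _ (by omega))
      | _ + 3 => simp [inputMemory])
    hf0 hg0 hM (hq.trans (mono _ (by omega)))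
    (fun x hx => by
      have h1 := (wt_le_pow hq1 m x hx).trans (pow_le_pow_left₀ (by omega) hq m)
      rw [← pow_mul, mul_comm] at h1
      rw [abs_of_pos (wt_pos (by omega) x)]
      exact h1.trans (mono _ (by omega)))
    (abs_sc_le hq1 hq (fun x => hFb x) hf0) (abs_sc_le hq1 hq (fun x => hGb x) hg0)
    (by rw [← pow_add]; exact pow_lt_pow_right₀ (by norm_num) (by omega)) (by omega)
  refine ⟨t, s', hr, ht.trans ?_, fun X => ?_⟩
  · set k := n + b + 1 with hk
    have hk1 : 1 ≤ k := by omega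
    have hmk : m ≤ k := by omega
    have hkk : k ≤ k ^ 2 := Nat.le_self_pow (by norm_num) k
    have hmΛk : m * Λ ≤ 4 * k ^ 2 := by
      calc m * Λ ≤ k * (4 * k) := Nat.mul_le_mul hmk (by omega)
        _ = 4 * k ^ 2 := by ring
    have hb'k : b' + m + 1 ≤ 8 * k ^ 2 := by omega
    have hLk : L ≤ 21 * k ^ 2 := by omega
    have hRk : ((m + 1) * 4 ^ m + 1) * L ^ 2 ≤ 1323 * k ^ 5 * 4 ^ m := by
      have e1 : (m + 1) * 4 ^ m + 1 ≤ 3 * k * 4 ^ m := by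
        have : 1 ≤ 4 ^ m := Nat.one_le_pow _ _ (by norm_num)
        nlinarith
      calc ((m + 1) * 4 ^ m + 1) * L ^ 2 ≤ (3 * k * 4 ^ m) * (21 * k ^ 2) ^ 2 :=
            Nat.mul_le_mul e1 (Nat.pow_le_pow_left hLk 2)
        _ = _ := by ring
    have hkR : ((n : ℝ) + b + 1) = (k : ℝ) := by
      rw [hk]
      push_cast
      ring
    have hk1R : (1 : ℝ) ≤ k := by exact_mod_cast hk1
    -- `(2 ^ m) ^ w ≤ 2 ^ (w / 2) * 2 ^ (w * n / 2)`, as `2 * m ≤ n + 1`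
    have hpow : ((2 ^ m : ℕ) : ℝ) ^ w ≤ 2 ^ (w / 2) * 2 ^ (w * n / 2) := by
      have h2m : (2 : ℝ) * m ≤ n + 1 := by
        exact_mod_cast (show 2 * m ≤ n + 1 by omega)
      rw [← Real.rpow_add (by norm_num)]
      push_cast
      rw [← Real.rpow_natCast, ← Real.rpow_mul (by norm_num)]
      refine Real.rpow_le_rpow_of_exponent_le (by norm_num) ?_
      nlinarith
    have hfour : ((4 ^ m : ℕ) : ℝ) ≤ ((2 ^ m : ℕ) : ℝ) ^ w := by
      have e1 : ((4 ^ m : ℕ) : ℝ) = ((2 ^ m : ℕ) : ℝ) ^ (2 : ℝ) := by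
        rw [← pow_mul_pow_two]
        push_cast
        rw [← sq, ← Real.rpow_natCast]
        norm_num
      rw [e1]
      exact Real.rpow_le_rpow_of_exponent_le (by exact_mod_cast Nat.one_le_two_pow) hw2
    set W := ((2 ^ m : ℕ) : ℝ) ^ w with hW
    have hW0 : 0 ≤ W := by positivity
    have hT1 : ((nscConst * (((m + 1) * 4 ^ m + 1) * L ^ 2) : ℕ) : ℝ) ≤
        1323 * nscConst * W * (k : ℝ) ^ (5 + 2 * c) := by
      have e1 : ((nscConst * (((m + 1) * 4 ^ m + 1) * L ^ 2) : ℕ) : ℝ) ≤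
          ((nscConst * (1323 * k ^ 5 * 4 ^ m) : ℕ) : ℝ) :=
        Nat.cast_le.2 (Nat.mul_le_mul_left _ hRk)
      refine e1.trans ?_
      rw [Nat.cast_mul, Nat.cast_mul (1323 * k ^ 5)]
      have e2 : ((1323 * k ^ 5 : ℕ) : ℝ) ≤ 1323 * (k : ℝ) ^ (5 + 2 * c) := by
        push_cast
        exact mul_le_mul_of_nonneg_left (pow_le_pow_right₀ hk1R (by omega)) (by norm_num)
      calc (nscConst : ℝ) * (((1323 * k ^ 5 : ℕ) : ℝ) * ((4 ^ m : ℕ) : ℝ)) ≤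
          nscConst * ((1323 * (k : ℝ) ^ (5 + 2 * c)) * W) := by gcongr
        _ = _ := by ring
    have hT2 : C * W * ((b' : ℝ) + Nat.log 2 (2 ^ m) + 1) ^ c ≤
        |C| * 8 ^ c * W * (k : ℝ) ^ (5 + 2 * c) := by
      rw [Nat.log_pow Nat.one_lt_two]
      have e1 : (b' : ℝ) + m + 1 ≤ 8 * (k : ℝ) ^ 2 := by exact_mod_cast hb'k
      have e2 : ((b' : ℝ) + m + 1) ^ c ≤ 8 ^ c * (k : ℝ) ^ (5 + 2 * c) := by
        calc ((b' : ℝ) + m + 1) ^ c ≤ (8 * (k : ℝ) ^ 2) ^ c :=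
              pow_le_pow_left₀ (by positivity) e1 c
          _ = 8 ^ c * (k : ℝ) ^ (2 * c) := by rw [mul_pow, ← pow_mul]
          _ ≤ _ := by
            gcongr
            omega
      calc C * W * ((b' : ℝ) + m + 1) ^ c ≤ |C| * W * (8 ^ c * (k : ℝ) ^ (5 + 2 * c)) := by
            gcongr
            exact le_abs_self C
        _ = _ := by ring
    simp only [hkR]
    calc _ ≤ 1323 * nscConst * W * (k : ℝ) ^ (5 + 2 * c) +
          |C| * 8 ^ c * W * (k : ℝ) ^ (5 + 2 * c) := add_le_add hT1 hT2
      _ = (1323 * nscConst + |C| * 8 ^ c) * W * (k : ℝ) ^ (5 + 2 * c) := by ring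
      _ ≤ (1323 * nscConst + |C| * 8 ^ c) * (2 ^ (w / 2) * 2 ^ (w * n / 2)) *
          (k : ℝ) ^ (5 + 2 * c) := by gcongr
      _ = _ := by ring
  · have hX : subsetPos X < 4 ^ m := (subsetPos_lt X).trans_le hnm
    have hwX : wedge (2 * m) f g (subsetPos X) = nsc F G X :=
      wedge_subsetPos (2 * m) (by omega) F G X
    have := hs _ hX (by rw [hwX]; exact abs_nsc_le (4 ^ m) hnm F G X)
    rw [hwX] at this
    exact this

end NSC

theorem mainTheorem4 :
    (∀ w : ℝ, NSC.omega < w →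
      ∃ (p : NSC.Prog) (C : ℝ) (c : ℕ),
        NSC.ComputesNSC p fun n b => C * (2 : ℝ) ^ (w * n / 2) * ((n : ℝ) + b + 1) ^ c) ∧
    (∀ w : ℝ, NSC.IsMatrixExponent w →
      ∃ (p : NSC.Prog) (C : ℝ) (c : ℕ),
        NSC.ComputesNSC p fun n b => C * (2 : ℝ) ^ (w * n / 2) * ((n : ℝ) + b + 1) ^ c) := by
  refine ⟨fun w hw => ?_, fun w hw => hw.exists_computesNSC⟩
  -- the exponent `3` is admissible, so `omega` is the infimum of a nonempty set
  obtain ⟨v, hv, hvw⟩ := exists_lt_of_csInf_lt ⟨3, NSC.isMatrixExponent_three⟩ hw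
  obtain ⟨p, C, c, hp⟩ := NSC.IsMatrixExponent.exists_computesNSC hv
  refine ⟨p, |C|, c, ?_⟩
  intro U _ _ b f g hf hg
  obtain ⟨t, s', hr, ht, hs⟩ := hp U b f g hf hg
  refine ⟨t, s', hr, ht.trans ?_, hs⟩
  have h : (2 : ℝ) ^ (v * Fintype.card U / 2) ≤ 2 ^ (w * Fintype.card U / 2) :=
    Real.rpow_le_rpow_of_exponent_le (by norm_num) (by gcongr)
  dsimp only
  gcongr
  exact le_abs_self C
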